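/- Let $X$ be a quasi-compact, quasi-separated scheme and let $\mathrm{Qcoh}(X)$ be the abelian category of quasi-coherent sheaves of $\mathcal O_X$-modules. *Definitions.* A localizing subcategory of an abelian category $\mathcal C$ is a full subcategory $\mathcal S$ closed under subobjects, quotient objects, extensions and direct limits. The quotient category $\mathcal C/\mathcal S$ is obtained by inverting the morphisms whose kernel and cokernel lie in $\mathcal S$. An object $Z$ is $\mathcal S$-closed if $\mathrm{Hom}(B,Z)\to\mathrm{Hom}(A,Z)$ is bijective for each such morphism $A\to B$. The subcategory $\mathcal S$ is of finite type if the inclusion into $\mathcal C$ of the full subcategory of $\mathcal S$-closed objects (which is equivalent to $\mathcal C/\mathcal S$) preserves directed sums, that is, colimits of directed systems of monomorphisms. A localizing subcategory $\mathcal S$ of $\mathrm{Qcoh}(X)$ is tensor if $\mathcal F\otimes_{\mathcal O_X}\mathcal G\in\mathcal S$ for all $\mathcal F\in\mathcal S$ and $\mathcal G\in\mathrm{Qcoh}(X)$. Let $L$ be the collection of tensor localizing subcategories of finite type of $\mathrm{Qcoh}(X)$, ordered by inclusion and with intersection as multiplication. Its largest element is $\mathrm{Qcoh}(X)$. An element $\mathcal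 P\neq\mathrm{Qcoh}(X)$ of $L$ is prime if, for all $\mathcal A,\mathcal B\in L$, $\mathcal A\cap\mathcal B\subseteq\mathcal P$ implies $\mathcal A\subseteq\mathcal P$ or $\mathcal B\subseteq\mathcal P$. Let $\mathrm{Spec}\,L$ be the set of prime elements with the topology generated by the sets $D(\mathcal A)=\{\mathcal P : \mathcal A\not\subseteq\mathcal P\}$, $\mathcal A\in L$, and let $\mathrm{Spec}(\mathrm{Qcoh}\,X)$ be the same set with the Hochster dual topology, in which the open sets are the unions of complements of quasi-compact open subsets of $\mathrm{Spec}\,L$. For $\mathcal F\in\mathrm{Qcoh}(X)$ put $\mathrm{supp}(\mathcal F)=\{\mathcal P : \mathcal F\notin\mathcal P\}$, and for an open $U\subseteq\mathrm{Spec}(\mathrm{Qcoh}\,X)$ put $\mathcal S_U=\{\mathcal F : \mathrm{supp}(\mathcal F)\cap U=\emptyset\}$. Let $\mathcal O_{\mathrm{Qcoh}\,X}$ be the sheaf of rings associated with the presheaf $U\mapsto\mathrm{End}_{\mathrm{Qcoh}(X)/\mathcal S_U}(\mathcal O_X)$, whose restriction maps are induced by the quotient functors $\mathrm{Qcoh}(X)/\mathcal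 S_U\to\mathrm{Qcoh}(X)/\mathcal S_V$ for $V\subseteq U$. *Theorem.* The open subsets of $\mathrm{Spec}\,L$ are exactly the sets $D(\mathcal A)$, $\mathcal A\in L$ (equivalently, the closed subsets are exactly the sets $V(\mathcal A)=\{\mathcal P:\mathcal A\subseteq\mathcal P\}$). The map $$f\colon X\to\mathrm{Spec}(\mathrm{Qcoh}\,X),\qquad P\mapsto\mathcal S_P=\{\mathcal F\in\mathrm{Qcoh}(X) : \mathcal F_P=0\},$$ is well defined and underlies an isomorphism of ringed spaces $(X,\mathcal O_X)\cong(\mathrm{Spec}(\mathrm{Qcoh}\,X),\mathcal O_{\mathrm{Qcoh}\,X})$. That is, $f$ is a homeomorphism and there are ring isomorphisms $f^\sharp_U\colon\mathcal O_{\mathrm{Qcoh}\,X}(U)\to\mathcal O_X(f^{-1}(U))$, for $U$ open in $\mathrm{Spec}(\mathrm{Qcoh}\,X)$, compatible with restriction. Moreover $f^\sharp$ is induced by the restriction $\mathcal F\mapsto\mathcal F|_{f^{-1}(U)}$: if $\varphi\in\mathrm{End}_{\mathrm{Qcoh}(X)/\mathcal S_U}(\mathcal O_X)$ and if $s,a\colon\mathcal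 O_X\to\mathcal F$ are morphisms in $\mathrm{Qcoh}(X)$ such that the kernel and cokernel of $s$ lie in $\mathcal S_U$ and $s\circ\varphi=a$ in $\mathrm{Qcoh}(X)/\mathcal S_U$, then $s(f^\sharp_U(\varphi))=a(1)$ in $\mathcal F(f^{-1}(U))$. -/

import Mathlib

open CategoryTheory Limits AlgebraicGeometry TopologicalSpace Opposite

universe u

namespace Reconstruction

noncomputable section

open scoped ZeroObject

/-! ### The abelian category of quasi-coherent sheaves -/

/-- The property of a sheaf of modules of being quasi-coherent. -/
def isQcoh (X : Scheme.{u}) : ObjectProperty X.Modules := fun M => M.IsQuasicoherent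

lemma isQcoh_iso {X : Scheme.{u}} {M N : X.Modules} (e : M ≅ N) (h : isQcoh X M) : isQcoh X N := by
  exact (SheafOfModules.isQuasicoherent.{u} X.ringCatSheaf).prop_of_iso
    (X := M) (Y := N) e h

lemma isQcoh_spec_iff {R : CommRingCat.{u}} (M : (Spec R).Modules) :
    isQcoh _ M ↔ ∃ A : ModuleCat R, Nonempty (tilde A ≅ M) :=
  (iff_of_eq (congrFun (essImage_tilde (R := R)) M)).symm

lemma presentation_of_iso {X : Scheme.{u}} {M N : X.Modules} (e : M ≅ N)
    (P : SheafOfModules.Presentation M) : Nonempty (SheafOfModules.Presentation N) := by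
  have h : ∀ {M N : SheafOfModules.{u} X.ringCatSheaf} (_ : M ≅ N) (_ : M.Presentation),
      Nonempty N.Presentation :=
    fun e P => ⟨SheafOfModules.Presentation.ofIsIso.{u, u, u} e.hom P⟩
  exact h (M := M) (N := N) ⟨e.hom, e.inv, e.hom_inv_id, e.inv_hom_id⟩ P

lemma nonempty_presentation {R : CommRingCat.{u}} (M : (Spec R).Modules) (h : isQcoh _ M) :
    Nonempty (SheafOfModules.Presentation M) := by
  obtain ⟨A, ⟨e⟩⟩ := (isQcoh_spec_iff M).1 h
  exact presentation_of_iso e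
    (presentationTilde.{u} _ .univ (by simp) _ (Submodule.span_eq _))

/-- Quasi-coherence may be checked on the affine open subsets. -/
lemma isQcoh_of_restrict {X : Scheme.{u}} (M : X.Modules)
    (h : ∀ (U : X.Opens) (hU : IsAffineOpen U), isQcoh _ (M.restrict hU.fromSpec)) :
    isQcoh X M := by
  have key : ∀ U : X.affineOpens, Nonempty
      ((SheafOfModules.over (R := X.ringCatSheaf) M U.1).Presentation) := by
    intro U
    have hU : IsAffineOpen U.1 := U.2
    generalize U.1 = U at hU ⊢
    obtain ⟨P⟩ := nonempty_presentation _ (h U hU)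
    let e₁ : (M.restrict hU.fromSpec).restrict hU.isoSpec.hom ≅ M.restrict U.ι :=
      (Scheme.Modules.restrictFunctorComp hU.isoSpec.hom hU.fromSpec).symm.app M ≪≫
        (Scheme.Modules.restrictFunctorCongr (by simp)).app M
    let e₂ : (Scheme.Modules.overEquiv U).functor.obj
        ((SheafOfModules.overFunctor X.ringCatSheaf U).obj M) ≅ M.restrict U.ι :=
      (Scheme.Modules.overFunctorEquiv U).app M
    obtain ⟨P₁⟩ := presentation_of_iso (e₁ ≪≫ e₂.symm)
        (Scheme.Modules.presentationRestrict hU.isoSpec.hom P)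
    let η : (Scheme.Modules.overEquiv U).functor.obj
        (SheafOfModules.unit (X.ringCatSheaf.over U)) ≅
        SheafOfModules.unit U.toScheme.ringCatSheaf :=
      (Scheme.Modules.overFunctorEquiv U).app (SheafOfModules.unit X.ringCatSheaf) ≪≫
        Scheme.Modules.restrictUnitIso U.ι
    let η' : SheafOfModules.unit (X.ringCatSheaf.over U) ≅
        (Scheme.Modules.overEquiv U).inverse.obj (SheafOfModules.unit U.toScheme.ringCatSheaf) :=
      (Scheme.Modules.overEquiv U).unitIso.app _ ≪≫ (Scheme.Modules.overEquiv U).inverse.mapIso η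
    have h₁ : PreservesColimitsOfSize.{u, u} (Scheme.Modules.overEquiv U).inverse := inferInstance
    let G : SheafOfModules.{u} U.toScheme.ringCatSheaf ⥤ SheafOfModules.{u} (X.ringCatSheaf.over U) :=
      (Scheme.Modules.overEquiv U).inverse
    have h₂ : PreservesColimitsOfSize.{u, u} G := h₁
    let e₃ : G.obj ((Scheme.Modules.overEquiv U).functor.obj
        ((SheafOfModules.overFunctor X.ringCatSheaf U).obj M)) ≅ SheafOfModules.over M U :=
      ((Scheme.Modules.overEquiv U).unitIso.app _).symm
    exact ⟨SheafOfModules.Presentation.ofIsIso.{u, u, u} e₃.hom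
      (SheafOfModules.Presentation.map P₁ G η')⟩
  refine SheafOfModules.QuasicoherentData.isQuasicoherent.{u, u, u, u} (M := M)
    { I := X.affineOpens, X := fun U => U.1, coversTop := ?_, presentation := fun U => (key U).some }
  rw [Opens.coversTop_iff]
  exact iSup_affineOpens_eq_top X

lemma isQcoh_restrict {X Y : Scheme.{u}} (f : X ⟶ Y) [IsOpenImmersion f] (M : Y.Modules)
    (h : isQcoh Y M) : isQcoh X (M.restrict f) := by
  have : M.IsQuasicoherent := h
  exact Scheme.Modules.isQuasicoherent_restrictFunctor f M

lemma isQcoh_unit (X : Scheme.{u}) : isQcoh X (SheafOfModules.unit X.ringCatSheaf) := by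
  refine isQcoh_of_restrict _ fun U hU => ?_
  refine isQcoh_iso (Scheme.Modules.restrictUnitIso hU.fromSpec).symm ?_
  exact (isQcoh_spec_iff _).2 ⟨_, ⟨tildeSelf⟩⟩

lemma isQcoh_cokernel_spec {R : CommRingCat.{u}} {M N : (Spec R).Modules} (f : M ⟶ N)
    (hM : isQcoh _ M) (hN : isQcoh _ N) : isQcoh _ (cokernel f) := by
  obtain ⟨A, ⟨e₁⟩⟩ := (isQcoh_spec_iff M).1 hM
  obtain ⟨B, ⟨e₂⟩⟩ := (isQcoh_spec_iff N).1 hN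
  obtain ⟨g, hg⟩ := (tilde.functor R).map_surjective (X := A) (Y := B) (e₁.hom ≫ f ≫ e₂.inv)
  refine (isQcoh_spec_iff _).2 ⟨cokernel g, ⟨PreservesCokernel.iso (tilde.functor R) g ≪≫
    cokernel.mapIso _ _ e₁ e₂ ?_⟩⟩
  have h : (e₁.hom ≫ f ≫ e₂.inv) ≫ e₂.hom = e₁.hom ≫ f := by simp
  exact (congrArg (· ≫ e₂.hom) hg).trans h

lemma isQcoh_coprod_spec {R : CommRingCat.{u}} {M N : (Spec R).Modules}
    (hM : isQcoh _ M) (hN : isQcoh _ N) : isQcoh _ (M ⨿ N) := by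
  obtain ⟨A, ⟨e₁⟩⟩ := (isQcoh_spec_iff M).1 hM
  obtain ⟨B, ⟨e₂⟩⟩ := (isQcoh_spec_iff N).1 hN
  exact (isQcoh_spec_iff _).2 ⟨A ⨿ B,
    ⟨(PreservesColimitPair.iso (tilde.functor R) _ _).symm ≪≫ coprod.mapIso e₁ e₂⟩⟩

lemma isQcoh_cokernel {X : Scheme.{u}} {M N : X.Modules} (f : M ⟶ N)
    (hM : isQcoh _ M) (hN : isQcoh _ N) : isQcoh _ (cokernel f) := by
  refine isQcoh_of_restrict _ fun U hU => ?_
  exact isQcoh_iso (PreservesCokernel.iso (Scheme.Modules.restrictFunctor hU.fromSpec) f).symm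
    (isQcoh_cokernel_spec _ (isQcoh_restrict _ _ hM) (isQcoh_restrict _ _ hN))

lemma isQcoh_coprod {X : Scheme.{u}} {M N : X.Modules}
    (hM : isQcoh _ M) (hN : isQcoh _ N) : isQcoh _ (M ⨿ N) := by
  refine isQcoh_of_restrict _ fun U hU => ?_
  exact isQcoh_iso (PreservesColimitPair.iso (Scheme.Modules.restrictFunctor hU.fromSpec) _ _)
    (isQcoh_coprod_spec (isQcoh_restrict _ _ hM) (isQcoh_restrict _ _ hN))


lemma app_smul_spec {R : CommRingCat.{u}} {M N : (Spec R).Modules} (g : M ⟶ N)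
    (V : (Spec R).Opens) (r : R) (x : Γ(M, V)) : g.app V (r • x) = r • g.app V x := by
  rw [Scheme.Modules.smul_Spec_def, Scheme.Modules.smul_Spec_def, Scheme.Modules.Hom.app_smul]

lemma app_res {X : Scheme.{u}} {M N : X.Modules} (g : M ⟶ N) {U V : X.Opens} (h : U ≤ V)
    (x : Γ(M, V)) :
    g.app U (M.presheaf.map (homOfLE h).op x) = N.presheaf.map (homOfLE h).op (g.app V x) :=
  congr($(g.mapPresheaf.naturality (homOfLE h).op) x)

/-- The basic open subset of an affine scheme. -/
def specBasicOpen {R : CommRingCat.{u}} (f : R) : (Spec R).Opens := PrimeSpectrum.basicOpen f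

lemma isLocalizing_iff_spec {R : CommRingCat.{u}} (M : (Spec R).Modules) :
    isQcoh _ M ↔ ∀ f : R,
      (∀ x : Γ(M, specBasicOpen f), ∃ (n : ℕ) (y : Γ(M, ⊤)),
        M.presheaf.map (homOfLE le_top).op y = f ^ n • x) ∧
      (∀ y : Γ(M, ⊤), M.presheaf.map (homOfLE (le_top : specBasicOpen f ≤ ⊤)).op y = 0 →
        ∃ n : ℕ, f ^ n • y = 0) := by
  refine ((isQuasicoherent_iff_isIso_fromTildeΓ M).trans
    (isIso_fromTildeΓ_iff_isLocalizing M)).trans (forall_congr' fun f => ⟨fun h => ?_, fun h => ?_⟩)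
  · refine ⟨fun x => ?_, fun y hy => ?_⟩
    · have h' : IsLocalizedModule.Away f
        ((modulesSpecToSheaf.obj M).obj.map (PrimeSpectrum.basicOpen f).leTop.op).hom := h
      obtain ⟨n, y, hy⟩ := h'.surj _ _ x
      exact ⟨n, y, hy.symm⟩
    · obtain ⟨⟨_, n, rfl⟩, hn⟩ := (IsLocalizedModule.eq_zero_iff (.powers f)
        ((modulesSpecToSheaf.obj M).obj.map (PrimeSpectrum.basicOpen f).leTop.op).hom).mp hy
      exact ⟨n, hn⟩
  · refine IsLocalizedModule.Away.mk_of_addCommGroup ?_ ?_ ?_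
    · exact Scheme.Modules.isUnit_algebraMap_end_of_le_basicOpen f le_rfl
    · intro x
      obtain ⟨n, y, hy⟩ := h.1 x
      exact ⟨n, y, hy.symm⟩
    · intro y hy
      exact h.2 y hy

lemma isQcoh_of_exact_spec {R : CommRingCat.{u}} {K M N : (Spec R).Modules} (i : K ⟶ M) (g : M ⟶ N)
    (hM : isQcoh _ M) (hN : isQcoh _ N)
    (hi : ∀ V, Function.Injective (i.app V)) (hig : ∀ V x, g.app V x = 0 ↔ ∃ y, i.app V y = x) :
    isQcoh _ K := by
  rw [isLocalizing_iff_spec] at hM hN ⊢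
  refine fun f => ⟨fun x => ?_, fun y hy => ?_⟩
  · obtain ⟨n, y, hy⟩ := (hM f).1 (i.app _ x)
    have h₀ : N.presheaf.map (homOfLE (le_top : specBasicOpen f ≤ ⊤)).op
        (g.app ⊤ y) = 0 := by
      rw [← app_res, hy, app_smul_spec, (hig _ _).2 ⟨x, rfl⟩, smul_zero]
    obtain ⟨m, hm⟩ := (hN f).2 _ h₀
    rw [← app_smul_spec] at hm
    obtain ⟨z, hz⟩ := (hig _ _).1 hm
    refine ⟨m + n, z, hi _ ?_⟩
    rw [app_res, hz, app_smul_spec, pow_add, mul_smul, ← hy]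
    exact Scheme.Modules.map_smul_Spec _ _ _
  · have h₀ : M.presheaf.map (homOfLE (le_top : specBasicOpen f ≤ ⊤)).op
        (i.app ⊤ y) = 0 := by
      rw [← app_res, hy, map_zero]
    obtain ⟨n, hn⟩ := (hM f).2 _ h₀
    refine ⟨n, hi _ ?_⟩
    rw [app_smul_spec, hn, map_zero]

lemma kernel_app {X : Scheme.{u}} {M N : X.Modules} (g : M ⟶ N) (V : X.Opens) :
    Function.Injective ((kernel.ι g).app V) ∧
      ∀ x, g.app V x = 0 ↔ ∃ y, (kernel.ι g).app V y = x := by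
  let E : TopCat.Presheaf Ab X ⥤ Ab := (evaluation X.Opensᵒᵖ Ab).obj (op V)
  let F : X.Modules ⥤ Ab := Scheme.Modules.toPresheaf X ⋙ E
  have hF : (F.map (kernel.ι g)) = (kernel.ι g).app V := rfl
  have : PreservesLimits (Scheme.Modules.toPresheaf X) := inferInstance
  have : PreservesLimitsOfSize.{0, 0} (Scheme.Modules.toPresheaf X) :=
    preservesLimitsOfSize_shrink _
  have : PreservesLimitsOfShape WalkingParallelPair E :=
    inferInstanceAs (PreservesLimitsOfShape WalkingParallelPair
      ((evaluation X.Opensᵒᵖ Ab.{u}).obj (op V)))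
  have : PreservesLimitsOfShape WalkingParallelPair F :=
    comp_preservesLimitsOfShape _ _
  have : F.PreservesZeroMorphisms := ⟨fun _ _ => rfl⟩
  have hl := KernelFork.mapIsLimit _ (kernelIsKernel g) F
  let S : ShortComplex Ab := ShortComplex.mk (F.map (kernel.ι g)) (F.map g)
    (by rw [← F.map_comp, kernel.condition]; rfl)
  have hS : S.Exact := S.exact_of_f_is_kernel hl
  have hm : Mono S.f := mono_of_isLimit_fork hl
  refine ⟨(AddCommGrpCat.mono_iff_injective S.f).1 hm, fun x => ⟨fun h => ?_, ?_⟩⟩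
  · exact (ShortComplex.ab_exact_iff S).1 hS x h
  · rintro ⟨y, rfl⟩
    exact S.ab_zero_apply y

lemma isQcoh_kernel {X : Scheme.{u}} {M N : X.Modules} (f : M ⟶ N)
    (hM : isQcoh _ M) (hN : isQcoh _ N) : isQcoh _ (kernel f) := by
  refine isQcoh_of_restrict _ fun U hU => ?_
  exact isQcoh_of_exact_spec
    ((Scheme.Modules.restrictFunctor hU.fromSpec).map (kernel.ι f))
    ((Scheme.Modules.restrictFunctor hU.fromSpec).map f)
    (isQcoh_restrict _ _ hM) (isQcoh_restrict _ _ hN)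
    (fun V => (kernel_app f (hU.fromSpec ''ᵁ V)).1) (fun V => (kernel_app f (hU.fromSpec ''ᵁ V)).2)

instance (X : Scheme.{u}) : (isQcoh X).IsClosedUnderIsomorphisms :=
  ⟨fun e h => isQcoh_iso e h⟩

instance (X : Scheme.{u}) : (isQcoh X).IsClosedUnderKernels where
  kernels_le := by
    rintro _ ⟨f, k, hk, hf⟩
    exact isQcoh_iso ((kernelIsKernel f).conePointUniqueUpToIso hk) (isQcoh_kernel f hf.1 hf.2)

instance (X : Scheme.{u}) : (isQcoh X).IsClosedUnderCokernels where
  cokernels_le := by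
    rintro _ ⟨f, k, hk, hf⟩
    exact isQcoh_iso ((cokernelIsCokernel f).coconePointUniqueUpToIso hk)
      (isQcoh_cokernel f hf.1 hf.2)

instance (X : Scheme.{u}) : (isQcoh X).ContainsZero where
  exists_zero := ⟨_, isZero_cokernel_of_epi (𝟙 (SheafOfModules.unit X.ringCatSheaf : X.Modules)),
    isQcoh_cokernel _ (isQcoh_unit X) (isQcoh_unit X)⟩

instance (X : Scheme.{u}) : (isQcoh X).IsClosedUnderBinaryProducts where
  limitsOfShape_le := by
    rintro M ⟨p⟩
    let e : M ≅ p.diag.obj ⟨.left⟩ ⨯ p.diag.obj ⟨.right⟩ :=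
      p.isLimit.conePointUniqueUpToIso
        ((IsLimit.postcomposeHomEquiv (diagramIsoPair p.diag).symm _).symm (prodIsProd _ _))
    refine isQcoh_iso (e ≪≫ (biprod.isoProd _ _).symm ≪≫ biprod.isoCoprod _ _).symm
      (isQcoh_coprod (p.prop_diag_obj _) (p.prop_diag_obj _))

instance (X : Scheme.{u}) : (isQcoh X).IsClosedUnderFiniteProducts := .mk'

/-- The category of quasi-coherent sheaves on `X`. -/
abbrev Qcoh (X : Scheme.{u}) := (isQcoh X).FullSubcategory

/-- The structure sheaf, as an object of `Qcoh X`. -/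
def structureModule (X : Scheme.{u}) : Qcoh X := ⟨SheafOfModules.unit X.ringCatSheaf, isQcoh_unit X⟩

/-! ### Localizing subcategories and quotient categories -/

section Localizing

universe v w
variable {C : Type w} [Category.{v} C] [Abelian C]

/-- A localizing subcategory: a Serre subcategory closed under direct limits. -/
class IsLocalizingSubcategory (S : ObjectProperty C) : Prop extends S.IsSerreClass where
  closedUnderFilteredColimits (J : Type v) [SmallCategory J] [IsFiltered J] :
    S.IsClosedUnderColimitsOfShape J

/-- The `S`-closed objects: those `Z` such that `Hom(B, Z) → Hom(A, Z)` is bijective for every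
`A ⟶ B` whose kernel and cokernel are in `S`; equivalently, `Hom(A, Z) = 0` and `Ext¹(A, Z) = 0` for
every `A` in `S`. -/
def closedObjects (S : ObjectProperty C) [S.IsSerreClass] : ObjectProperty C :=
  S.isoModSerre.isLocal

/-- `S` is of finite type if the inclusion of the full subcategory of `S`-closed objects (which is
the inclusion `C/S ⥤ C`) preserves directed sums, that is the colimits of directed systems of
monomorphisms. -/
def IsOfFiniteType (S : ObjectProperty C) [S.IsSerreClass] : Prop :=
  ∀ (J : Type v) [PartialOrder J] [IsDirectedOrder J] [Nonempty J]
    (F : J ⥤ (closedObjects S).FullSubcategory),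
    (∀ {i j : J} (f : i ⟶ j), Mono (F.map f)) → PreservesColimit F (closedObjects S).ι

/-- The quotient category `C/S`: the category obtained from `C` by inverting the morphisms whose
kernel and cokernel are in `S`. -/
abbrev QuotientCategory (S : ObjectProperty C) [S.IsSerreClass] := S.isoModSerre.Localization

/-- The quotient functor `C ⥤ C/S`. -/
abbrev toQuotient (S : ObjectProperty C) [S.IsSerreClass] : C ⥤ QuotientCategory S :=
  S.isoModSerre.Q

variable {S T R : ObjectProperty C} [S.IsSerreClass] [T.IsSerreClass] [R.IsSerreClass]

lemma isInvertedBy_toQuotient (h : S ≤ T) : S.isoModSerre.IsInvertedBy (toQuotient T) :=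
  fun _ _ f hf => T.isoModSerre.Q_inverts f ⟨h _ hf.1, h _ hf.2⟩

/-- The functor `C/S ⥤ C/T` induced by the quotient functors when `S ⊆ T`. -/
def quotientFunctor (h : S ≤ T) : QuotientCategory S ⥤ QuotientCategory T :=
  Localization.Construction.lift (toQuotient T) (isInvertedBy_toQuotient h)

lemma toQuotient_comp (h : S ≤ T) : toQuotient S ⋙ quotientFunctor h = toQuotient T :=
  Localization.Construction.fac _ _

instance (h : S ≤ T) : (quotientFunctor h).Additive := by
  rw [Localization.functor_additive_iff (toQuotient S) S.isoModSerre, toQuotient_comp]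
  infer_instance

/-- The ring `End_{C/S}(A)` of endomorphisms of the image of `A` in the quotient category. -/
def quotientEnd (S : ObjectProperty C) [S.IsSerreClass] (A : C) : RingCat.{max v w} :=
  RingCat.of (End ((toQuotient S).obj A))

/-- The ring homomorphism `End_{C/S}(A) → End_{C/T}(A)` induced by the functor `C/S ⥤ C/T` when
`S ⊆ T`. -/
def quotientEndMap (A : C) (h : S ≤ T) : quotientEnd S A ⟶ quotientEnd T A :=
  RingCat.ofHom
    { toFun := fun φ => (quotientFunctor h).map φ
      map_one' := (quotientFunctor h).map_id _
      map_mul' := fun φ ψ => (quotientFunctor h).map_comp ψ φ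
      map_zero' := (quotientFunctor h).map_zero _ _
      map_add' := fun _ _ => (quotientFunctor h).map_add }

lemma quotientEndMap_refl (A : C) : quotientEndMap A (le_refl S) = 𝟙 (quotientEnd S A) := by
  have h : quotientFunctor (le_refl S) = 𝟭 _ :=
    Localization.Construction.uniq _ _ (toQuotient_comp _)
  ext φ
  exact (Functor.congr_hom h (X := (toQuotient S).obj A) (Y := (toQuotient S).obj A) φ).trans
    ((Category.id_comp _).trans (Category.comp_id _))

lemma quotientEndMap_trans (A : C) (h : S ≤ T) (h' : T ≤ R) :
    quotientEndMap A (h.trans h') = quotientEndMap A h ≫ quotientEndMap A h' := by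
  have e : quotientFunctor (h.trans h') = quotientFunctor h ⋙ quotientFunctor h' := by
    refine Localization.Construction.uniq _ _ ?_
    rw [← Functor.assoc, toQuotient_comp h]
    exact (toQuotient_comp _).trans (toQuotient_comp _).symm
  ext φ
  exact (Functor.congr_hom e (X := (toQuotient S).obj A) (Y := (toQuotient S).obj A) φ).trans
    ((Category.id_comp _).trans (Category.comp_id _))

end Localizing

/-! ### Tensor localizing subcategories of finite type -/

/-- The tensor product of sheaves of modules over the structure sheaf: the sheaf associated with
`U ↦ M(U) ⊗ N(U)`, the tensor product being over the ring of sections over `U`. -/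
def tensor {X : Scheme.{u}} (M N : X.Modules) : X.Modules :=
  (PresheafOfModules.sheafification (𝟙 X.ringCatSheaf.obj)).obj
    (PresheafOfModules.Monoidal.tensorObj (R := X.presheaf) M.val N.val)

/-- A tensor localizing subcategory of finite type of `Qcoh X`: a localizing subcategory of finite
type that contains `F ⊗ G` whenever it contains `F`, for every quasi-coherent `G`. These are the
elements of the lattice; the order is inclusion and the product of two elements is their
intersection. (The tensor product of quasi-coherent sheaves is quasi-coherent, so `h` always
exists; it is only there to make `F ⊗ G` an object of `Qcoh X`.) -/
structure TensorLocalizing (X : Scheme.{u}) where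
  /-- the underlying class of objects -/
  carrier : ObjectProperty (Qcoh X)
  [isLocalizing : IsLocalizingSubcategory carrier]
  isOfFiniteType : IsOfFiniteType carrier
  isTensor (F G : Qcoh X) : carrier F →
    ∃ h : isQcoh X (tensor F.obj G.obj), carrier ⟨tensor F.obj G.obj, h⟩

attribute [instance] TensorLocalizing.isLocalizing

/-- The prime elements of the lattice of tensor localizing subcategories of finite type: an element
`p` other than the largest element (all of `Qcoh X`) is prime if `A ∩ B ≤ p` implies `A ≤ p` or
`B ≤ p`. -/
structure LatticeSpec (X : Scheme.{u}) where
  /-- the underlying element of the lattice -/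
  toTensorLocalizing : TensorLocalizing X
  ne_top : toTensorLocalizing.carrier ≠ ⊤
  prime (A B : TensorLocalizing X) : A.carrier ⊓ B.carrier ≤ toTensorLocalizing.carrier →
    A.carrier ≤ toTensorLocalizing.carrier ∨ B.carrier ≤ toTensorLocalizing.carrier

/-- The prime element `p` as a class of objects of `Qcoh X`. -/
def LatticeSpec.subcategory {X : Scheme.{u}} (p : LatticeSpec X) : ObjectProperty (Qcoh X) :=
  p.toTensorLocalizing.carrier

instance {X : Scheme.{u}} (p : LatticeSpec X) : p.subcategory.IsSerreClass :=
  inferInstanceAs p.toTensorLocalizing.carrier.IsSerreClass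

/-- The set `D(A)` of the primes `p` with `A ≰ p`, the complement of `V(A) = {p | A ≤ p}`. -/
def LatticeSpec.basicOpen {X : Scheme.{u}} (A : TensorLocalizing X) : Set (LatticeSpec X) :=
  {p | ¬ A.carrier ≤ p.subcategory}

/-- The Zariski topology on the prime spectrum of the lattice, generated by the sets `D(A)`. -/
instance (X : Scheme.{u}) : TopologicalSpace (LatticeSpec X) :=
  .generateFrom (Set.range LatticeSpec.basicOpen)

/-- The Hochster dual of a topology: the open subsets are the unions of complements of quasi-compact
open subsets. -/
@[reducible] def hochsterDual (α : Type*) [TopologicalSpace α] : TopologicalSpace α where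
  IsOpen U := ∃ 𝒦 : Set (Set α), (∀ K ∈ 𝒦, IsOpen K ∧ IsCompact K) ∧ U = ⋃ K ∈ 𝒦, Kᶜ
  isOpen_univ := ⟨{∅}, by simp, by simp⟩
  isOpen_inter := by
    rintro _ _ ⟨𝒦, h𝒦, rfl⟩ ⟨ℒ, hℒ, rfl⟩
    refine ⟨Set.image2 (· ∪ ·) 𝒦 ℒ, ?_, ?_⟩
    · rintro _ ⟨K, hK, L, hL, rfl⟩
      exact ⟨(h𝒦 K hK).1.union (hℒ L hL).1, (h𝒦 K hK).2.union (hℒ L hL).2⟩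
    · ext x
      simp only [Set.mem_inter_iff, Set.mem_iUnion, Set.mem_compl_iff, Set.mem_image2,
        exists_prop]
      constructor
      · rintro ⟨⟨K, hK, hx⟩, L, hL, hx'⟩
        exact ⟨K ∪ L, ⟨K, hK, L, hL, rfl⟩, by simp [hx, hx']⟩
      · rintro ⟨_, ⟨K, hK, L, hL, rfl⟩, hx⟩
        simp only [Set.mem_union, not_or] at hx
        exact ⟨⟨K, hK, hx.1⟩, L, hL, hx.2⟩
  isOpen_sUnion := by
    intro 𝒰 h𝒰
    choose! κ hκ hκ' using h𝒰
    refine ⟨⋃ U ∈ 𝒰, κ U, ?_, ?_⟩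
    · simp only [Set.mem_iUnion, exists_prop]
      rintro K ⟨U, hU, hK⟩
      exact hκ U hU K hK
    · ext x
      simp only [Set.mem_sUnion, Set.mem_iUnion, Set.mem_compl_iff, exists_prop]
      constructor
      · rintro ⟨U, hU, hx⟩
        rw [hκ' U hU] at hx
        simp only [Set.mem_iUnion, Set.mem_compl_iff, exists_prop] at hx
        obtain ⟨K, hK, hx⟩ := hx
        exact ⟨K, ⟨U, hU, hK⟩, hx⟩
      · rintro ⟨K, ⟨U, hU, hK⟩, hx⟩
        refine ⟨U, hU, ?_⟩
        rw [hκ' U hU]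
        simp only [Set.mem_iUnion, Set.mem_compl_iff, exists_prop]
        exact ⟨K, hK, hx⟩

/-- The space `Spec(Qcoh X)`: the prime spectrum of the lattice of tensor localizing subcategories
of finite type of `Qcoh X`, with the Hochster dual of the Zariski topology. -/
def SpecQcoh (X : Scheme.{u}) : TopCat.{u + 1} :=
  @TopCat.of (LatticeSpec X) (hochsterDual (LatticeSpec X))

/-- The support `supp F` of a quasi-coherent sheaf `F`: the set of points `p` of `SpecQcoh X` such
that `F` is not in `p`. -/
def SpecQcoh.support {X : Scheme.{u}} (F : Qcoh X) : Set (SpecQcoh X) :=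
  {p : LatticeSpec X | ¬ p.subcategory F}

/-- The subcategory `S_U` of the sheaves `F` with `supp F ∩ U = ∅`. -/
def supportedAway {X : Scheme.{u}} (U : Opens (SpecQcoh X)) : ObjectProperty (Qcoh X) :=
  fun F => SpecQcoh.support F ∩ U = ∅

lemma supportedAway_iff {X : Scheme.{u}} (U : Opens (SpecQcoh X)) (F : Qcoh X) :
    supportedAway U F ↔ ∀ p : LatticeSpec X, p ∈ (U : Set (SpecQcoh X)) → p.subcategory F := by
  rw [supportedAway, Set.eq_empty_iff_forall_notMem]
  exact forall_congr' fun p => ⟨fun h hp => by_contra fun hF => h ⟨hF, hp⟩,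
    fun h hp => hp.1 (h hp.2)⟩

lemma supportedAway_anti {X : Scheme.{u}} {U V : Opens (SpecQcoh X)} (h : V ≤ U) :
    supportedAway U ≤ supportedAway V := by
  intro F hF
  rw [supportedAway_iff] at hF ⊢
  exact fun p hp => hF p (h hp)

instance {X : Scheme.{u}} (U : Opens (SpecQcoh X)) : (supportedAway U).IsSerreClass where
  exists_zero := ⟨0, isZero_zero _, (supportedAway_iff _ _).2 fun p _ => p.subcategory.prop_zero⟩
  prop_of_mono f _ h := (supportedAway_iff _ _).2 fun p hp =>
    p.subcategory.prop_of_mono f ((supportedAway_iff _ _).1 h p hp)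
  prop_of_epi f _ h := (supportedAway_iff _ _).2 fun p hp =>
    p.subcategory.prop_of_epi f ((supportedAway_iff _ _).1 h p hp)
  prop_X₂_of_shortExact hS h₁ h₃ := (supportedAway_iff _ _).2 fun p hp =>
    p.subcategory.prop_X₂_of_shortExact hS ((supportedAway_iff _ _).1 h₁ p hp)
      ((supportedAway_iff _ _).1 h₃ p hp)

/-- The presheaf of rings `U ↦ End_{Qcoh(X)/S_U}(O_X)`; the restriction maps are induced by the
quotient functors `Qcoh(X)/S_U ⥤ Qcoh(X)/S_V` for `V ⊆ U`. -/
def endPresheaf (X : Scheme.{u}) : TopCat.Presheaf RingCat.{u + 1} (SpecQcoh X) where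
  obj U := quotientEnd (supportedAway U.unop) (structureModule X)
  map i := quotientEndMap _ (supportedAway_anti i.unop.le)
  map_id _ := quotientEndMap_refl _
  map_comp _ _ := quotientEndMap_trans _ _ _

/-- The structure sheaf of `Spec(Qcoh X)`: the sheaf of rings associated with `endPresheaf X`. -/
def specQcohSheaf (X : Scheme.{u}) : TopCat.Sheaf RingCat.{u + 1} (SpecQcoh X) :=
  (presheafToSheaf (Opens.grothendieckTopology (SpecQcoh X)) RingCat.{u + 1}).obj (endPresheaf X)

/-- The map from the sections over `U` of the presheaf `U ↦ End_{Qcoh(X)/S_U}(O_X)` to those of the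
associated sheaf. -/
def toSpecQcohSheaf (X : Scheme.{u}) (U : Opens (SpecQcoh X)) :
    End ((toQuotient (supportedAway U)).obj (structureModule X)) →
      (specQcohSheaf X).obj.obj (op U) :=
  fun φ => (CategoryTheory.toSheafify (Opens.grothendieckTopology (SpecQcoh X)) (endPresheaf X)).app
    (op U) φ

/-- The subcategory `S_P` of the sheaves `F` with zero stalk at `P`. -/
def vanishingAt {X : Scheme.{u}} (P : X) : ObjectProperty (Qcoh X) :=
  fun F => IsZero (TopCat.Presheaf.stalk F.obj.presheaf P)

/-- The map that a morphism `O_X ⟶ F` induces on sections over an open set `V`. -/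
def onSections {X : Scheme.{u}} {F : Qcoh X} (a : structureModule X ⟶ F) (V : X.Opens) :
    Γ(X, V) → Γ(F.obj, V) :=
  fun r => a.hom.app V r

end
end Reconstruction

open Reconstruction

/-!
The sheaves supported on a Thomason subset `V` of `X`, that is, an open subset for the Hochster
dual topology, form a tensor localizing subcategory of finite type, and every such subcategory
arises from the union `V` of the supports of its objects. Over an affine open subset the
subcategory becomes a torsion class of modules; being of finite type forces the class to be
determined by the finitely generated ideals `I` with `R ⧸ I` torsion, hence by a Thomason subset.
Under this correspondence the prime elements are the sets of the points that do not specialize to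
a given point `P`, so the sets `D(A)` are the Thomason subsets of `X`, and Hochster duality gives
back the topology of `X`.

A fraction `s⁻¹ a` that represents an endomorphism of `O_X` in the quotient category by the
sheaves that vanish on `O` defines the function `φ(1)`, because `s` is bijective on the sections
over `O`. If `O` is quasi-compact, then every function on `O` arises in this way: the direct image
of the restriction of `O_X` to `O` is isomorphic to `O_X` in the quotient category.
-/

namespace Reconstruction

noncomputable section

open scoped Topology TensorProduct

/-! ### Thomason subsets and Hochster duality -/

section Topology

variable {X : Type*} [TopologicalSpace X]

/-- A Thomason subset is a union of closed subsets with quasi-compact complements, that is, an open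
subset for the Hochster dual topology. -/
def IsThomason (V : Set X) : Prop := IsOpen[hochsterDual X] V

lemma isThomason_iff {V : Set X} :
    IsThomason V ↔ ∀ x ∈ V, ∃ U : Set X, IsOpen U ∧ IsCompact U ∧ x ∉ U ∧ Uᶜ ⊆ V := by
  constructor
  · rintro ⟨𝒦, h𝒦, rfl⟩ x hx
    obtain ⟨K, hK, hxK⟩ := Set.mem_iUnion₂.1 hx
    exact ⟨K, (h𝒦 K hK).1, (h𝒦 K hK).2, hxK, Set.subset_biUnion_of_mem (u := compl) hK⟩
  · refine fun h => ⟨{K | (IsOpen K ∧ IsCompact K) ∧ Kᶜ ⊆ V}, fun K hK => hK.1,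
      Set.Subset.antisymm (fun x hx => ?_) (Set.iUnion₂_subset fun K hK => hK.2)⟩
    obtain ⟨U, hU, hUc, hxU, hUV⟩ := h x hx
    exact Set.mem_iUnion₂.2 ⟨U, ⟨⟨hU, hUc⟩, hUV⟩, hxU⟩

lemma IsThomason.inter {V W : Set X} (hV : IsThomason V) (hW : IsThomason W) :
    IsThomason (V ∩ W) :=
  @IsOpen.inter X (hochsterDual X) _ _ hV hW

lemma isThomason_compl {U : Set X} (hU : IsOpen U) (hUc : IsCompact U) : IsThomason Uᶜ :=
  isThomason_iff.2 fun _ hx => ⟨U, hU, hUc, hx, subset_rfl⟩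

lemma IsThomason.mem_of_specializes {V : Set X} (hV : IsThomason V) {x y : X} (h : x ⤳ y)
    (hx : x ∈ V) : y ∈ V := by
  obtain ⟨U, hU, -, hxU, hUV⟩ := isThomason_iff.1 hV x hx
  exact hUV fun hy => hxU (h.mem_open hU hy)

/-- The set of the points which do not specialize to `x`: the largest Thomason subset that does not
contain `x`. -/
def nonGeneralizations (x : X) : Set X := {y | ¬ y ⤳ x}

lemma IsThomason.subset_nonGeneralizations_iff {V : Set X} (hV : IsThomason V) {x : X} :
    V ⊆ nonGeneralizations x ↔ x ∉ V :=
  ⟨fun h hx => h hx specializes_rfl, fun h _ hy hyx => h (hV.mem_of_specializes hyx hy)⟩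

lemma nonGeneralizations_injective [T0Space X] :
    Function.Injective (nonGeneralizations : X → Set X) := fun x y h =>
  (Specializes.antisymm (not_not.1 fun hn => (h ▸ hn : x ∈ nonGeneralizations x) specializes_rfl)
    (not_not.1 fun hn => (h ▸ hn : y ∈ nonGeneralizations y) specializes_rfl)).eq

lemma exists_isOpen_isCompact_of_not_specializes [PrespectralSpace X] {x y : X} (h : ¬ y ⤳ x) :
    ∃ U : Set X, IsOpen U ∧ IsCompact U ∧ x ∈ U ∧ y ∉ U := by
  obtain ⟨s, hs, hx, hy⟩ := not_specializes_iff_exists_open.1 h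
  obtain ⟨U, ⟨hU, hUc⟩, hxU, hUs⟩ :=
    PrespectralSpace.isTopologicalBasis.exists_subset_of_mem_open hx hs
  exact ⟨U, hU, hUc, hxU, fun hyU => hy (hUs hyU)⟩

lemma isThomason_nonGeneralizations [PrespectralSpace X] (x : X) :
    IsThomason (nonGeneralizations x) := by
  refine isThomason_iff.2 fun y hy => ?_
  obtain ⟨U, hU, hUc, hxU, hyU⟩ := exists_isOpen_isCompact_of_not_specializes hy
  exact ⟨U, hU, hUc, hyU, fun z hz hzx => hz (hzx.mem_open hU hxU)⟩

lemma isOpen_constructible_of_isOpen [PrespectralSpace X] {U : Set X} (hU : IsOpen U) :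
    IsOpen[constructibleTopology X] U := by
  refine (@isOpen_iff_forall_mem_open X (constructibleTopology X) U).2 fun x hx => ?_
  obtain ⟨V, ⟨hV, hVc⟩, hxV, hVU⟩ :=
    PrespectralSpace.isTopologicalBasis.exists_subset_of_mem_open hx hU
  exact ⟨V, hVU, hVc.isOpen_constructibleTopology_of_isOpen hV, hxV⟩

lemma constructibleTopology_le_hochsterDual : constructibleTopology X ≤ hochsterDual X := by
  rintro _ ⟨𝒦, h𝒦, rfl⟩
  refine @isOpen_biUnion X _ (constructibleTopology X) _ _ fun K hK => ?_
  exact IsCompact.isOpen_constructibleTopology_of_isClosed (by simpa using (h𝒦 K hK).2)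
    (h𝒦 K hK).1.isClosed_compl

lemma IsThomason.isOpen_constructible {V : Set X} (hV : IsThomason V) :
    IsOpen[constructibleTopology X] V :=
  constructibleTopology_le_hochsterDual V hV

lemma IsThomason.exists_disjoint_of_isCompact [CompactSpace X] [QuasiSeparatedSpace X]
    {V C : Set X} (hV : IsThomason V) (hC : @IsCompact X (hochsterDual X) C) (h : C ⊆ V) :
    ∃ U : Set X, IsOpen U ∧ IsCompact U ∧ Disjoint U C ∧ Uᶜ ⊆ V := by
  refine @IsCompact.induction_on X (hochsterDual X) C hC
    (fun C => ∃ U, IsOpen U ∧ IsCompact U ∧ Disjoint U C ∧ Uᶜ ⊆ V) ?_ ?_ ?_ ?_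
  · exact ⟨Set.univ, isOpen_univ, isCompact_univ, by simp, by simp⟩
  · rintro C C' hCC' ⟨U, hU, hUc, hUC, hUV⟩
    exact ⟨U, hU, hUc, hUC.mono_right hCC', hUV⟩
  · rintro C C' ⟨U, hU, hUc, hUC, hUV⟩ ⟨U', hU', hUc', hUC', hUV'⟩
    refine ⟨U ∩ U', hU.inter hU', hUc.inter_of_isOpen hUc' hU hU', Set.disjoint_union_right.2
      ⟨hUC.mono_left Set.inter_subset_left, hUC'.mono_left Set.inter_subset_right⟩, ?_⟩
    rw [Set.compl_inter]
    exact Set.union_subset hUV hUV'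
  · intro x hx
    obtain ⟨U, hU, hUc, hxU, hUV⟩ := isThomason_iff.1 hV x (h hx)
    exact ⟨Uᶜ, @mem_nhdsWithin_of_mem_nhds X (hochsterDual X) _ _ _
      (@IsOpen.mem_nhds X (hochsterDual X) _ _ (isThomason_compl hU hUc) hxU),
      U, hU, hUc, disjoint_compl_right, hUV⟩

variable [CompactSpace X] [QuasiSober X] [PrespectralSpace X] [QuasiSeparatedSpace X]

lemma isCompact_constructible_of_isClosed {C : Set X} (hC : IsClosed[constructibleTopology X] C) :
    @IsCompact X (constructibleTopology X) C :=
  have := @Function.Surjective.compactSpace _ X _ (constructibleTopology X) _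
    (WithTopology.continuous_ofTopology _) inferInstance (WithTopology.ofTopology_surjective _)
  @IsClosed.isCompact X (constructibleTopology X) _ this hC

lemma isCompact_hochsterDual_of_isClosed_constructible {C : Set X}
    (hC : IsClosed[constructibleTopology X] C) : @IsCompact X (hochsterDual X) C := by
  have h := @IsCompact.image X X (constructibleTopology X) (hochsterDual X) C id
    (isCompact_constructible_of_isClosed hC)
    (continuous_id_of_le constructibleTopology_le_hochsterDual)
  rwa [Set.image_id] at h

lemma IsThomason.exists_disjoint_of_isClosed {V C : Set X} (hV : IsThomason V)
    (hC : IsClosed[constructibleTopology X] C) (h : C ⊆ V) :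
    ∃ U : Set X, IsOpen U ∧ IsCompact U ∧ Disjoint U C ∧ Uᶜ ⊆ V :=
  hV.exists_disjoint_of_isCompact (isCompact_hochsterDual_of_isClosed_constructible hC) h

lemma exists_notMem_of_directed {V : Set X} (hV : IsOpen[constructibleTopology X] V)
    {𝒰 : Set (Set X)} (hne : 𝒰.Nonempty) (hd : ∀ U ∈ 𝒰, ∀ U' ∈ 𝒰, U ∪ U' ∈ 𝒰)
    (ho : ∀ U ∈ 𝒰, IsOpen U) (h : ∀ U ∈ 𝒰, ¬ Uᶜ ⊆ V) : ∃ x ∉ V, ∀ U ∈ 𝒰, x ∉ U := by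
  by_contra! hn
  have hc := isCompact_constructible_of_isClosed
    (@IsOpen.isClosed_compl X (constructibleTopology X) V hV)
  have : Nonempty 𝒰 := hne.to_subtype
  obtain ⟨U, hU⟩ := @IsCompact.elim_directed_cover X (constructibleTopology X) Vᶜ 𝒰 _ hc (↑)
    (fun U => isOpen_constructible_of_isOpen (ho U U.2))
    (fun x hx => by
      obtain ⟨U, hU, hxU⟩ := hn x hx
      exact Set.mem_iUnion.2 ⟨⟨U, hU⟩, hxU⟩)
    fun U U' => ⟨⟨_, hd U U.2 U' U'.2⟩, Set.subset_union_left, Set.subset_union_right⟩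
  exact h U U.2 (Set.compl_subset_comm.1 hU)

lemma isThomason_of_isOpen_constructible {V : Set X} (hV : IsOpen[constructibleTopology X] V)
    (h : ∀ x y, x ⤳ y → x ∈ V → y ∈ V) : IsThomason V := by
  refine isThomason_iff.2 fun x hx => ?_
  by_contra! hn
  obtain ⟨y, hyV, hy⟩ := exists_notMem_of_directed (𝒰 := {U | IsOpen U ∧ IsCompact U ∧ x ∉ U})
    hV ⟨∅, isOpen_empty, isCompact_empty, Set.notMem_empty x⟩
    (fun U hU U' hU' => ⟨hU.1.union hU'.1, hU.2.1.union hU'.2.1, by simp [hU.2.2, hU'.2.2]⟩)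
    (fun U hU => hU.1) fun U hU => hn U hU.1 hU.2.1 hU.2.2
  refine hyV (h x y (not_not.1 fun hxy => ?_) hx)
  obtain ⟨U, hU, hUc, hyU, hxU⟩ := exists_isOpen_isCompact_of_not_specializes hxy
  exact hy U ⟨hU, hUc, hxU⟩ hyU

lemma IsThomason.exists_eq_nonGeneralizations {V : Set X} (hV : IsThomason V) (hne : V ≠ Set.univ)
    (hp : ∀ A B : Set X, IsThomason A → IsThomason B → A ∩ B ⊆ V → A ⊆ V ∨ B ⊆ V) :
    ∃ x, V = nonGeneralizations x := by
  obtain ⟨x, hxV, hx⟩ := exists_notMem_of_directed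
    (𝒰 := {U | IsOpen U ∧ IsCompact U ∧ ¬ Uᶜ ⊆ V}) hV.isOpen_constructible
    ⟨∅, isOpen_empty, isCompact_empty, by simpa [Set.univ_subset_iff] using hne⟩
    (fun U hU U' hU' => ⟨hU.1.union hU'.1, hU.2.1.union hU'.2.1, by
      rw [Set.compl_union]
      exact fun h => (hp _ _ (isThomason_compl hU.1 hU.2.1) (isThomason_compl hU'.1 hU'.2.1) h).elim
        hU.2.2 hU'.2.2⟩)
    (fun U hU => hU.1) fun U hU => hU.2.2
  refine ⟨x, (hV.subset_nonGeneralizations_iff.2 hxV).antisymm fun y hy => ?_⟩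
  obtain ⟨U, hU, hUc, hxU, hyU⟩ := exists_isOpen_isCompact_of_not_specializes hy
  by_contra hyV
  exact hx U ⟨hU, hUc, fun h => hyV (h hyU)⟩ hxU

lemma isOpen_isCompact_hochsterDual_iff {K : Set X} :
    IsOpen[hochsterDual X] K ∧ @IsCompact X (hochsterDual X) K ↔ IsOpen Kᶜ ∧ IsCompact Kᶜ := by
  constructor
  · rintro ⟨hK, hKc⟩
    obtain ⟨U, hU, hUc, hUK, hUK'⟩ := IsThomason.exists_disjoint_of_isCompact hK hKc subset_rfl
    have h : U = Kᶜ := hUK.subset_compl_right.antisymm (Set.compl_subset_comm.1 hUK')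
    exact h ▸ ⟨hU, hUc⟩
  · rintro ⟨hK, hKc⟩
    have hKT : IsThomason K := compl_compl K ▸ isThomason_compl hK hKc
    refine ⟨hKT, isCompact_hochsterDual_of_isClosed_constructible ?_⟩
    exact @isOpen_compl_iff X K (constructibleTopology X) |>.1 (isOpen_constructible_of_isOpen hK)

lemma hochsterDual_hochsterDual :
    @hochsterDual X (hochsterDual X) = ‹TopologicalSpace X› := by
  refine TopologicalSpace.ext_iff.2 fun V => ?_
  refine (@isThomason_iff X (hochsterDual X) V).trans
    (Iff.trans ?_ PrespectralSpace.isTopologicalBasis.isOpen_iff.symm)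
  refine forall₂_congr fun x _ => ⟨?_, ?_⟩
  · rintro ⟨U, hU, hUc, hxU, hUV⟩
    exact ⟨Uᶜ, isOpen_isCompact_hochsterDual_iff.1 ⟨hU, hUc⟩, hxU, hUV⟩
  · rintro ⟨U, hU, hxU, hUV⟩
    obtain ⟨hU', hUc'⟩ := isOpen_isCompact_hochsterDual_iff (K := Uᶜ).2 (by rwa [compl_compl])
    exact ⟨Uᶜ, hU', hUc', fun h => h hxU, by rwa [compl_compl]⟩

end Topology

lemma IsThomason.preimage {X Y : Type*} [TopologicalSpace X] [TopologicalSpace Y] {V : Set Y}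
    (hV : IsThomason V) (φ : X ≃ₜ Y) : IsThomason (φ ⁻¹' V) := by
  refine isThomason_iff.2 fun x hx => ?_
  obtain ⟨U, hU, hUc, hxU, hUV⟩ := isThomason_iff.1 hV (φ x) hx
  exact ⟨φ ⁻¹' U, hU.preimage φ.continuous, φ.isCompact_preimage.2 hUc, hxU,
    Set.preimage_mono hUV⟩

lemma induced_hochsterDual {X Y : Type*} [TopologicalSpace Y] (e : X ≃ Y) :
    (hochsterDual Y).induced e = @hochsterDual X (‹TopologicalSpace Y›.induced e) := by
  let := ‹TopologicalSpace Y›.induced e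
  let φ : X ≃ₜ Y := e.toHomeomorphOfIsInducing ⟨rfl⟩
  refine TopologicalSpace.ext_iff.2 fun V => ⟨?_, fun hV => ?_⟩
  · rintro ⟨W, hW, rfl⟩
    exact IsThomason.preimage hW φ
  · exact ⟨φ.symm ⁻¹' V, IsThomason.preimage hV φ.symm, φ.toEquiv.preimage_symm_preimage V⟩

/-! ### Sections of quasi-coherent sheaves -/

section Sections

variable {X : Scheme.{u}}

/-- The restriction of functions to a smaller open subset. -/
def resO {U V : X.Opens} (h : V ≤ U) : Γ(X, U) →+* Γ(X, V) := (X.presheaf.map (homOfLE h).op).hom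

lemma resO_resO {U V W : X.Opens} (h : V ≤ U) (h' : W ≤ V) (r : Γ(X, U)) :
    resO h' (resO h r) = resO (h'.trans h) r := by
  simp only [resO, ← CommRingCat.comp_apply, ← Functor.map_comp, ← op_comp, homOfLE_comp]

@[simp] lemma resO_self {U : X.Opens} (h : U ≤ U) (r : Γ(X, U)) : resO h r = r :=
  congr($(X.presheaf.map_id (op U)) r)

lemma basicOpen_resO {U V : X.Opens} (h : V ≤ U) (f : Γ(X, U)) :
    X.basicOpen (resO h f) = V ⊓ X.basicOpen f :=
  X.basicOpen_res _ _

lemma isUnit_resO_basicOpen_pow {U : X.Opens} (f : Γ(X, U)) (n : ℕ) :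
    IsUnit (resO (X.basicOpen_le f) (f ^ n)) := by
  rw [map_pow]
  exact (RingedSpace.isUnit_res_basicOpen X.toRingedSpace f).pow n

/-- The restriction of sections of a sheaf of modules to a smaller open subset. -/
def res (F : X.Modules) {U V : X.Opens} (h : V ≤ U) : Γ(F, U) →+ Γ(F, V) :=
  (F.presheaf.map (homOfLE h).op).hom

variable {F : X.Modules}

lemma res_res {U V W : X.Opens} (h : V ≤ U) (h' : W ≤ V) (x : Γ(F, U)) :
    res F h' (res F h x) = res F (h'.trans h) x := by
  simp only [res, ← AddCommGrpCat.comp_apply, ← Functor.map_comp, ← op_comp, homOfLE_comp]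

@[simp] lemma res_self {U : X.Opens} (h : U ≤ U) (x : Γ(F, U)) : res F h x = x :=
  congr($(F.presheaf.map_id (op U)) x)

lemma res_smul {U V : X.Opens} (h : V ≤ U) (r : Γ(X, U)) (x : Γ(F, U)) :
    res F h (r • x) = resO h r • res F h x :=
  F.map_smul (homOfLE h) r x

lemma app_res' {G : X.Modules} (g : F ⟶ G) {U V : X.Opens} (h : V ≤ U) (x : Γ(F, U)) :
    g.app V (res F h x) = res G h (g.app U x) :=
  app_res g h x

lemma res_injective_of_le {U V : X.Opens} (h : V ≤ U) (h' : U ≤ V) :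
    Function.Injective (res F h) :=
  fun x y e => by simpa only [res_res, res_self] using congrArg (res F h') e

lemma sections_ext {ι : Type*} {U : X.Opens} (V : ι → X.Opens) (hV : ∀ i, V i ≤ U)
    (hU : U ≤ ⨆ i, V i)
    {x y : Γ(F, U)} (h : ∀ i, res F (hV i) x = res F (hV i) y) : x = y :=
  TopCat.Sheaf.eq_of_locally_eq' ⟨_, F.isSheaf⟩ V U (fun i => homOfLE (hV i)) hU x y h

lemma sections_eq_zero {ι : Type*} {U : X.Opens} (V : ι → X.Opens) (hV : ∀ i, V i ≤ U)
    (hU : U ≤ ⨆ i, V i) {x : Γ(F, U)} (h : ∀ i, res F (hV i) x = 0) : x = 0 :=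
  sections_ext V hV hU fun i => by rw [h, map_zero]

lemma exists_sections_glue {ι : Type*} {U : X.Opens} (V : ι → X.Opens) (hV : ∀ i, V i ≤ U)
    (hU : U ≤ ⨆ i, V i) (x : ∀ i, Γ(F, V i))
    (h : ∀ i j, res F (inf_le_left : V i ⊓ V j ≤ V i) (x i) = res F inf_le_right (x j)) :
    ∃ y : Γ(F, U), ∀ i, res F (hV i) y = x i := by
  obtain ⟨y, hy, -⟩ := TopCat.Sheaf.existsUnique_gluing' ⟨_, F.isSheaf⟩ V U
    (fun i => homOfLE (hV i)) hU x h
  exact ⟨y, hy⟩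

/-- The sections of `F` over `D` are those over `U` localized at `f`: a section over `D` extends to
`U` after multiplication by a power of `f`, and a section over `U` vanishing on `D` is annihilated
by a power of `f`. The open subset `D` is a variable, and not literally `X.basicOpen f`, because
opens that are only propositionally equal to a basic open subset occur. -/
def LocalizesAt (F : X.Modules) {U D : X.Opens} (h : D ≤ U) (f : Γ(X, U)) : Prop :=
  (∀ x : Γ(F, D), ∃ (n : ℕ) (y : Γ(F, U)), res F h y = resO h (f ^ n) • x) ∧
    ∀ y : Γ(F, U), res F h y = 0 → ∃ n : ℕ, f ^ n • y = 0

lemma localizesAt_congr {U U' D D' : X.Opens} (hU : U' = U) (hD : D' = D) (h : D ≤ U)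
    (f : Γ(X, U)) :
    LocalizesAt F (hD.trans_le (h.trans hU.ge)) (resO hU.le f) ↔ LocalizesAt F h f := by
  subst hU hD
  rw [resO_self]

lemma smul_restrict_fromSpec {U : X.Opens} (hU : IsAffineOpen U) (V : (Spec Γ(X, U)).Opens)
    (h : hU.fromSpec ''ᵁ V ≤ U) (r : Γ(X, U)) (x : Γ(F.restrict hU.fromSpec, V)) :
    r • x = (resO h r • (show Γ(F, hU.fromSpec ''ᵁ V) from x) : Γ(F, hU.fromSpec ''ᵁ V)) := by
  have e : V ≤ hU.fromSpec ⁻¹ᵁ U := by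
    rw [hU.fromSpec_preimage_self]
    exact le_top
  have key : (Scheme.ΓSpecIso Γ(X, U)).inv ≫ (Spec Γ(X, U)).presheaf.map V.leTop.op ≫
      (hU.fromSpec.appIso V).inv = X.presheaf.map (homOfLE h).op := by
    rw [← Scheme.Hom.appLE_appIso_inv hU.fromSpec e, Scheme.Hom.appLE, hU.fromSpec_app_self]
    simp only [Category.assoc, ← Functor.map_comp_assoc]
    rfl
  rw [Scheme.Modules.smul_Spec_def]
  exact congr($key r • (show Γ(F, hU.fromSpec ''ᵁ V) from x))

lemma isQcoh_restrict_iff {U : X.Opens} (hU : IsAffineOpen U) :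
    isQcoh _ (F.restrict hU.fromSpec) ↔ ∀ f : Γ(X, U), LocalizesAt F (X.basicOpen_le f) f := by
  have hTop : hU.fromSpec ''ᵁ ⊤ = U := by simp [hU.opensRange_fromSpec]
  rw [isLocalizing_iff_spec]
  refine forall_congr' fun f => ?_
  have hD : hU.fromSpec ''ᵁ specBasicOpen f = X.basicOpen f := hU.fromSpec_image_basicOpen f
  have hDU := hD.trans_le (X.basicOpen_le f)
  rw [← localizesAt_congr hTop hD (X.basicOpen_le f)]
  simp only [smul_restrict_fromSpec hU _ hTop.le, smul_restrict_fromSpec hU _ hDU,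
    LocalizesAt, ← map_pow, resO_resO]
  rfl

lemma isQcoh_iff_localizesAt :
    isQcoh X F ↔ ∀ U, IsAffineOpen U → ∀ f : Γ(X, U), LocalizesAt F (X.basicOpen_le f) f :=
  ⟨fun h _ hU => (isQcoh_restrict_iff hU).1 (isQcoh_restrict _ _ h),
    fun h => isQcoh_of_restrict _ fun _ hU => (isQcoh_restrict_iff hU).2 (h _ hU)⟩

lemma localizesAt_inf_basicOpen (hF : isQcoh X F) {U V : X.Opens} (hV : IsAffineOpen V)
    (h : V ≤ U) (f : Γ(X, U)) :
    LocalizesAt F (inf_le_left : V ⊓ X.basicOpen f ≤ V) (resO h f) := by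
  have := isQcoh_iff_localizesAt.1 hF V hV (resO h f)
  rwa [← localizesAt_congr rfl (basicOpen_resO h f).symm, resO_self] at this

lemma exists_finite_affine_cover {U : X.Opens} (hU : IsCompact (U : Set X)) :
    ∃ (ι : Type u) (_ : Finite ι) (V : ι → X.Opens), (∀ i, IsAffineOpen (V i)) ∧ U = ⨆ i, V i := by
  obtain ⟨s, hs, h⟩ := isCompact_iff_finite_and_eq_biUnion_affineOpens.mp hU
  exact ⟨s, hs, fun i => i.1, fun i => i.1.2,
    h.trans (iSup_subtype' (p := (· ∈ s)) (f := fun i _ => i.1))⟩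

lemma pow_smul_eq_zero_of_le {A M : Type*} [Monoid A] [AddMonoid M] [DistribMulAction A M] {f : A}
    {y : M} {m n : ℕ} (h : m ≤ n) (hy : f ^ m • y = 0) : f ^ n • y = 0 := by
  rw [← Nat.sub_add_cancel h, pow_add, mul_smul, hy, smul_zero]

lemma exists_pow_smul_eq_zero (hF : isQcoh X F) {U V : X.Opens} (hV : IsCompact (V : Set X))
    (h : V ≤ U) (f : Γ(X, U)) (y : Γ(F, V))
    (hy : res F (inf_le_left : V ⊓ X.basicOpen f ≤ V) y = 0) :
    ∃ n : ℕ, resO h f ^ n • y = 0 := by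
  obtain ⟨ι, _, W, hW, hVW⟩ := exists_finite_affine_cover hV
  have hle (i : ι) : W i ≤ V := hVW.symm ▸ le_iSup W i
  have key (i : ι) : ∃ n : ℕ, resO ((hle i).trans h) f ^ n • res F (hle i) y = 0 := by
    refine (localizesAt_inf_basicOpen hF (hW i) ((hle i).trans h) f).2 _ ?_
    rw [res_res, ← res_res inf_le_left (inf_le_inf_right _ (hle i)), hy, map_zero]
  choose n hn using key
  obtain ⟨N, hN⟩ := Finite.exists_le n
  refine ⟨N, sections_eq_zero W hle hVW.le fun i => ?_⟩
  rw [res_smul, map_pow, resO_resO]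
  exact pow_smul_eq_zero_of_le (hN i) (hn i)

/-- Local extensions of a section over `X.basicOpen f` agree on overlaps up to a power of `f`, hence
glue after multiplication by a large power of `f`. -/
lemma exists_extension_of_locally (hF : isQcoh X F) {U : X.Opens} (f : Γ(X, U)) {ι : Type*}
    [Finite ι] {V : ι → X.Opens} (hV : ∀ i, V i ≤ U) (hU : U ≤ ⨆ i, V i)
    (hc : ∀ i j, IsCompact ((V i ⊓ V j : X.Opens) : Set X)) {x : Γ(F, X.basicOpen f)}
    (y : ∀ i, Γ(F, V i)) (hy : ∀ i, res F (inf_le_left : V i ⊓ X.basicOpen f ≤ V i) (y i) =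
      res F inf_le_right x) :
    ∃ (n : ℕ) (z : Γ(F, U)), res F (X.basicOpen_le f) z = resO (X.basicOpen_le f) (f ^ n) • x := by
  have key (p : ι × ι) : ∃ m : ℕ, resO (inf_le_left.trans (hV p.1) : V p.1 ⊓ V p.2 ≤ U) f ^ m •
      (res F (inf_le_left : V p.1 ⊓ V p.2 ≤ V p.1) (y p.1) - res F inf_le_right (y p.2)) = 0 := by
    refine exists_pow_smul_eq_zero hF (hc _ _) _ f _ ?_
    have h₁ := congrArg (res F (inf_le_inf_right _ inf_le_left :
      (V p.1 ⊓ V p.2) ⊓ X.basicOpen f ≤ V p.1 ⊓ X.basicOpen f)) (hy p.1)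
    have h₂ := congrArg (res F (inf_le_inf_right _ inf_le_right :
      (V p.1 ⊓ V p.2) ⊓ X.basicOpen f ≤ V p.2 ⊓ X.basicOpen f)) (hy p.2)
    simp only [res_res] at h₁ h₂
    simp only [map_sub, res_res, h₁, h₂, sub_self]
  choose m hm using key
  obtain ⟨n, hn⟩ := Finite.exists_le m
  obtain ⟨z, hz⟩ := exists_sections_glue V hV hU (fun i => resO (hV i) f ^ n • y i) fun i j => by
    have := pow_smul_eq_zero_of_le (hn (i, j)) (hm (i, j))
    rw [smul_sub, sub_eq_zero] at this
    simpa only [res_smul, map_pow, resO_resO] using this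
  refine ⟨n, z, sections_ext (fun i => V i ⊓ X.basicOpen f) (fun i => inf_le_right) ?_ fun i => ?_⟩
  · rw [← iSup_inf_eq]
    exact le_inf ((X.basicOpen_le f).trans hU) le_rfl
  · rw [res_res, ← res_res (hV i) inf_le_left, hz, res_smul, hy, res_smul, ← map_pow, resO_resO,
      resO_resO]

lemma localizesAt_of_isCompact (hF : isQcoh X F) {U : X.Opens} (hU : IsCompact (U : Set X))
    (hU' : IsQuasiSeparated (U : Set X)) (f : Γ(X, U)) : LocalizesAt F (X.basicOpen_le f) f := by
  refine ⟨fun x => ?_, fun y hy => ?_⟩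
  · obtain ⟨ι, _, V, hV, hUV⟩ := exists_finite_affine_cover hU
    have hle (i : ι) : V i ≤ U := hUV.symm ▸ le_iSup V i
    choose n y hy using fun i =>
      (localizesAt_inf_basicOpen hF (hV i) (hle i) f).1 (res F inf_le_right x)
    obtain ⟨N, hN⟩ := Finite.exists_le n
    obtain ⟨m, z, hz⟩ := exists_extension_of_locally hF f hle hUV.le
      (fun i j => hU' _ _ (hle i) (V i).2 (hV i).isCompact (hle j) (V j).2 (hV j).isCompact)
      (x := resO (X.basicOpen_le f) (f ^ N) • x) (fun i => resO (hle i) f ^ (N - n i) • y i)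
      fun i => by
        rw [res_smul, hy, ← mul_smul, ← map_mul, ← pow_add, Nat.sub_add_cancel (hN i), res_smul,
          ← map_pow, resO_resO, resO_resO]
    exact ⟨m + N, z, by rw [hz, ← mul_smul, ← map_mul, ← pow_add]⟩
  · obtain ⟨n, hn⟩ := exists_pow_smul_eq_zero hF hU le_rfl f y
      (by rw [← res_res (X.basicOpen_le f) inf_le_right, hy, map_zero])
    exact ⟨n, by rwa [resO_self] at hn⟩

lemma isQcoh_pushforward {Y : Scheme.{u}} (f : X ⟶ Y) [QuasiCompact f] [QuasiSeparated f]
    (hF : isQcoh X F) : isQcoh Y ((Scheme.Modules.pushforward f).obj F) := by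
  refine isQcoh_iff_localizesAt.2 fun U hU r => ?_
  have h := localizesAt_of_isCompact hF (U := f ⁻¹ᵁ U) (f.isCompact_preimage hU.isCompact)
    (f.isQuasiSeparated_preimage hU.isQuasiSeparated) (f.app U r)
  rw [← localizesAt_congr rfl (f.preimage_basicOpen r), resO_self] at h
  refine ⟨fun x => ?_, fun y hy => ?_⟩
  · obtain ⟨n, y, hy⟩ := h.1 x
    refine ⟨n, y, hy.trans ?_⟩
    have := congr($(f.naturality (homOfLE (Y.basicOpen_le r)).op) (r ^ n))
    rw [← map_pow]
    exact congr($this.symm • (show Γ(F, f ⁻¹ᵁ Y.basicOpen r) from x))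
  · obtain ⟨n, hn⟩ := h.2 y hy
    exact ⟨n, by rwa [← map_pow] at hn⟩

end Sections

/-! ### Sections over affine open subsets and extension by direct image -/

section Functors

variable {X : Scheme.{u}}

instance (J : Type u) [SmallCategory J] : (isQcoh X).IsClosedUnderColimitsOfShape J :=
  .mk' (by
    rintro _ ⟨G, hG⟩
    refine isQcoh_of_restrict _ fun U hU => ?_
    have : PreservesColimitsOfSize.{u, u} (Scheme.Modules.restrictFunctor hU.fromSpec) :=
      inferInstance
    refine isQcoh_iso (preservesColimitIso (Scheme.Modules.restrictFunctor hU.fromSpec) G).symm ?_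
    have h := (tilde.functor Γ(X, U)).essImage.prop_colimit
      (G ⋙ Scheme.Modules.restrictFunctor hU.fromSpec) fun j => by
        rw [essImage_tilde]
        exact isQcoh_restrict _ _ (hG j)
    rw [essImage_tilde] at h
    exact h)

/-- The functor of sections over an open subset. -/
def sections (U : X.Opens) : Qcoh X ⥤ ModuleCat.{u} Γ(X, U) where
  obj F := ModuleCat.of _ Γ(F.obj, U)
  map g := ModuleCat.ofHom
    { toFun := g.hom.app U
      map_add' := map_add _
      map_smul' := Scheme.Modules.Hom.app_smul _ }

instance (U : X.Opens) : (sections U).Additive where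
  map_add := rfl

instance (U : X.Opens) {F G : Qcoh X} (f : F ⟶ G) :
    PreservesLimit (parallelPair f 0) (sections U) := by
  have h₁ := (isQcoh X).preservesKernels_ι f
  let E : TopCat.Presheaf Ab X ⥤ Ab := (evaluation X.Opensᵒᵖ Ab).obj (op U)
  have : PreservesLimits (Scheme.Modules.toPresheaf X) := inferInstance
  have : PreservesLimitsOfSize.{0, 0} (Scheme.Modules.toPresheaf X) :=
    preservesLimitsOfSize_shrink _
  have : PreservesLimitsOfShape WalkingParallelPair E :=
    inferInstanceAs (PreservesLimitsOfShape WalkingParallelPair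
      ((evaluation X.Opensᵒᵖ Ab.{u}).obj (op U)))
  have h₂ : PreservesLimit (parallelPair f 0)
      ((isQcoh X).ι ⋙ Scheme.Modules.toPresheaf X ⋙ E) := inferInstance
  have h₃ : PreservesLimit (parallelPair f 0) (sections U ⋙ forget₂ (ModuleCat Γ(X, U)) Ab) := h₂
  exact preservesLimit_of_reflects_of_preserves (sections U) (forget₂ (ModuleCat Γ(X, U)) Ab)

instance (U : X.Opens) : PreservesFiniteLimits (sections U) :=
  Functor.preservesFiniteLimits_of_preservesKernels _

/-- The direct image of quasi-coherent sheaves. -/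
def pushforward {X Y : Scheme.{u}} (f : X ⟶ Y) [QuasiCompact f] [QuasiSeparated f] :
    Qcoh X ⥤ Qcoh Y :=
  (isQcoh Y).lift ((isQcoh X).ι ⋙ Scheme.Modules.pushforward f)
    fun F => isQcoh_pushforward f F.property

/-- The restriction of quasi-coherent sheaves along an open immersion. -/
def restrict {X Y : Scheme.{u}} (f : X ⟶ Y) [IsOpenImmersion f] : Qcoh Y ⥤ Qcoh X :=
  (isQcoh X).lift ((isQcoh Y).ι ⋙ Scheme.Modules.restrictFunctor f)
    fun F => isQcoh_restrict f _ F.property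

/-- Restriction is left adjoint to the direct image. -/
def restrictAdjunction {X Y : Scheme.{u}} (f : X ⟶ Y) [IsOpenImmersion f] [QuasiCompact f]
    [QuasiSeparated f] : restrict f ⊣ pushforward f :=
  (Scheme.Modules.restrictAdjunction f).restrictFullyFaithful (isQcoh Y).fullyFaithfulι
    (isQcoh X).fullyFaithfulι (Iso.refl _) (Iso.refl _)

variable {W : X.Opens} (hW : IsAffineOpen W)

/-- The sheaf associated with a module, as a quasi-coherent sheaf. -/
def tildeQcoh (R : CommRingCat.{u}) : ModuleCat.{u} R ≌ Qcoh (Spec R) := tildeEquiv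

/-- The sections over an affine open subset are the global sections of the restriction. -/
def restrictSectionsIsoApp (F : X.Modules) : ModuleCat.of Γ(X, W) Γ(F.restrict hW.fromSpec, ⊤) ≅
    ModuleCat.of Γ(X, W) Γ(F, W) :=
  LinearEquiv.toModuleIso
    { toFun := fun x => res F (show W ≤ hW.fromSpec ''ᵁ ⊤ by simp [hW.opensRange_fromSpec]) x
      invFun := fun x => res F (show hW.fromSpec ''ᵁ ⊤ ≤ W by simp [hW.opensRange_fromSpec]) x
      map_add' := map_add _
      map_smul' := fun r x => by
        rw [smul_restrict_fromSpec hW ⊤ (by simp [hW.opensRange_fromSpec])]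
        exact (res_smul _ _ _).trans (by rw [resO_resO, resO_self]; rfl)
      left_inv := fun x => (res_res _ _ _).trans (res_self _ _)
      right_inv := fun x => (res_res _ _ _).trans (res_self _ _) }

/-- The sections over an affine open subset are the module corresponding to the restriction. -/
def restrictSectionsIso : restrict hW.fromSpec ⋙ (tildeQcoh Γ(X, W)).inverse ≅ sections W :=
  NatIso.ofComponents (fun F => restrictSectionsIsoApp hW F.obj) (fun {F G} g => by
    ext x
    exact (app_res' g.hom (show W ≤ hW.fromSpec ''ᵁ ⊤ by simp [hW.opensRange_fromSpec]) x).symm)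

variable [QuasiSeparatedSpace X]

/-- The direct image on `X` of the sheaf on the affine open subset `W` associated with a module. -/
def extend : ModuleCat.{u} Γ(X, W) ⥤ Qcoh X := (tildeQcoh Γ(X, W)).functor ⋙ pushforward hW.fromSpec

/-- The functor of sections over an affine open subset is left adjoint to `extend`. -/
def sectionsAdjunction : sections W ⊣ extend hW :=
  ((restrictAdjunction hW.fromSpec).comp
    (tildeQcoh Γ(X, W)).symm.toAdjunction).ofNatIsoLeft (restrictSectionsIso hW)

instance {X Y : Scheme.{u}} (f : X ⟶ Y) [IsOpenImmersion f] [QuasiCompact f]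
    [QuasiSeparated f] : (pushforward f).Full where
  map_surjective g := by
    obtain ⟨h, hh⟩ := (Scheme.Modules.pushforward f).map_surjective g.hom
    exact ⟨ObjectProperty.homMk h, ObjectProperty.hom_ext _ hh⟩

instance {X Y : Scheme.{u}} (f : X ⟶ Y) [IsOpenImmersion f] [QuasiCompact f]
    [QuasiSeparated f] : (pushforward f).Faithful where
  map_injective h := ObjectProperty.hom_ext _ ((Scheme.Modules.pushforward f).map_injective
    congr(($h).hom))

instance : (extend hW).Full := by
  unfold extend
  infer_instance

instance : (extend hW).Faithful := by
  unfold extend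
  infer_instance

end Functors

/-! ### Testing on affine open subsets -/

section Affine

variable {X : Scheme.{u}}

lemma injective_of_mono {F G : Qcoh X} (g : F ⟶ G) [Mono g] (U : X.Opens) :
    Function.Injective (g.hom.app U) :=
  (ModuleCat.mono_iff_injective ((sections U).map g)).1 inferInstance

lemma le_iSup_affineOpens (U : X.Opens) : U ≤ ⨆ W : {W : X.affineOpens // W.1 ≤ U}, W.1.1 := by
  intro x hx
  obtain ⟨W, hW, hxW, hWU⟩ := Opens.isBasis_iff_nbhd.1 X.isBasis_affineOpens hx
  exact Opens.mem_iSup.2 ⟨⟨⟨W, hW⟩, hWU⟩, hxW⟩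

lemma hom_ext_of_affine {F G : Qcoh X} {f g : F ⟶ G}
    (h : ∀ W, IsAffineOpen W → ∀ x, f.hom.app W x = g.hom.app W x) : f = g := by
  refine ObjectProperty.hom_ext _ (Scheme.Modules.hom_ext _ _ fun U => ?_)
  ext x
  refine sections_ext _ (fun W : {W : X.affineOpens // W.1 ≤ U} => W.2) (le_iSup_affineOpens U)
    fun W => ?_
  rw [← app_res', ← app_res', h _ W.1.2]

lemma mono_of_injective {F G : Qcoh X} (g : F ⟶ G)
    (h : ∀ W, IsAffineOpen W → Function.Injective (g.hom.app W)) : Mono g :=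
  ⟨fun a b e => hom_ext_of_affine fun W hW x => h W hW (by
    exact congr(($e).hom.app W x))⟩

lemma epi_of_surjective {F G : Qcoh X} (g : F ⟶ G)
    (h : ∀ W, IsAffineOpen W → Function.Surjective (g.hom.app W)) : Epi g :=
  ⟨fun a b e => hom_ext_of_affine fun W hW x => by
    obtain ⟨y, rfl⟩ := h W hW x
    exact congr(($e).hom.app W y)⟩

lemma isIso_of_bijective {F G : Qcoh X} (g : F ⟶ G)
    (h : ∀ W, IsAffineOpen W → Function.Bijective (g.hom.app W)) : IsIso g := by
  have := mono_of_injective g fun W hW => (h W hW).1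
  have := epi_of_surjective g fun W hW => (h W hW).2
  exact isIso_of_mono_of_epi g

lemma isZero_of_sections {F : Qcoh X}
    (h : ∀ W, IsAffineOpen W → ∀ x : Γ(F.obj, W), x = 0) : IsZero F :=
  (IsZero.iff_id_eq_zero _).2 (hom_ext_of_affine fun W hW x => by
    rw [h W hW x, map_zero, map_zero])

lemma LocalizesAt.eq_zero {F : X.Modules} {U : X.Opens} {f : Γ(X, U)}
    (hF : LocalizesAt F (X.basicOpen_le f) f) [Subsingleton Γ(F, U)]
    (x : Γ(F, X.basicOpen f)) : x = 0 := by
  obtain ⟨n, y, hy⟩ := hF.1 x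
  rw [Subsingleton.elim y 0, map_zero] at hy
  exact (isUnit_resO_basicOpen_pow f n).smul_eq_zero.1 hy.symm

lemma isZero_of_cover {F : Qcoh X} {ι : Type*} (W : ι → X.Opens) (hc : ⨆ i, W i = ⊤)
    (hW : ∀ i, IsAffineOpen (W i)) (h : ∀ i, IsZero ((sections (W i)).obj F)) : IsZero F := by
  refine isZero_of_sections fun U _ x => sections_eq_zero
    (fun D : {D : X.Opens // D ≤ U ∧ ∃ i, ∃ f : Γ(X, W i), D = X.basicOpen f} => D.1)
    (fun D => D.2.1) (fun y hy => ?_) ?_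
  · obtain ⟨i, hi⟩ := Opens.mem_iSup.1 (hc.ge (trivial : y ∈ (⊤ : X.Opens)))
    obtain ⟨f, hf, hyf⟩ := (hW i).exists_basicOpen_le ⟨y, hy⟩ hi
    exact Opens.mem_iSup.2 ⟨⟨_, hf, i, f, rfl⟩, hyf⟩
  · rintro ⟨_, hD, i, f, rfl⟩
    have : Subsingleton Γ(F.obj, W i) := ModuleCat.subsingleton_of_isZero (h i)
    exact (isQcoh_iff_localizesAt.1 F.property (W i) (hW i) f).eq_zero _

end Affine

/-! ### Directed unions -/

section Union

variable {X : Scheme.{u}} [QuasiSeparatedSpace X]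

lemma preservesColimits_sections {W : X.Opens} (hW : IsAffineOpen W) :
    PreservesColimitsOfSize.{u, u} (sections W) :=
  (sectionsAdjunction hW).leftAdjoint_preservesColimits

lemma preservesFiniteColimits_sections {W : X.Opens} (hW : IsAffineOpen W) :
    PreservesFiniteColimits (sections W) := by
  have := (sectionsAdjunction hW).leftAdjoint_preservesColimits.{0, 0}
  exact inferInstance

lemma surjective_of_epi {F G : Qcoh X} (g : F ⟶ G) [Epi g] {W : X.Opens} (hW : IsAffineOpen W) :
    Function.Surjective (g.hom.app W) := by
  have := preservesFiniteColimits_sections hW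
  exact (ModuleCat.epi_iff_surjective ((sections W).map g)).1 inferInstance

lemma nonempty_isColimit_of_mono_of_exists_rep {J : Type u} [SmallCategory J] [IsFiltered J]
    {F : J ⥤ Qcoh X}
    (c : Cocone F) (hm : ∀ j, Mono (c.ι.app j))
    (hc : ∀ W, IsAffineOpen W → ∀ x : Γ(c.pt.obj, W), ∃ j y, (c.ι.app j).hom.app W y = x) :
    Nonempty (IsColimit c) := by
  have h : IsIso (colimit.desc F c) := by
    refine isIso_of_bijective _ fun W hW => ⟨?_, fun x => ?_⟩
    · refine (injective_iff_map_eq_zero _).2 fun x hx => ?_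
      have := preservesColimits_sections hW
      have hl := isColimitOfPreserves (sections W) (colimit.isColimit F)
      obtain ⟨j, y, rfl⟩ := Concrete.isColimit_exists_rep _ hl x
      have e : (c.ι.app j).hom.app W y = 0 := by
        rw [← colimit.ι_desc c j]
        exact hx
      have hy : y = 0 := injective_of_mono (c.ι.app j) W (e.trans (map_zero _).symm)
      rw [hy]
      exact map_zero (((sections W).map (colimit.ι F j)).hom)
    · obtain ⟨j, y, rfl⟩ := hc W hW x
      refine ⟨(colimit.ι F j).hom.app W y, ?_⟩
      exact congr(($(colimit.ι_desc c j)).hom.app W y)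
  have : IsIso ((colimit.isColimit F).desc c) := h
  exact ⟨IsColimit.ofPointIso (colimit.isColimit F)⟩

lemma exists_rep_of_isColimit {J : Type u} [SmallCategory J] [IsFiltered J] {F : J ⥤ Qcoh X}
    {c : Cocone F} (hc : IsColimit c) {W : X.Opens} (hW : IsAffineOpen W) (x : Γ(c.pt.obj, W)) :
    ∃ j y, (c.ι.app j).hom.app W y = x := by
  have := preservesColimits_sections hW
  exact Concrete.isColimit_exists_rep _ (isColimitOfPreserves (sections W) hc) x

lemma mono_of_isColimit {J : Type u} [SmallCategory J] [IsFiltered J] {F : J ⥤ Qcoh X}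
    {c : Cocone F} (hc : IsColimit c) (hF : ∀ {i j : J} (f : i ⟶ j), Mono (F.map f)) (j : J) :
    Mono (c.ι.app j) := by
  refine mono_of_injective _ fun W hW => (injective_iff_map_eq_zero _).2 fun x hx => ?_
  have := preservesColimits_sections hW
  have hl := isColimitOfPreserves (sections W) hc
  obtain ⟨k, f, g, hf⟩ :=
    Concrete.isColimit_exists_of_rep_eq (F ⋙ sections W) hl (i := j) (j := j) x
    (0 : Γ((F.obj j).obj, W)) (hx.trans (map_zero ((sections W).map (c.ι.app j)).hom).symm)
  have := hF f
  refine injective_of_mono (F.map f) W (hf.trans ?_)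
  exact (map_zero ((sections W).map (F.map g)).hom).trans
      (map_zero ((sections W).map (F.map f)).hom).symm

lemma exists_rep_of_isCompact {J : Type u} [SmallCategory J] [IsFiltered J] {F : J ⥤ Qcoh X}
    {c : Cocone F} (hc : IsColimit c) (hm : ∀ j, Mono (c.ι.app j))
    {U : X.Opens} (hU : IsCompact (U : Set X)) (x : Γ(c.pt.obj, U)) :
    ∃ j y, (c.ι.app j).hom.app U y = x := by
  obtain ⟨ι, _, V, hV, hUV⟩ := exists_finite_affine_cover hU
  have hle (i : ι) : V i ≤ U := hUV.symm ▸ le_iSup V i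
  choose j y hy using fun i => exists_rep_of_isColimit hc (hV i) (res _ (hle i) x)
  have := Fintype.ofFinite ι
  classical
  obtain ⟨k, hk⟩ := IsFiltered.sup_objs_exists (Finset.univ.image j)
  let t (i : ι) : j i ⟶ k := (hk (Finset.mem_image_of_mem j (Finset.mem_univ i))).some
  have hy' (i : ι) : (c.ι.app k).hom.app (V i) ((F.map (t i)).hom.app (V i) (y i)) =
      res _ (hle i) x := by
    rw [← hy i, ← c.w (t i)]
    rfl
  obtain ⟨z, hz⟩ := exists_sections_glue (F := (F.obj k).obj) V hle hUV.le
    (fun i => (F.map (t i)).hom.app (V i) (y i)) (fun i i' => by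
      refine injective_of_mono (c.ι.app k) _ ?_
      rw [app_res', app_res', hy', hy']
      exact (res_res _ _ _).trans (res_res _ _ _).symm)
  refine ⟨k, z, sections_ext V hle hUV.le fun i => ?_⟩
  rw [← app_res', hz, hy']
  rfl

instance {W : X.Opens} (hW : IsAffineOpen W) : (extend hW).IsRightAdjoint :=
  (sectionsAdjunction hW).isRightAdjoint

instance {W : X.Opens} (hW : IsAffineOpen W) : (extend hW).Additive :=
  (extend hW).additive_of_preserves_binary_products

lemma nonempty_isColimit_extend {W : X.Opens} (hW : IsAffineOpen W) {J : Type u} [SmallCategory J]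
    [IsFiltered J] {N : J ⥤ ModuleCat.{u} Γ(X, W)} {c : Cocone N} (hc : IsColimit c)
    (hm : ∀ j, Mono (c.ι.app j)) : Nonempty (IsColimit ((extend hW).mapCocone c)) := by
  have hc' := isColimitOfPreserves (tildeQcoh Γ(X, W)).functor hc
  have hm' (j : J) : Mono (((tildeQcoh Γ(X, W)).functor.mapCocone c).ι.app j) := by
    have := hm j
    exact inferInstanceAs (Mono ((tildeQcoh Γ(X, W)).functor.map (c.ι.app j)))
  refine nonempty_isColimit_of_mono_of_exists_rep _ (fun j => ?_) (fun W' hW' x => ?_)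
  · have := hm j
    exact inferInstanceAs (Mono ((extend hW).map (c.ι.app j)))
  · exact exists_rep_of_isCompact hc' hm' (U := hW.fromSpec ⁻¹ᵁ W')
      (hW.fromSpec.isCompact_preimage hW'.isCompact) x

end Union

/-! ### Serre subcategories and exact functors with a fully faithful right adjoint -/

section Locality

universe v w v' w'

variable {C : Type w} [Category.{v} C] [Abelian C] (S : ObjectProperty C) [S.IsSerreClass]

instance : S.IsClosedUnderBinaryProducts where
  limitsOfShape_le := by
    rintro M ⟨p⟩
    let e : M ≅ p.diag.obj ⟨.left⟩ ⨯ p.diag.obj ⟨.right⟩ :=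
      p.isLimit.conePointUniqueUpToIso
        ((IsLimit.postcomposeHomEquiv (diagramIsoPair p.diag).symm _).symm (prodIsProd _ _))
    exact S.prop_of_iso (e ≪≫ (biprod.isoProd _ _).symm).symm
      (S.prop_biprod (p.prop_diag_obj _) (p.prop_diag_obj _))

instance : S.IsClosedUnderFiniteProducts := .mk'

section

variable {D : Type w'} [Category.{v'} D] {Ψ : C ⥤ D} {Φ : D ⥤ C}
  [PreservesFiniteLimits Ψ] [Φ.Full] [Φ.Faithful]

lemma prop_map_of_mono_obj (adj : Ψ ⊣ Φ) {F : C} (hF : S F) {N : D} (f : N ⟶ Ψ.obj F) [Mono f] :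
    S.map Ψ N := by
  have := adj.rightAdjoint_preservesLimits.{0, 0}
  have hi : IsIso (Ψ.map (pullback.snd (adj.unit.app F) (Φ.map f))) :=
    (IsPullback.map Ψ (IsPullback.of_hasPullback (adj.unit.app F) (Φ.map f))).isIso_snd_of_isIso
  exact ⟨pullback (adj.unit.app F) (Φ.map f), S.prop_of_mono (pullback.fst _ _) hF,
    ⟨asIso (Ψ.map (pullback.snd (adj.unit.app F) (Φ.map f))) ≪≫ asIso (adj.counit.app N)⟩⟩

lemma prop_map_of_mono (adj : Ψ ⊣ Φ) {M N : D} (hN : S.map Ψ N) (f : M ⟶ N) [Mono f] :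
    S.map Ψ M := by
  obtain ⟨F, hF, ⟨e⟩⟩ := hN
  exact prop_map_of_mono_obj S adj hF (f ≫ e.inv)

variable [Abelian D]

lemma prop_map_of_jointly_mono (adj : Ψ ⊣ Φ) {K : Type*} [Finite K] {N : D} {M : K → D}
    (hM : ∀ k, S.map Ψ (M k)) (g : ∀ k, N ⟶ M k)
    (hg : ∀ {Z : D} (a : Z ⟶ N), (∀ k, a ≫ g k = 0) → a = 0) : S.map Ψ N := by
  obtain ⟨n, ⟨ε⟩⟩ := Finite.exists_equiv_fin K
  choose F hF e using fun k : Fin n => hM (ε.symm k)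
  have := Abelian.hasFiniteBiproducts (C := C)
  have := Abelian.hasFiniteBiproducts (C := D)
  have : Ψ.Additive := Ψ.additive_of_preserves_binary_products
  let l : N ⟶ ⨁ Ψ.obj ∘ F := biproduct.lift fun k => g (ε.symm k) ≫ (e k).some.inv
  have : Mono (l ≫ (Ψ.mapBiproduct F).inv) := by
    refine Preadditive.mono_of_cancel_zero _ fun a ha => hg a fun k => ?_
    have h : a ≫ l = 0 := by
      rw [← cancel_mono (Ψ.mapBiproduct F).inv, Category.assoc, ha, zero_comp]
    have h' := h =≫ biproduct.π _ (ε k)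
    rw [Category.assoc, biproduct.lift_π, zero_comp, ← Category.assoc] at h'
    have h'' := (cancel_mono (e (ε k)).some.inv).1 (h'.trans zero_comp.symm)
    rwa [ε.symm_apply_apply] at h''
  exact prop_map_of_mono_obj S adj
    (S.prop_of_iso (biproduct.isoProduct F).symm (S.prop_product hF)) (l ≫ (Ψ.mapBiproduct F).inv)

variable [PreservesFiniteColimits Ψ]

lemma prop_map_of_epi_obj (adj : Ψ ⊣ Φ) {F : C} (hF : S F) {N : D} (g : Ψ.obj F ⟶ N) [Epi g] :
    S.map Ψ N := by
  let h := adj.homEquiv _ _ g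
  have e : Ψ.map (factorThruImage h) ≫ Ψ.map (image.ι h) ≫ adj.counit.app N = g := by
    rw [← Category.assoc, ← Ψ.map_comp, image.fac]
    exact (adj.homEquiv_counit (g := h)).symm.trans ((adj.homEquiv _ _).symm_apply_apply g)
  have h₁ : Mono (Ψ.map (image.ι h) ≫ adj.counit.app N) := inferInstance
  have h₂ : Epi (Ψ.map (image.ι h) ≫ adj.counit.app N) :=
    @epi_of_epi_fac _ _ _ _ _ _ _ _ ‹Epi g› e
  have := isIso_of_mono_of_epi (Ψ.map (image.ι h) ≫ adj.counit.app N)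
  exact ⟨image h, S.prop_of_epi (factorThruImage h) hF,
    ⟨asIso (Ψ.map (image.ι h) ≫ adj.counit.app N)⟩⟩

lemma prop_map_of_epi (adj : Ψ ⊣ Φ) {M N : D} (hM : S.map Ψ M) (f : M ⟶ N) [Epi f] :
    S.map Ψ N := by
  obtain ⟨F, hF, ⟨e⟩⟩ := hM
  exact prop_map_of_epi_obj S adj hF (e.hom ≫ f)

end

section

variable {D : Type w'} [Category.{v'} D] [Abelian D] {Ψ : C ⥤ D}

lemma isZero_map_kernel [Ψ.PreservesZeroMorphisms] [PreservesFiniteLimits Ψ] {X Y : C} (f : X ⟶ Y)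
    [Mono (Ψ.map f)] : IsZero (Ψ.obj (kernel f)) := by
  refine (IsZero.iff_id_eq_zero _).2 ?_
  rw [← cancel_mono (Ψ.map (kernel.ι f)), ← cancel_mono (Ψ.map f), zero_comp, zero_comp,
    Category.id_comp, ← Ψ.map_comp, kernel.condition, Ψ.map_zero]

lemma isZero_map_cokernel [Ψ.PreservesZeroMorphisms] [PreservesFiniteColimits Ψ] {X Y : C}
    (f : X ⟶ Y) [Epi (Ψ.map f)] : IsZero (Ψ.obj (cokernel f)) := by
  refine (IsZero.iff_id_eq_zero _).2 ?_
  rw [← cancel_epi (Ψ.map (cokernel.π f)), ← cancel_epi (Ψ.map f), comp_zero, comp_zero,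
    Category.comp_id, ← Ψ.map_comp, cokernel.condition, Ψ.map_zero]

variable [PreservesFiniteLimits Ψ] [PreservesFiniteColimits Ψ] {Φ : D ⥤ C} [Φ.Full] [Φ.Faithful]

/-- If `Ψ G ≅ Ψ F` with `F` in the subcategory, the pullback of the two morphisms from `G` and `F`
to `Φ (Ψ F)` differs from `F` and from `G` only by objects that are killed by `Ψ`. -/
lemma prop_of_adjunction (adj : Ψ ⊣ Φ) {G : C} (hG : S.map Ψ (Ψ.obj G))
    (hsub : ∀ {K : C} (k : K ⟶ G) [Mono k], IsZero (Ψ.obj K) → S K)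
    (hquot : ∀ {Q : C} (q : G ⟶ Q) [Epi q], IsZero (Ψ.obj Q) → S Q) : S G := by
  obtain ⟨F, hF, ⟨e⟩⟩ := hG
  let η := adj.unit.app G
  let k : F ⟶ Φ.obj (Ψ.obj G) := adj.unit.app F ≫ Φ.map e.hom
  have hη : IsIso (Ψ.map η) := inferInstance
  have hk : IsIso (Ψ.map k) := by
    rw [Functor.map_comp]
    infer_instance
  have : Ψ.PreservesZeroMorphisms := ⟨fun X Y => by
    have := Ψ.additive_of_preserves_binary_products
    exact Ψ.map_zero X Y⟩
  have hP := IsPullback.of_hasPullback η k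
  have hfst : IsIso (Ψ.map (pullback.fst η k)) := (hP.map Ψ).isIso_fst_of_isIso
  have hsnd : IsIso (Ψ.map (pullback.snd η k)) := (hP.map Ψ).isIso_snd_of_isIso
  have hmono : Mono (kernel.ι (pullback.snd η k) ≫ pullback.fst η k) :=
    Preadditive.mono_of_cancel_zero _ fun a ha => by
      rw [← cancel_mono (kernel.ι (pullback.snd η k))]
      refine pullback.hom_ext ?_ ?_
      · rw [zero_comp, zero_comp, Category.assoc, ha]
      · rw [zero_comp, zero_comp, Category.assoc, kernel.condition, comp_zero]
  have hpullback : S (pullback η k) := S.prop_X₂_of_exact (ShortComplex.exact_kernel _)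
    (hsub (kernel.ι (pullback.snd η k) ≫ pullback.fst η k) (isZero_map_kernel _)) hF
  exact S.prop_X₂_of_exact (ShortComplex.exact_cokernel (pullback.fst η k)) hpullback
    (hquot (cokernel.π _) (isZero_map_cokernel _))

end

theorem prop_of_map {ι : Type*} [Finite ι] {D : ι → Type w'} [∀ i, Category.{v'} (D i)]
    [∀ i, Abelian (D i)] {Ψ : ∀ i, C ⥤ D i} {Φ : ∀ i, D i ⥤ C} (adj : ∀ i, Ψ i ⊣ Φ i)
    [∀ i, PreservesFiniteLimits (Ψ i)] [∀ i, PreservesFiniteColimits (Ψ i)] [∀ i, (Φ i).Full]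
    [∀ i, (Φ i).Faithful] (hd : ∀ G, (∀ i, IsZero ((Ψ i).obj G)) → IsZero G)
    {G : C} (hG : ∀ i, S.map (Ψ i) ((Ψ i).obj G)) : S G := by
  classical
  have := Fintype.ofFinite ι
  have key (s : Finset ι) : ∀ G, (∀ i, i ∉ s → IsZero ((Ψ i).obj G)) →
      (∀ i, S.map (Ψ i) ((Ψ i).obj G)) → S G := by
    induction s using Finset.induction_on with
    | empty => exact fun G h _ => S.prop_of_isZero (hd G fun i => h i (Finset.notMem_empty i))
    | insert i t _ ih =>
      intro G h₀ h₁
      have hz (j : ι) (hj : j ∉ t) (hji : j ≠ i) : IsZero ((Ψ j).obj G) :=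
        h₀ j (by simp [hj, hji])
      refine prop_of_adjunction S (adj i) (h₁ i) (fun k _ hK => ih _ (fun j hj => ?_) fun j =>
        prop_map_of_mono S (adj j) (h₁ j) ((Ψ j).map k)) (fun q _ hQ => ih _ (fun j hj => ?_)
        fun j => prop_map_of_epi S (adj j) (h₁ j) ((Ψ j).map q))
      · rcases eq_or_ne j i with rfl | hji
        exacts [hK, (hz j hj hji).of_mono ((Ψ j).map k)]
      · rcases eq_or_ne j i with rfl | hji
        exacts [hQ, (hz j hj hji).of_epi ((Ψ j).map q)]
  exact key Finset.univ G (fun i hi => (hi (Finset.mem_univ i)).elim) hG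

lemma closedObjects_of_injective {M P Q : C} (i : M ⟶ P) (p : P ⟶ Q) (w : i ≫ p = 0)
    (hl : IsLimit (KernelFork.ofι i w)) [Injective P]
    (hP : ∀ A, S A → ∀ g : A ⟶ P, g = 0) (hQ : ∀ A, S A → ∀ g : A ⟶ Q, g = 0) :
    closedObjects S M := by
  have hi : Mono i := mono_of_isLimit_fork hl
  intro A B f hf
  refine ⟨fun a b hab => ?_, fun g => ?_⟩
  · have h : f ≫ (a - b) = 0 := by
      rw [Preadditive.comp_sub]
      exact sub_eq_zero.2 hab
    have h₂ : cokernel.desc f (a - b) h ≫ i = 0 := hP _ hf.2 _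
    have h₃ : a - b = 0 := by
      rw [← cokernel.π_desc f (a - b) h, zero_of_comp_mono i h₂, comp_zero]
    exact sub_eq_zero.1 h₃
  · have h : kernel.ι f ≫ g = 0 := zero_of_comp_mono i (hP _ hf.1 _)
    let g' : Abelian.coimage f ⟶ M := cokernel.desc _ g h
    let b : B ⟶ P := Injective.factorThru (g' ≫ i) (Abelian.factorThruCoimage f)
    have hb : f ≫ b = g ≫ i := by
      rw [← Abelian.coimage.fac f, Category.assoc, Injective.comp_factorThru, ← Category.assoc]
      congr 1
      exact cokernel.π_desc _ _ _
    have hb' : b ≫ p = 0 := by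
      have h₁ : f ≫ b ≫ p = 0 := by rw [← Category.assoc, hb, Category.assoc, w, comp_zero]
      rw [← cokernel.π_desc f (b ≫ p) h₁, hQ _ hf.2 (cokernel.desc f (b ≫ p) h₁), comp_zero]
    obtain ⟨c, hc⟩ := KernelFork.IsLimit.lift' hl b hb'
    refine ⟨c, ?_⟩
    rw [← cancel_mono i]
    exact (Category.assoc _ _ _).trans ((congrArg (f ≫ ·) hc).trans hb)

end Locality

/-! ### The tensor product of quasi-coherent sheaves -/

section Algebra

variable {R A M N M' N' : Type*} [CommRing R] [CommRing A] [Algebra R A] (f : R)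
  [IsLocalization.Away f A] [AddCommGroup M] [AddCommGroup N] [AddCommGroup M'] [AddCommGroup N']
  [Module R M] [Module R N] [Module R M'] [Module R N'] [Module A M'] [Module A N']
  [IsScalarTower R A M'] [IsScalarTower R A N'] (g : M →ₗ[R] M') (h : N →ₗ[R] N')
  [IsLocalizedModule.Away f g] [IsLocalizedModule.Away f h]

lemma exists_pow_smul_of_tensorProduct (t : M ⊗[R] N →+ M' ⊗[A] N')
    (ht : ∀ m n, t (m ⊗ₜ n) = g m ⊗ₜ h n) :
    (∀ x, ∃ (n : ℕ) (y : M ⊗[R] N), t y = algebraMap R A (f ^ n) • x) ∧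
      ∀ y, t y = 0 → ∃ n : ℕ, f ^ n • y = 0 := by
  let e := (IsLocalization.moduleTensorEquiv (.powers f) A M' N').toAddEquiv
  have he (y) : e (t y) = TensorProduct.map g h y := by
    induction y with
    | zero => simp only [map_zero]
    | add x y hx hy => simp only [map_add, hx, hy]
    | tmul m n =>
      rw [ht]
      rfl
  have hs (r : R) (x) : e (algebraMap R A r • x) = r • e x := by
    rw [← algebraMap_smul A r (e x)]
    exact (IsLocalization.moduleTensorEquiv (.powers f) A M' N').map_smul _ x
  have hl : IsLocalizedModule.Away f (TensorProduct.map g h) := inferInstance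
  refine ⟨fun x => ?_, fun y hy => ?_⟩
  · obtain ⟨n, y, hy⟩ := hl.surj _ _ (e x)
    refine ⟨n, y, e.injective ?_⟩
    rw [he, hs, ← hy]
  · obtain ⟨⟨_, n, rfl⟩, hn⟩ := (IsLocalizedModule.eq_zero_iff (.powers f)
      (TensorProduct.map g h)).mp (by rw [← he, hy, map_zero] : TensorProduct.map g h y = 0)
    exact ⟨n, hn⟩

end Algebra

section Presheaf

variable {X : Scheme.{u}} {W : X.Opens}

lemma ideal_eq_top_of_cover (hW : IsAffineOpen W) (I : Ideal Γ(X, W))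
    (h : ∀ p ∈ W, ∃ f ∈ I, p ∈ X.basicOpen f) : I = ⊤ := by
  rw [← Ideal.span_eq I, ← hW.iSup_basicOpen_eq_self_iff]
  refine le_antisymm (iSup_le fun f => X.basicOpen_le _) fun p hp => ?_
  obtain ⟨f, hf, hpf⟩ := h p hp
  exact Opens.mem_iSup.2 ⟨⟨f, hf⟩, hpf⟩

lemma mem_basicOpen_pow {f : Γ(X, W)} {p : X} (hp : p ∈ X.basicOpen f) (n : ℕ) :
    p ∈ X.basicOpen (f ^ n) := by
  rcases Nat.eq_zero_or_pos n with rfl | hn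
  · simpa using X.basicOpen_le f hp
  · rwa [X.basicOpen_pow _ hn]

variable {T : X.Opens → Type u} [∀ U, AddCommGroup (T U)] [∀ U, Module Γ(X, U) (T U)]
  (ρ : ∀ {U V : X.Opens}, V ≤ U → T U →+ T V) {A : X.Modules}
  (θ : ∀ U, T U →ₗ[Γ(X, U)] Γ(A, U))

/-- The maps `θ` exhibit the module `A` as the sheaf associated with a presheaf `T` of modules with
restriction maps `ρ`, and the sections of `T` over affine open subsets localize. The presheaf is
unbundled so that `T U` can be the tensor product of two modules of sections. -/
structure IsLocalizingSheafification : Prop where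
  map_map {U V W : X.Opens} (h : V ≤ U) (h' : W ≤ V) (x : T U) : ρ h' (ρ h x) = ρ (h'.trans h) x
  map_res {U V : X.Opens} (h : V ≤ U) (x : T U) : θ V (ρ h x) = res A h (θ U x)
  locally_injective (U : X.Opens) (x : T U) (hx : θ U x = 0) (p : X) (hp : p ∈ U) :
    ∃ (V : X.Opens) (h : V ≤ U), p ∈ V ∧ ρ h x = 0
  locally_surjective (U : X.Opens) (a : Γ(A, U)) (p : X) (hp : p ∈ U) :
    ∃ (V : X.Opens) (h : V ≤ U), p ∈ V ∧ ∃ y, θ V y = res A h a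
  extends_of_pow {U : X.Opens} (hU : IsAffineOpen U) (f : Γ(X, U)) (x : T (X.basicOpen f)) :
    ∃ (n : ℕ) (y : T U), ρ (X.basicOpen_le f) y = resO (X.basicOpen_le f) (f ^ n) • x
  pow_smul_eq_zero {U : X.Opens} (hU : IsAffineOpen U) (f : Γ(X, U)) (y : T U)
    (hy : ρ (X.basicOpen_le f) y = 0) : ∃ n : ℕ, f ^ n • y = 0

namespace IsLocalizingSheafification

variable {ρ θ}

lemma injective (hA : IsLocalizingSheafification ρ θ) (hW : IsAffineOpen W) :
    Function.Injective (θ W) := by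
  refine (injective_iff_map_eq_zero _).2 fun x hx => ?_
  have h : LinearMap.ker (LinearMap.toSpanSingleton Γ(X, W) _ x) = ⊤ := by
    refine ideal_eq_top_of_cover hW _ fun p hp => ?_
    obtain ⟨V, hV, hpV, hVx⟩ := hA.locally_injective W x hx p hp
    obtain ⟨f, hf, hpf⟩ := hW.exists_basicOpen_le ⟨p, hpV⟩ hp
    obtain ⟨n, hn⟩ := hA.pow_smul_eq_zero hW f x (by rw [← hA.map_map hV hf, hVx, map_zero])
    exact ⟨f ^ n, hn, mem_basicOpen_pow hpf n⟩
  simpa using (h.symm ▸ Submodule.mem_top :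
    (1 : Γ(X, W)) ∈ LinearMap.ker (LinearMap.toSpanSingleton Γ(X, W) _ x))

lemma pow_smul_eq_zero_of_res (hA : IsLocalizingSheafification ρ θ) (hW : IsAffineOpen W)
    (f : Γ(X, W)) (b : Γ(A, W)) (hb : res A (X.basicOpen_le f) b = 0) : ∃ n : ℕ, f ^ n • b = 0 := by
  have key : ∀ p ∈ W, ∃ g : Γ(X, W), p ∈ X.basicOpen g ∧
      ∃ n : ℕ, resO (X.basicOpen_le g) (f ^ n) • res A (X.basicOpen_le g) b = 0 := by
    intro p hp
    obtain ⟨V, hV, hpV, z, hz⟩ := hA.locally_surjective W b p hp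
    obtain ⟨g, hg, hpg⟩ := hW.exists_basicOpen_le ⟨p, hpV⟩ hp
    refine ⟨g, hpg, ?_⟩
    have hz' : θ _ (ρ hg z) = res A (X.basicOpen_le g) b := by rw [hA.map_res, hz, res_res]
    have hle : X.basicOpen (resO (X.basicOpen_le g) f) ≤ X.basicOpen f := by
      rw [basicOpen_resO]
      exact inf_le_right
    obtain ⟨n, hn⟩ := hA.pow_smul_eq_zero (hW.basicOpen g) (resO (X.basicOpen_le g) f)
      (ρ hg z) (by
      refine hA.injective ((hW.basicOpen g).basicOpen _) ?_
      rw [hA.map_res, hz', res_res, ← res_res (X.basicOpen_le f) hle, hb, map_zero,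
        map_zero])
    refine ⟨n, ?_⟩
    rw [← hz', map_pow, ← map_smul, hn, map_zero]
  choose! g hg n hn using key
  obtain ⟨s, hs⟩ := hW.isCompact.elim_finite_subcover (fun p : W => (X.basicOpen (g p) : Set X))
    (fun p => (X.basicOpen (g p)).isOpen) (fun p hp => Set.mem_iUnion.2 ⟨⟨p, hp⟩, hg p hp⟩)
  refine ⟨s.sup fun p => n p, sections_eq_zero (fun p : s => X.basicOpen (g p.1))
    (fun p => X.basicOpen_le _) (fun p hp => ?_) fun p => ?_⟩
  · obtain ⟨q, hq, hpq⟩ := Set.mem_iUnion₂.1 (hs hp)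
    exact Opens.mem_iSup.2 ⟨⟨q, hq⟩, hpq⟩
  · have h := hn p.1 p.1.2
    rw [map_pow] at h
    rw [res_smul, map_pow]
    exact pow_smul_eq_zero_of_le (Finset.le_sup (f := fun p : W => n p) p.2) h

lemma bijective (hA : IsLocalizingSheafification ρ θ) (hW : IsAffineOpen W) :
    Function.Bijective (θ W) := by
  refine ⟨hA.injective hW, fun a => ?_⟩
  have h : (LinearMap.range (θ W)).comap (LinearMap.toSpanSingleton Γ(X, W) _ a) = ⊤ := by
    refine ideal_eq_top_of_cover hW _ fun p hp => ?_
    obtain ⟨V, hV, hpV, z, hz⟩ := hA.locally_surjective W a p hp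
    obtain ⟨f, hf, hpf⟩ := hW.exists_basicOpen_le ⟨p, hpV⟩ hp
    obtain ⟨n, y, hy⟩ := hA.extends_of_pow hW f (ρ hf z)
    obtain ⟨m, hm⟩ := hA.pow_smul_eq_zero_of_res hW f
      (f ^ n • a - θ W y) (by
        rw [map_sub, res_smul, ← hA.map_res, hy, map_smul, hA.map_res, hz,
          res_res, sub_self])
    refine ⟨f ^ (m + n), ⟨f ^ m • y, ?_⟩, mem_basicOpen_pow hpf _⟩
    rw [smul_sub, sub_eq_zero] at hm
    rw [map_smul, ← hm, pow_add, ← mul_smul]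
    rfl
  obtain ⟨y, hy⟩ := (h.symm ▸ Submodule.mem_top :
    (1 : Γ(X, W)) ∈ (LinearMap.range (θ W)).comap (LinearMap.toSpanSingleton Γ(X, W) _ a))
  exact ⟨y, by simpa using hy⟩

lemma isQcoh (hA : IsLocalizingSheafification ρ θ) : Reconstruction.isQcoh X A := by
  refine isQcoh_iff_localizesAt.2 fun U hU f => ⟨fun a => ?_,
    hA.pow_smul_eq_zero_of_res hU f⟩
  obtain ⟨x, rfl⟩ := (hA.bijective (hU.basicOpen f)).2 a
  obtain ⟨n, y, hy⟩ := hA.extends_of_pow hU f x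
  exact ⟨n, θ U y, by rw [← hA.map_res, hy, map_smul]⟩

end IsLocalizingSheafification

end Presheaf

section Tensor

variable {X : Scheme.{u}} (F G : X.Modules)

/-- The presheaf tensor product. -/
def tensorPresheaf : PresheafOfModules X.ringCatSheaf.obj :=
  PresheafOfModules.Monoidal.tensorObj (R := X.presheaf) F.val G.val

/-- The map from the presheaf tensor product to its associated sheaf. -/
def tensorUnit : tensorPresheaf F G ⟶ (PresheafOfModules.restrictScalars (𝟙 X.ringCatSheaf.obj)).obj
    ((SheafOfModules.forget X.ringCatSheaf).obj (tensor F G)) :=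
  (PresheafOfModules.sheafificationAdjunction (𝟙 X.ringCatSheaf.obj)).unit.app (tensorPresheaf F G)

/-- The map from the tensor product of sections to the sections of the tensor product. -/
def toTensor (U : X.Opens) : Γ(F, U) ⊗[Γ(X, U)] Γ(G, U) →ₗ[Γ(X, U)] Γ(tensor F G, U) where
  toFun x := (tensorUnit F G).app (op U) x
  map_add' := map_add ((tensorUnit F G).app (op U)).hom
  map_smul' r x := ((tensorUnit F G).app (op U)).hom.map_smul r x

/-- The restriction maps of the presheaf tensor product. -/
def resTensor {U V : X.Opens} (h : V ≤ U) :
    Γ(F, U) ⊗[Γ(X, U)] Γ(G, U) →+ Γ(F, V) ⊗[Γ(X, V)] Γ(G, V) :=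
  ((tensorPresheaf F G).presheaf.map (homOfLE h).op).hom

lemma resTensor_tmul {U V : X.Opens} (h : V ≤ U) (x : Γ(F, U)) (y : Γ(G, U)) :
    resTensor F G h (x ⊗ₜ y) = res F h x ⊗ₜ res G h y := rfl

lemma resTensor_resTensor {U V W : X.Opens} (h : V ≤ U) (h' : W ≤ V)
    (x : Γ(F, U) ⊗[Γ(X, U)] Γ(G, U)) :
    resTensor F G h' (resTensor F G h x) = resTensor F G (h'.trans h) x := by
  induction x with
  | zero => simp only [map_zero]
  | add x y hx hy => simp only [map_add, hx, hy]
  | tmul x y => simp only [resTensor_tmul, res_res]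

lemma toTensor_resTensor {U V : X.Opens} (h : V ≤ U) (x : Γ(F, U) ⊗[Γ(X, U)] Γ(G, U)) :
    toTensor F G V (resTensor F G h x) = res (tensor F G) h (toTensor F G U x) :=
  congr($(((PresheafOfModules.toPresheaf _).map (tensorUnit F G)).naturality (homOfLE h).op) x)

lemma toTensor_locally_injective (U : X.Opens) (x) (hx : toTensor F G U x = 0) (p : X)
    (hp : p ∈ U) :
    ∃ (V : X.Opens) (h : V ≤ U), p ∈ V ∧ resTensor F G h x = 0 := by
  have h : Presheaf.IsLocallyInjective (Opens.grothendieckTopology X)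
      (CategoryTheory.toSheafify (Opens.grothendieckTopology X) (tensorPresheaf F G).presheaf) :=
    inferInstance
  obtain ⟨V, i, hi, hpV⟩ := h.equalizerSieve_mem (X := op U) x 0 (hx.trans (map_zero _).symm) p hp
  exact ⟨V, i.le, hpV, hi.trans (map_zero _)⟩

lemma toTensor_locally_surjective (U : X.Opens) (a : Γ(tensor F G, U)) (p : X) (hp : p ∈ U) :
    ∃ (V : X.Opens) (h : V ≤ U), p ∈ V ∧ ∃ y, toTensor F G V y = res (tensor F G) h a := by
  have h : Presheaf.IsLocallySurjective (Opens.grothendieckTopology X)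
      (CategoryTheory.toSheafify (Opens.grothendieckTopology X) (tensorPresheaf F G).presheaf) :=
    inferInstance
  obtain ⟨V, i, ⟨y, hy⟩, hpV⟩ := h.imageSieve_mem (U := U) a p hp
  exact ⟨V, i.le, hpV, y, hy⟩

variable {F G}

lemma isLocalizedModule_res (hF : isQcoh X F) {U : X.Opens} (hU : IsAffineOpen U) (f : Γ(X, U))
    [Module Γ(X, U) Γ(F, X.basicOpen f)]
    (g : Γ(F, U) →ₗ[Γ(X, U)] Γ(F, X.basicOpen f)) (hg : ∀ x, g x = res F (X.basicOpen_le f) x)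
    (hs : ∀ (r : Γ(X, U)) (x : Γ(F, X.basicOpen f)), r • x = resO (X.basicOpen_le f) r • x) :
    IsLocalizedModule.Away f g := by
  have h := isQcoh_iff_localizesAt.1 hF U hU f
  refine IsLocalizedModule.Away.mk_of_addCommGroup ?_ (fun x => ?_) (fun y hy => ?_)
  · have hu : IsUnit (resO (X.basicOpen_le f) f) :=
      RingedSpace.isUnit_res_basicOpen X.toRingedSpace f
    rw [Module.End.isUnit_iff]
    refine ⟨fun x y hxy => ?_, fun y => ?_⟩
    · refine hu.smul_left_cancel.1 ?_
      rw [← hs, ← hs]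
      exact hxy
    · obtain ⟨v, hv⟩ := hu
      refine ⟨v⁻¹ • y, ?_⟩
      change f • (v⁻¹ • y) = y
      rw [hs, ← hv]
      exact smul_inv_smul v y
  · obtain ⟨n, y, hy⟩ := h.1 x
    exact ⟨n, y, by rw [hg, hy, hs]⟩
  · exact h.2 y (by rw [← hg, hy])

lemma resTensor_localizing (hF : isQcoh X F) (hG : isQcoh X G) {U : X.Opens} (hU : IsAffineOpen U)
    (f : Γ(X, U)) :
    (∀ x, ∃ (n : ℕ) (y : Γ(F, U) ⊗[Γ(X, U)] Γ(G, U)),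
      resTensor F G (X.basicOpen_le f) y = resO (X.basicOpen_le f) (f ^ n) • x) ∧
    (∀ y, resTensor F G (X.basicOpen_le f) y = 0 → ∃ n : ℕ, f ^ n • y = 0) := by
  have := hU.isLocalization_basicOpen f
  let : Module Γ(X, U) Γ(F, X.basicOpen f) := Module.compHom _ (resO (X.basicOpen_le f))
  let : Module Γ(X, U) Γ(G, X.basicOpen f) := Module.compHom _ (resO (X.basicOpen_le f))
  have : IsScalarTower Γ(X, U) Γ(X, X.basicOpen f) Γ(F, X.basicOpen f) :=
    ⟨fun r s x => mul_smul (resO (X.basicOpen_le f) r) s x⟩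
  have : IsScalarTower Γ(X, U) Γ(X, X.basicOpen f) Γ(G, X.basicOpen f) :=
    ⟨fun r s x => mul_smul (resO (X.basicOpen_le f) r) s x⟩
  let g : Γ(F, U) →ₗ[Γ(X, U)] Γ(F, X.basicOpen f) :=
    { toFun := res F (X.basicOpen_le f), map_add' := map_add _, map_smul' := res_smul _ }
  let h : Γ(G, U) →ₗ[Γ(X, U)] Γ(G, X.basicOpen f) :=
    { toFun := res G (X.basicOpen_le f), map_add' := map_add _, map_smul' := res_smul _ }
  have := isLocalizedModule_res hF hU f g (fun _ => rfl) (fun _ _ => rfl)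
  have := isLocalizedModule_res hG hU f h (fun _ => rfl) (fun _ _ => rfl)
  exact exists_pow_smul_of_tensorProduct (A := Γ(X, X.basicOpen f)) f g h
    (resTensor F G (X.basicOpen_le f)) (resTensor_tmul F G _)

lemma isLocalizingSheafification_toTensor (hF : isQcoh X F) (hG : isQcoh X G) :
    IsLocalizingSheafification (resTensor F G) (toTensor F G) where
  map_map := resTensor_resTensor F G
  map_res := toTensor_resTensor F G
  locally_injective := toTensor_locally_injective F G
  locally_surjective := toTensor_locally_surjective F G
  extends_of_pow hU f := (resTensor_localizing hF hG hU f).1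
  pow_smul_eq_zero hU f := (resTensor_localizing hF hG hU f).2

lemma isQcoh_tensor (hF : isQcoh X F) (hG : isQcoh X G) : isQcoh X (tensor F G) :=
  (isLocalizingSheafification_toTensor hF hG).isQcoh

lemma bijective_toTensor (hF : isQcoh X F) (hG : isQcoh X G) {W : X.Opens} (hW : IsAffineOpen W) :
    Function.Bijective (toTensor F G W) :=
  (isLocalizingSheafification_toTensor hF hG).bijective hW

end Tensor

/-! ### Stalks -/

section Vanishing

variable {X : Scheme.{u}}

lemma res_basicOpen_eq_zero {F : X.Modules} {W : X.Opens} {f : Γ(X, W)} {x : Γ(F, W)}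
    (h : f • x = 0) : res F (X.basicOpen_le f) x = 0 := by
  have hf : IsUnit (resO (X.basicOpen_le f) f) :=
    RingedSpace.isUnit_res_basicOpen X.toRingedSpace f
  exact hf.smul_eq_zero.1 (by rw [← res_smul, h, map_zero])

lemma exists_smul_eq_zero_of_vanishingAt {P : X} {W : X.Opens} (hW : IsAffineOpen W) (hP : P ∈ W)
    {F : Qcoh X} (h : vanishingAt P F) (x : Γ(F.obj, W)) :
    ∃ f : Γ(X, W), P ∈ X.basicOpen f ∧ f • x = 0 := by
  have := AddCommGrpCat.subsingleton_of_isZero h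
  obtain ⟨V, hPV, i, _, hx⟩ := TopCat.Presheaf.germ_eq F.obj.presheaf P hP hP x 0
    (Subsingleton.elim _ _)
  have hx' : res F.obj i.le x = 0 := hx.trans (map_zero _)
  obtain ⟨f, hf, hPf⟩ := hW.exists_basicOpen_le ⟨P, hPV⟩ hP
  obtain ⟨n, hn⟩ := (isQcoh_iff_localizesAt.1 F.property W hW f).2 x
    (by rw [← res_res i.le hf, hx', map_zero])
  exact ⟨f ^ n, mem_basicOpen_pow hPf n, hn⟩

lemma vanishingAt_of_forall_exists_smul_eq_zero {P : X} {W : X.Opens} (hW : IsAffineOpen W)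
    (hP : P ∈ W) {F : Qcoh X}
    (h : ∀ x : Γ(F.obj, W), ∃ f : Γ(X, W), P ∈ X.basicOpen f ∧ f • x = 0) : vanishingAt P F := by
  have : Subsingleton (↑(TopCat.Presheaf.stalk F.obj.presheaf P) : Type u) := by
    refine subsingleton_of_forall_eq 0 fun t => ?_
    obtain ⟨U, hPU, x, rfl⟩ := TopCat.Presheaf.exists_germ_eq F.obj.presheaf t
    obtain ⟨f, hf, hPf⟩ := hW.exists_basicOpen_le ⟨P, hPU⟩ hP
    obtain ⟨n, y, hy⟩ := (isQcoh_iff_localizesAt.1 F.property W hW f).1 (res F.obj hf x)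
    obtain ⟨g, hPg, hg⟩ := h y
    have hle : X.basicOpen f ⊓ X.basicOpen g ≤ X.basicOpen f := inf_le_left
    have hx : res F.obj (hle.trans hf) x = 0 := by
      refine ((isUnit_resO_basicOpen_pow f n).map (resO hle)).smul_eq_zero.1 ?_
      rw [← res_res hf hle, ← res_smul, ← hy, res_res, ← res_res (X.basicOpen_le g) inf_le_right,
        res_basicOpen_eq_zero hg, map_zero]
    rw [← TopCat.Presheaf.germ_res_apply F.obj.presheaf (homOfLE (hle.trans hf)) P ⟨hPf, hPg⟩ x]
    exact (congrArg _ hx).trans (map_zero _)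
  exact AddCommGrpCat.isZero_of_subsingleton _

lemma vanishingAt_iff {P : X} {W : X.Opens} (hW : IsAffineOpen W) (hP : P ∈ W) (F : Qcoh X) :
    vanishingAt P F ↔ ∀ x : Γ(F.obj, W), ∃ f : Γ(X, W), P ∈ X.basicOpen f ∧ f • x = 0 :=
  ⟨exists_smul_eq_zero_of_vanishingAt hW hP, vanishingAt_of_forall_exists_smul_eq_zero hW hP⟩

end Vanishing

/-! ### Tensor-closed Serre subcategories -/

section TensorSerre

variable {X : Scheme.{u}}

lemma exists_hom_of_tensorProduct_restrictScalars {A B : Type u} [CommRing A] [CommRing B]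
    {φ : A →+* B} {M : ModuleCat.{u} A} {N : ModuleCat.{u} B}
    (ρ : M ⟶ (ModuleCat.restrictScalars φ).obj N) :
    ∃ g : ModuleCat.of A (M ⊗[A] (ModuleCat.restrictScalars φ).obj (ModuleCat.of B B)) ⟶
        (ModuleCat.restrictScalars φ).obj N,
      ∀ (m : M) (b : B), g (m ⊗ₜ b) = b • (show N from ρ m) := by
  let ρ' (m : M) : N := ρ m
  let β (m : M) (b : B) : N := b • ρ' m
  have hadd (m m' b) : β (m + m') b = β m b + β m' b :=
    (congrArg (b • ·) (map_add ρ.hom m m')).trans (smul_add b (ρ' m) (ρ' m'))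
  have hsmul (a m b) : β (a • m) b = φ a • β m b :=
    (congrArg (b • ·) (map_smul ρ.hom a m)).trans (smul_comm b (φ a) (ρ' m))
  let g : M →ₗ[A] (ModuleCat.restrictScalars φ).obj (ModuleCat.of B B) →ₗ[A]
      (ModuleCat.restrictScalars φ).obj N :=
    LinearMap.mk₂ A β hadd hsmul (fun m b b' => add_smul (R := B) b b' (ρ' m))
      (fun a m b => mul_smul (α := B) (φ a) b (ρ' m))
  exact ⟨ModuleCat.ofHom (Y := (ModuleCat.restrictScalars φ).obj N) (TensorProduct.lift g),
    fun m b => rfl⟩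

/-- Closure under the tensor product with an arbitrary quasi-coherent module. -/
def IsTensorIdeal (S : ObjectProperty (Qcoh X)) : Prop :=
  ∀ F G : Qcoh X, S F → ∃ h : isQcoh X (tensor F.obj G.obj), S ⟨tensor F.obj G.obj, h⟩

lemma restrictAdjunction_unit_app {Y : Scheme.{u}} (j : Y ⟶ X) [IsOpenImmersion j]
    [QuasiCompact j] [QuasiSeparated j] (F : Qcoh X) (U : X.Opens) (x : Γ(F.obj, U)) :
    ((restrictAdjunction j).unit.app F).hom.app U x = res F.obj (j.image_preimage_le U) x :=
  rfl

/-- The restriction of sections as a linear map. -/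
def resLinear (F : Qcoh X) {U V : X.Opens} (h : V ≤ U) : (sections U).obj F ⟶
    (ModuleCat.restrictScalars (resO h)).obj ((sections V).obj F) :=
  ModuleCat.ofHom (Y := (ModuleCat.restrictScalars (resO h)).obj ((sections V).obj F))
    { toFun := fun x => res F.obj h x
      map_add' := map_add _
      map_smul' := res_smul _ }

lemma exists_finite_basicOpen_cover {V : X.Opens} (hV : IsAffineOpen V) {U : X.Opens}
    (hU : IsCompact (U : Set X)) (h : U ≤ V) :
    ∃ (κ : Type u) (_ : Finite κ) (f : κ → Γ(X, V)), U = ⨆ k, X.basicOpen (f k) := by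
  choose! f hfU hf using fun p (hp : p ∈ U) => hV.exists_basicOpen_le ⟨p, hp⟩ (h hp)
  obtain ⟨s, hs⟩ := hU.elim_finite_subcover (fun p : U => (X.basicOpen (f p) : Set X))
    (fun p => (X.basicOpen (f p)).isOpen) (fun p hp => Set.mem_iUnion.2 ⟨⟨p, hp⟩, hf p hp⟩)
  refine ⟨s, inferInstance, fun p => f p, le_antisymm (fun p hp => ?_)
    (iSup_le fun p => hfU _ p.1.2)⟩
  obtain ⟨q, hq, hpq⟩ := Set.mem_iUnion₂.1 (hs hp)
  exact Opens.mem_iSup.2 ⟨⟨q, hq⟩, hpq⟩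

variable [QuasiSeparatedSpace X]

/-- `extend` applied to the sections of `F` is the direct image of the restriction of `F`. -/
def extendSectionsIso {W : X.Opens} (hW : IsAffineOpen W) (F : Qcoh X) :
    (extend hW).obj ((sections W).obj F) ≅
      (pushforward hW.fromSpec).obj ((restrict hW.fromSpec).obj F) :=
  (extend hW).mapIso ((restrictSectionsIso hW).app F).symm ≪≫
    (pushforward hW.fromSpec).mapIso
      ((tildeQcoh Γ(X, W)).counitIso.app ((restrict hW.fromSpec).obj F))

variable {S : ObjectProperty (Qcoh X)}

lemma IsTensorIdeal.prop_map_tensorProduct (hT : IsTensorIdeal S) {F : Qcoh X} (hF : S F)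
    {V : X.Opens} (hV : IsAffineOpen V) (A : ModuleCat.{u} Γ(X, V)) :
    S.map (sections V) (ModuleCat.of Γ(X, V) ((sections V).obj F ⊗[Γ(X, V)] A)) := by
  let G := (extend hV).obj A
  obtain ⟨h, hS⟩ := hT F G hF
  let e : Γ(G.obj, V) ≃ₗ[Γ(X, V)] A :=
    (asIso ((sectionsAdjunction hV).counit.app A)).toLinearEquiv
  let t : Γ(F.obj, V) ⊗[Γ(X, V)] Γ(G.obj, V) ≃ₗ[Γ(X, V)] Γ(tensor F.obj G.obj, V) :=
    LinearEquiv.ofBijective (toTensor F.obj G.obj V) (bijective_toTensor F.property G.property hV)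
  exact ⟨_, hS, ⟨(t.symm ≪≫ₗ TensorProduct.congr (LinearEquiv.refl _ _) e).toModuleIso⟩⟩

variable [S.IsSerreClass]

lemma prop_of_sections {ι : Type*} [Finite ι] (W : ι → X.Opens) (hW : ∀ i, IsAffineOpen (W i))
    (hc : ⨆ i, W i = ⊤) {G : Qcoh X}
    (hG : ∀ i, S.map (sections (W i)) ((sections (W i)).obj G)) : S G := by
  have (i : ι) := preservesFiniteColimits_sections (hW i)
  exact prop_of_map S (fun i => sectionsAdjunction (hW i)) (fun G => isZero_of_cover W hc hW) hG

lemma IsTensorIdeal.prop_map_sections_basicOpen (hT : IsTensorIdeal S) {F : Qcoh X} (hF : S F)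
    {V : X.Opens} (hV : IsAffineOpen V) (f : Γ(X, V)) {H : Qcoh X} (η : F ⟶ H)
    (hη : Function.Surjective (η.hom.app (X.basicOpen f))) :
    S.map (sections V) ((ModuleCat.restrictScalars (resO (X.basicOpen_le f))).obj
      ((sections (X.basicOpen f)).obj H)) := by
  obtain ⟨g, hgt⟩ := exists_hom_of_tensorProduct_restrictScalars
    (resLinear F (X.basicOpen_le f) ≫ (ModuleCat.restrictScalars _).map
      ((sections (X.basicOpen f)).map η))
  have hg : Function.Surjective g := by
    intro z
    obtain ⟨z, rfl⟩ := hη z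
    obtain ⟨n, x, hx⟩ := (isQcoh_iff_localizesAt.1 F.property V hV f).1 z
    obtain ⟨v, hv⟩ := isUnit_resO_basicOpen_pow f n
    refine ⟨_, (hgt x (↑v⁻¹ : Γ(X, X.basicOpen f))).trans ?_⟩
    change (↑v⁻¹ : Γ(X, X.basicOpen f)) • η.hom.app _ (res F.obj (X.basicOpen_le f) x) =
      η.hom.app _ z
    rw [hx, ← hv, Scheme.Modules.Hom.app_smul, ← mul_smul, v.inv_mul, one_smul]
  have := (ModuleCat.epi_iff_surjective g).2 hg
  have := preservesFiniteColimits_sections hV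
  exact prop_map_of_epi S (sectionsAdjunction hV) (hT.prop_map_tensorProduct hF hV _) g

lemma IsTensorIdeal.prop_extend_sections [CompactSpace X] (hT : IsTensorIdeal S) {F : Qcoh X}
    (hF : S F) {W : X.Opens} (hW : IsAffineOpen W) :
    S ((extend hW).obj ((sections W).obj F)) := by
  let j := hW.fromSpec
  let H := (pushforward j).obj ((restrict j).obj F)
  let η : F ⟶ H := (restrictAdjunction j).unit.app F
  have hj (U : X.Opens) : j ''ᵁ j ⁻¹ᵁ U = W ⊓ U := by
    rw [j.image_preimage_eq_opensRange_inf, hW.opensRange_fromSpec]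
  refine S.prop_of_iso (extendSectionsIso hW F).symm (?_ : S H)
  obtain ⟨ι, _, V, hV, hc⟩ := exists_finite_affine_cover (X := X) (U := ⊤) isCompact_univ
  refine prop_of_sections V hV hc.symm fun i => ?_
  obtain ⟨κ, _, f, hf⟩ := exists_finite_basicOpen_cover (hV i) (U := W ⊓ V i)
    (QuasiSeparatedSpace.inter_isCompact _ _ W.isOpen hW.isCompact (V i).isOpen (hV i).isCompact)
    inf_le_right
  have := preservesFiniteColimits_sections (hV i)
  have hfW (k : κ) : X.basicOpen (f k) ≤ W := (le_iSup _ k).trans (hf.ge.trans inf_le_left)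
  refine prop_map_of_jointly_mono S (sectionsAdjunction (hV i))
    (fun k => hT.prop_map_sections_basicOpen hF (hV i) (f k) η fun z => ?_)
    (fun k => resLinear H (X.basicOpen_le (f k))) fun {Z} a ha => ?_
  · refine ⟨res F.obj ((le_inf (hfW k) le_rfl).trans (hj _).ge) z,
      (restrictAdjunction_unit_app j F _ _).trans ?_⟩
    exact (res_res _ _ _).trans (res_self _ _)
  · ext z
    refine sections_eq_zero (F := F.obj) (U := j ''ᵁ j ⁻¹ᵁ V i)
      (fun k => j ''ᵁ j ⁻¹ᵁ X.basicOpen (f k))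
      (fun k => j.image_mono (j.preimage_mono (X.basicOpen_le _))) ?_
      (x := (show Γ(H.obj, V i) from a z)) (fun k => congr($(ha k) z))
    rw [hj, hf]
    exact iSup_mono fun k => (le_inf (hfW k) le_rfl).trans (hj _).ge

end TensorSerre

/-! ### Torsion classes of modules -/

section Modules

variable {R : Type u} [CommRing R] {T : ObjectProperty (ModuleCat.{u} R)}
  {M N : Type u} [AddCommGroup M] [Module R M] [AddCommGroup N] [Module R N]

lemma prop_of_injective [T.IsClosedUnderSubobjects] (f : M →ₗ[R] N) (hf : Function.Injective f)
    (h : T (ModuleCat.of R N)) : T (ModuleCat.of R M) := by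
  have : Mono (ModuleCat.ofHom f) := (ModuleCat.mono_iff_injective _).2 hf
  exact T.prop_of_mono (ModuleCat.ofHom f) h

lemma prop_of_surjective [T.IsClosedUnderQuotients] (f : M →ₗ[R] N)
    (hf : Function.Surjective f) (h : T (ModuleCat.of R M)) : T (ModuleCat.of R N) := by
  have : Epi (ModuleCat.ofHom f) := (ModuleCat.epi_iff_surjective _).2 hf
  exact T.prop_of_epi (ModuleCat.ofHom f) h

lemma exact_ofHom_of_exact {L : Type u} [AddCommGroup L] [Module R L] {f : L →ₗ[R] M}
    {g : M →ₗ[R] N} (h : Function.Exact f g) :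
    (ShortComplex.mk (ModuleCat.ofHom f) (ModuleCat.ofHom g)
      (ModuleCat.hom_ext h.linearMap_comp_eq_zero)).Exact :=
  (ShortComplex.ShortExact.moduleCat_exact_iff_function_exact _).2 h

lemma prop_quotient_of_le [T.IsClosedUnderQuotients] {I J : Ideal R} (h : I ≤ J)
    (hI : T (ModuleCat.of R (R ⧸ I))) : T (ModuleCat.of R (R ⧸ J)) :=
  prop_of_surjective (Submodule.factor h) (Submodule.factor_surjective h) hI

variable (T) in
/-- An element is torsion for `T` if the cyclic submodule that it generates is in `T`. -/
def IsTorsionElt (x : M) : Prop := T (ModuleCat.of R (R ⧸ Ideal.torsionOf R M x))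

variable (T M) in
/-- A module is torsion-free for `T` if it has no torsion elements other than zero. -/
def IsTorsionFree : Prop := ∀ x : M, IsTorsionElt T x → x = 0

section Serre

variable [T.IsSerreClass]

lemma prop_of_submodule (K : Submodule R M) (h : T (ModuleCat.of R K))
    (h' : T (ModuleCat.of R (M ⧸ K))) : T (ModuleCat.of R M) :=
  T.prop_X₂_of_exact (exact_ofHom_of_exact (LinearMap.exact_subtype_mkQ K)) h h'

lemma prop_span_singleton {x : M} (hx : IsTorsionElt T x) :
    T (ModuleCat.of R (Submodule.span R {x})) :=
  T.prop_of_iso (Ideal.quotTorsionOfEquivSpanSingleton R M x).toModuleIso hx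

lemma isTorsionElt_of_prop (h : T (ModuleCat.of R M)) (x : M) : IsTorsionElt T x := by
  refine prop_of_injective
    ((Submodule.subtype _).comp (Ideal.quotTorsionOfEquivSpanSingleton R M x).toLinearMap) ?_ h
  exact (Submodule.subtype_injective _).comp (Ideal.quotTorsionOfEquivSpanSingleton R M x).injective

lemma IsTorsionElt.of_le {x : M} {y : N} (h : ∀ r : R, r • x = 0 → r • y = 0)
    (hx : IsTorsionElt T x) : IsTorsionElt T y :=
  prop_quotient_of_le (fun r hr => (Ideal.mem_torsionOf_iff y r).2
    (h r ((Ideal.mem_torsionOf_iff x r).1 hr))) hx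

lemma isTorsionElt_of_forall_smul_eq_zero {x : M} {I : Ideal R} (hI : T (ModuleCat.of R (R ⧸ I)))
    (h : ∀ r ∈ I, r • x = 0) : IsTorsionElt T x :=
  prop_quotient_of_le (fun r hr => (Ideal.mem_torsionOf_iff x r).2 (h r hr)) hI

lemma prop_quotient_top : T (ModuleCat.of R (R ⧸ (⊤ : Ideal R))) := by
  have : Subsingleton (R ⧸ (⊤ : Ideal R)) := Submodule.Quotient.subsingleton_iff.2 rfl
  exact T.prop_of_isZero (ModuleCat.isZero_of_subsingleton _)

variable (T M) in
/-- The submodule of the elements of `M` that are torsion for `T`. -/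
def torsionSubmodule : Submodule R M where
  carrier := {x | IsTorsionElt T x}
  zero_mem' := isTorsionElt_of_forall_smul_eq_zero prop_quotient_top fun r _ => smul_zero r
  add_mem' {x y} hx hy := by
    have h : T (ModuleCat.of R (Submodule.span R {x} × Submodule.span R {y})) :=
      T.prop_of_iso (ModuleCat.biprodIsoProd _ _)
        (T.prop_biprod (prop_span_singleton hx) (prop_span_singleton hy))
    refine IsTorsionElt.of_le (fun r hr => ?_) (isTorsionElt_of_prop h
      (⟨x, Submodule.mem_span_singleton_self x⟩, ⟨y, Submodule.mem_span_singleton_self y⟩))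
    have h₁ : r • x = 0 := congrArg (fun z => (z.1 : M)) hr
    have h₂ : r • y = 0 := congrArg (fun z => (z.2 : M)) hr
    rw [smul_add, h₁, h₂, add_zero]
  smul_mem' r x hx := hx.of_le fun s hs => by rw [smul_comm, hs, smul_zero]

lemma IsTorsionFree.eq_zero (hN : IsTorsionFree T N) {A : ModuleCat.{u} R} (hA : T A)
    (g : A ⟶ ModuleCat.of R N) : g = 0 := by
  ext x
  refine hN _ ((isTorsionElt_of_prop (T := T) (M := A) hA x).of_le fun r hr => ?_)
  exact (map_smul g.hom r x).symm.trans ((congrArg g hr).trans (map_zero g.hom))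

end Serre

/-- A torsion class of modules: a Serre class that contains a module as soon as it contains its
finitely generated submodules. -/
class IsTorsionClass (T : ObjectProperty (ModuleCat.{u} R)) : Prop extends T.IsSerreClass where
  of_fg (M : Type u) [AddCommGroup M] [Module R M] :
    (∀ N : Submodule R M, N.FG → T (ModuleCat.of R N)) → T (ModuleCat.of R M)

variable [IsTorsionClass T]

lemma prop_of_isTorsionElt (h : ∀ x : M, IsTorsionElt T x) : T (ModuleCat.of R M) := by
  refine IsTorsionClass.of_fg M fun N hN => ?_
  induction N, hN using Submodule.fg_induction with
  | singleton x => exact prop_span_singleton (h x)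
  | sup N₁ N₂ _ _ h₁ h₂ =>
    refine prop_of_submodule (N₂.submoduleOf (N₁ ⊔ N₂)) ?_ ?_
    · exact T.prop_of_iso (Submodule.submoduleOfEquivOfLe le_sup_right).symm.toModuleIso h₂
    · exact T.prop_of_iso (LinearMap.quotientInfEquivSupQuotient N₁ N₂).toModuleIso
        (prop_of_surjective _ (Submodule.mkQ_surjective _) h₁)

lemma prop_torsionSubmodule : T (ModuleCat.of R (torsionSubmodule T M)) :=
  prop_of_isTorsionElt fun x => IsTorsionElt.of_le (x := x.1)
    (fun _ hr => Subtype.ext hr) x.2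

lemma IsTorsionElt.of_smul {x : M} {I : Ideal R} (hI : T (ModuleCat.of R (R ⧸ I)))
    (h : ∀ r ∈ I, IsTorsionElt T (r • x)) : IsTorsionElt T x := by
  let K : Submodule R (Submodule.span R {x}) := (torsionSubmodule T M).comap (Submodule.subtype _)
  have hK : T (ModuleCat.of R K) := prop_of_isTorsionElt fun y =>
    IsTorsionElt.of_le (x := y.1.1) (fun _ hr => Subtype.ext (Subtype.ext hr)) y.2
  have hs : T (ModuleCat.of R (Submodule.span R {x})) := by
    refine prop_of_submodule K hK (prop_of_isTorsionElt fun y => ?_)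
    obtain ⟨⟨y, hy⟩, rfl⟩ := Submodule.mkQ_surjective _ y
    obtain ⟨a, rfl⟩ := Submodule.mem_span_singleton.1 hy
    refine isTorsionElt_of_forall_smul_eq_zero hI fun r hr =>
      (Submodule.Quotient.mk_eq_zero _).2 ?_
    change IsTorsionElt T (r • a • x)
    rw [smul_comm]
    exact (torsionSubmodule T M).smul_mem a (h r hr)
  exact IsTorsionElt.of_le (fun _ hr => congrArg Subtype.val hr)
    (isTorsionElt_of_prop hs ⟨x, Submodule.mem_span_singleton_self x⟩)

lemma isOka_prop_quotient : Ideal.IsOka fun I : Ideal R => T (ModuleCat.of R (R ⧸ I)) where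
  top := prop_quotient_top
  oka {I a} h₁ h₂ := by
    have ha : IsTorsionElt T (Submodule.Quotient.mk a : R ⧸ I) :=
      isTorsionElt_of_forall_smul_eq_zero h₂ fun r hr =>
        (Submodule.Quotient.mk_eq_zero I).2 (Ideal.mem_colon_span_singleton.1 hr)
    have h : IsTorsionElt T (Submodule.Quotient.mk 1 : R ⧸ I) := by
      refine IsTorsionElt.of_smul h₁ fun r hr => ?_
      obtain ⟨q, hq, _, hd, rfl⟩ := Submodule.mem_sup.1 hr
      obtain ⟨c, rfl⟩ := Ideal.mem_span_singleton'.1 hd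
      have e : (q + c * a) • (Submodule.Quotient.mk 1 : R ⧸ I) = c • Submodule.Quotient.mk a := by
        rw [← Submodule.Quotient.mk_smul, ← Submodule.Quotient.mk_smul, Submodule.Quotient.eq]
        simpa using hq
      exact e ▸ (torsionSubmodule T (R ⧸ I)).smul_mem c ha
    refine prop_quotient_of_le (fun s hs => ?_) h
    rw [Ideal.mem_torsionOf_iff, ← Submodule.Quotient.mk_smul,
      Submodule.Quotient.mk_eq_zero] at hs
    simpa using hs

lemma isTorsionFree_quotient_comap (f : M →ₗ[R] N) :
    IsTorsionFree T (M ⧸ (torsionSubmodule T N).comap f) := by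
  intro x hx
  obtain ⟨x, rfl⟩ := Submodule.mkQ_surjective _ x
  refine (Submodule.Quotient.mk_eq_zero _).2 (IsTorsionElt.of_smul hx fun r hr => ?_)
  rw [← map_smul]
  exact (Submodule.Quotient.mk_eq_zero _).1 hr

lemma isTorsionFree_quotient : IsTorsionFree T (M ⧸ torsionSubmodule T M) :=
  isTorsionFree_quotient_comap LinearMap.id

end Modules

section Injective

variable {R : Type u} [CommRing R] {M : Type u} [AddCommGroup M] [Module R M]

lemma exists_maximal_disjoint (N t : Submodule R M) (h : Disjoint N t) :
    ∃ E, N ≤ E ∧ Maximal (Disjoint · t) E :=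
  zorn_le_nonempty₀ {E : Submodule R M | Disjoint E t}
    (fun c hc hc' _ _ => ⟨sSup c, hc'.directedOn.disjoint_sSup_left.2 fun _ ha => hc ha,
      fun _ hz => le_sSup hz⟩) N h

/- With `D` maximal among the submodules that meet `E` trivially, `E → M ⧸ D` is essential.
By injectivity the inclusion of `E` extends to `M ⧸ D`, and maximality of `E` bounds the image. -/
lemma exists_retraction_of_maximal_disjoint [Injective (ModuleCat.of R M)] {E t : Submodule R M}
    (hE : Maximal (Disjoint · t) E) : ∃ p : M →ₗ[R] E, ∀ x : E, p x = x := by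
  obtain ⟨D, -, hD⟩ := exists_maximal_disjoint ⊥ E disjoint_bot_left
  have ha : Function.Injective (D.mkQ ∘ₗ E.subtype) := by
    refine (injective_iff_map_eq_zero _).2 fun x hx => Subtype.ext ?_
    exact Submodule.disjoint_def.1 hD.prop _ ((Submodule.Quotient.mk_eq_zero D).1 hx) x.2
  have hM := Module.injective_module_of_injective_object R M
  obtain ⟨q, hq⟩ := hM.out _ ha E.subtype
  have hle : E ≤ LinearMap.range q := fun x hx => ⟨_, hq ⟨x, hx⟩⟩
  have hmkQ {x : M} (hx : x ∈ D) : D.mkQ x = 0 := (Submodule.Quotient.mk_eq_zero D).2 hx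
  have hrange : LinearMap.range q = E := by
    refine (hE.eq_of_le (Submodule.disjoint_def.2 ?_) hle).symm
    rintro _ ⟨y, rfl⟩ hy
    obtain ⟨y, rfl⟩ := D.mkQ_surjective y
    suffices hyD : Disjoint (D ⊔ Submodule.span R {y}) E by
      have : y ∈ D := hD.le_of_ge hyD le_sup_left
        (Submodule.mem_sup_right (Submodule.mem_span_singleton_self y))
      rw [hmkQ this, map_zero]
    refine Submodule.disjoint_def.2 fun z hz hzE => ?_
    obtain ⟨d, hd, b, hb, rfl⟩ := Submodule.mem_sup.1 hz
    obtain ⟨r, rfl⟩ := Submodule.mem_span_singleton.1 hb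
    refine Submodule.disjoint_def.1 hE.prop _ hzE ?_
    have hqr : q (D.mkQ (d + r • y)) = r • q (D.mkQ y) := by
      rw [map_add, hmkQ hd, zero_add, map_smul, map_smul]
    have hz' : d + r • y = r • q (D.mkQ y) := (hq ⟨_, hzE⟩).symm.trans hqr
    exact hz' ▸ t.smul_mem r hy
  exact ⟨(q ∘ₗ D.mkQ).codRestrict E fun x => hrange ▸ ⟨_, rfl⟩, fun x => Subtype.ext (hq x)⟩

variable {T : ObjectProperty (ModuleCat.{u} R)} [IsTorsionClass T]

lemma exists_torsionFree_injective (hM : ¬ T (ModuleCat.of R M)) :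
    ∃ (E : Type u) (_ : AddCommGroup E) (_ : Module R E), Module.Injective R E ∧
      IsTorsionFree T E ∧ ∃ g : M →ₗ[R] E, g ≠ 0 := by
  let Q := ModuleCat.of R (M ⧸ torsionSubmodule T M)
  let P := Injective.under Q
  have hP : Injective (ModuleCat.of R P) := inferInstanceAs (Injective P)
  let i : Q →ₗ[R] P := (Injective.ι Q).hom
  have hi : Function.Injective i := (ModuleCat.mono_iff_injective (Injective.ι Q)).1 inferInstance
  have hd : Disjoint (LinearMap.range i) (torsionSubmodule T P) := by
    rw [Submodule.disjoint_def]
    rintro _ ⟨x, rfl⟩ hx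
    rw [isTorsionFree_quotient x (IsTorsionElt.of_le (fun r hr => hi ?_) hx), map_zero]
    rw [map_smul, hr, map_zero]
  obtain ⟨E, hE, hEt⟩ := exists_maximal_disjoint _ _ hd
  obtain ⟨p, hp⟩ := exists_retraction_of_maximal_disjoint hEt
  let r : Retract (ModuleCat.of R E) (ModuleCat.of R P) :=
    { i := ModuleCat.ofHom E.subtype
      r := ModuleCat.ofHom p
      retract := by ext x; exact congrArg Subtype.val (hp x) }
  have hEi := r.injective
  refine ⟨E, inferInstance, inferInstance, Module.injective_module_of_injective_object R E,
    fun x hx => ?_, i.codRestrict E (fun x => hE ⟨x, rfl⟩) ∘ₗ Submodule.mkQ _, fun h => hM ?_⟩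
  · exact Subtype.ext (Submodule.disjoint_def.1 hEt.prop _ x.2
      (hx.of_le fun _ hr => congrArg Subtype.val hr))
  · refine prop_of_isTorsionElt fun x => (Submodule.Quotient.mk_eq_zero _).1 (hi ?_)
    rw [map_zero]
    exact congrArg Subtype.val (LinearMap.congr_fun h x)

lemma exists_ne_zero_of_not_prop_quotient {I : Ideal R} (hI : ¬ T (ModuleCat.of R (R ⧸ I))) :
    ∃ (E : Type u) (_ : AddCommGroup E) (_ : Module R E), Module.Injective R E ∧
      IsTorsionFree T E ∧ ∃ e : E, e ≠ 0 ∧ ∀ r ∈ I, r • e = 0 := by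
  obtain ⟨E, _, _, hEi, hE, g, hg⟩ := exists_torsionFree_injective hI
  refine ⟨E, _, _, hEi, hE, g (Submodule.mkQ _ 1), fun h => hg ?_, fun r hr => ?_⟩
  · exact Submodule.linearMap_qext _ (LinearMap.ext_ring (h.trans (LinearMap.zero_apply _).symm))
  · rw [← map_smul, ← map_smul, smul_eq_mul, mul_one, Submodule.mkQ_apply,
      (Submodule.Quotient.mk_eq_zero I).2 hr, map_zero]

/- For each finitely generated `l ≤ I` choose `e l ≠ 0` killed by `l` in a torsion-free injective
module. In the product of these modules let `M k` consist of the families that vanish from `k` on.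
The family `e` is killed by `I` modulo `⨆ k, M k`, without being in it. -/
lemma exists_not_isTorsionFree_quotient_iSup {I : Ideal R} (hI : T (ModuleCat.of R (R ⧸ I)))
    (hfg : ∀ l ≤ I, l.FG → ¬ T (ModuleCat.of R (R ⧸ l))) :
    ∃ (K : Type u) (_ : PartialOrder K) (_ : IsDirectedOrder K) (_ : Nonempty K) (P : Type u)
      (_ : AddCommGroup P) (_ : Module R P) (M : K →o Submodule R P),
      Module.Injective R P ∧ IsTorsionFree T P ∧ (∀ k, IsTorsionFree T (P ⧸ M k)) ∧
      ¬ IsTorsionFree T (P ⧸ ⨆ k, M k) := by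
  let K := {l : Ideal R // l ≤ I ∧ l.FG}
  choose E _ _ hE hEt e he hle using
    fun l : K => exists_ne_zero_of_not_prop_quotient (hfg l.1 l.2.1 l.2.2)
  let M : K →o Submodule R (∀ l, E l) :=
    { toFun := fun k => ⨅ l : K, ⨅ _ : k ≤ l, LinearMap.ker (LinearMap.proj l)
      monotone' := fun k k' h => le_iInf₂ fun l hl => iInf₂_le l (h.trans hl) }
  have hM (k : K) (x) : x ∈ M k ↔ ∀ l, k ≤ l → x l = 0 := by
    change x ∈ ⨅ l : K, ⨅ _ : k ≤ l, LinearMap.ker (LinearMap.proj l) ↔ _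
    simp only [Submodule.mem_iInf, LinearMap.mem_ker, LinearMap.proj_apply]
  have hdir : IsDirectedOrder K := ⟨fun a b =>
    ⟨⟨a.1 ⊔ b.1, sup_le a.2.1 b.2.1, Submodule.FG.sup a.2.2 b.2.2⟩,
    le_sup_left (a := a.1), le_sup_right (a := a.1)⟩⟩
  have hne : Nonempty K := ⟨⟨⊥, bot_le, Submodule.fg_bot⟩⟩
  refine ⟨K, inferInstance, hdir, hne, ∀ l, E l, inferInstance, inferInstance, M,
    inferInstance, fun x hx => funext fun l => ?_, fun k x hx => ?_, fun h => ?_⟩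
  · exact hEt l _ (hx.of_le fun r hr => congrFun hr l)
  · obtain ⟨x, rfl⟩ := Submodule.mkQ_surjective _ x
    refine (Submodule.Quotient.mk_eq_zero _).2 ((hM _ _).2 fun l hl => ?_)
    exact hEt l _ (hx.of_le fun r hr => (hM _ _).1 ((Submodule.Quotient.mk_eq_zero _).1 hr) l hl)
  · have heI : Submodule.mkQ (⨆ k, M k) e = 0 := by
      refine h _ (isTorsionElt_of_forall_smul_eq_zero hI fun r hr => ?_)
      refine (Submodule.Quotient.mk_eq_zero _).2 <| Submodule.mem_iSup_of_mem
        ⟨Ideal.span {r}, I.span_singleton_le_iff_mem.2 hr, Submodule.fg_span_singleton r⟩ ?_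
      exact (hM _ _).2 fun l hl => hle l r (hl (Ideal.mem_span_singleton_self r))
    have heM := (Submodule.Quotient.mk_eq_zero _).1 heI
    rw [Submodule.mem_iSup_of_directed _ M.monotone.directed_le] at heM
    obtain ⟨k, hk⟩ := heM
    exact he k ((hM _ _).1 hk k le_rfl)

end Injective

/-! ### Subcategories of finite type over affine open subsets -/

section ClosedColimit

universe w v w' v'

variable {C : Type w} [Category.{v} C] [Abelian C] {S : ObjectProperty C} [S.IsSerreClass]
  {J : Type w'} [Category.{v'} J] {F : J ⥤ (closedObjects S).FullSubcategory}

/-- A cocone over a diagram of closed objects, pushed forward to a closed object `Z`. -/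
def closedCocone (c : Cocone (F ⋙ (closedObjects S).ι)) {Z : (closedObjects S).FullSubcategory}
    (θ : c.pt ⟶ Z.obj) : Cocone F where
  pt := Z
  ι :=
    { app k := ObjectProperty.homMk (c.ι.app k ≫ θ)
      naturality k l f := by
        ext1
        change (F.map f).hom ≫ c.ι.app l ≫ θ = (c.ι.app k ≫ θ) ≫ 𝟙 _
        rw [Category.comp_id, ← c.w f, Category.assoc]
        rfl }

lemma nonempty_isColimit_closedCocone {c : Cocone (F ⋙ (closedObjects S).ι)} (hc : IsColimit c)
    {Z : (closedObjects S).FullSubcategory} {θ : c.pt ⟶ Z.obj} (hθ : S.isoModSerre θ) :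
    Nonempty (IsColimit (closedCocone c θ)) := by
  choose g hg using fun s : Cocone F =>
    (s.pt.property θ hθ).2 (hc.desc ((closedObjects S).ι.mapCocone s))
  refine ⟨{ desc := fun s => ObjectProperty.homMk (g s), fac := fun s k => ?_,
            uniq := fun s m hm => ?_ }⟩
  · ext1
    change (c.ι.app k ≫ θ) ≫ g s = _
    rw [Category.assoc]
    exact (congrArg _ (hg s)).trans (hc.fac ((closedObjects S).ι.mapCocone s) k)
  · ext1
    refine (s.pt.property θ hθ).1 (Eq.trans (hc.hom_ext fun k => ?_) (hg s).symm)
    refine Eq.trans ?_ (hc.fac ((closedObjects S).ι.mapCocone s) k).symm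
    exact (Category.assoc _ _ _).symm.trans congr(($(hm k)).hom)

lemma IsOfFiniteType.isIso_of_isoModSerre (hS : IsOfFiniteType S) {J : Type v} [PartialOrder J]
    [IsDirectedOrder J] [Nonempty J] {F : J ⥤ (closedObjects S).FullSubcategory}
    (hF : ∀ {i j : J} (f : i ⟶ j), Mono (F.map f)) {c : Cocone (F ⋙ (closedObjects S).ι)}
    (hc : IsColimit c) {Z : C} (hZ : closedObjects S Z) {θ : c.pt ⟶ Z} (hθ : S.isoModSerre θ) :
    IsIso θ := by
  obtain ⟨hc'⟩ := nonempty_isColimit_closedCocone (Z := ⟨Z, hZ⟩) hc hθ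
  have := hS J F hF
  have hι := isColimitOfPreserves (closedObjects S).ι hc'
  have h : θ = (hc.coconePointUniqueUpToIso hι).hom :=
    hc.hom_ext fun k => (hc.comp_coconePointUniqueUpToIso_hom hι k).symm
  rw [h]
  exact (hc.coconePointUniqueUpToIso hι).isIso_hom

end ClosedColimit

lemma nonempty_isColimit_of_injective_of_exists_rep {R : Type u} [CommRing R] {K : Type u}
    [Preorder K] [IsDirectedOrder K] [Nonempty K] {F : K ⥤ ModuleCat.{u} R} (c : Cocone F)
    (hi : ∀ k, Function.Injective (c.ι.app k)) (hs : ∀ x : c.pt, ∃ k y, c.ι.app k y = x) :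
    Nonempty (IsColimit c) := by
  refine ⟨isColimitOfReflects (forget (ModuleCat R)) (Types.FilteredColimit.isColimitOf _ _ ?_ ?_)⟩
  · intro x
    obtain ⟨k, y, hy⟩ := hs x
    exact ⟨k, y, hy.symm⟩
  · intro k l x y h
    obtain ⟨m, hkm, hlm⟩ := exists_ge_ge k l
    refine ⟨m, homOfLE hkm, homOfLE hlm, hi m ?_⟩
    have hx := congr($(c.w (homOfLE hkm)) x)
    have hy := congr($(c.w (homOfLE hlm)) y)
    exact hx.trans (h.trans hy.symm)

section Torsion

variable {X : Scheme.{u}} [QuasiSeparatedSpace X]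

lemma exact_extend {W : X.Opens} (hW : IsAffineOpen W) {M₁ M₂ M₃ : ModuleCat.{u} Γ(X, W)}
    {f : M₁ ⟶ M₂} {g : M₂ ⟶ M₃} {w : f ≫ g = 0} (h : (ShortComplex.mk f g w).Exact) [Mono f] :
    (ShortComplex.mk ((extend hW).map f) ((extend hW).map g)
      (by rw [← Functor.map_comp, w, Functor.map_zero])).Exact := by
  have := (sectionsAdjunction hW).rightAdjoint_preservesLimits.{0, 0}
  exact h.map_of_mono_of_preservesKernel (extend hW) ‹_› inferInstance

section Union

variable {W : X.Opens} (hW : IsAffineOpen W) {P : Type u} [AddCommGroup P] [Module Γ(X, W) P]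
  {K : Type u} [PartialOrder K] (M : K →o Submodule Γ(X, W) P)

/-- A monotone family of submodules, as a diagram of modules. -/
def submoduleFunctor : K ⥤ ModuleCat.{u} Γ(X, W) where
  obj k := ModuleCat.of _ (M k)
  map f := ModuleCat.ofHom (Submodule.inclusion (M.monotone f.le))

/-- The union of a monotone family of submodules, as a cocone. -/
def iSupCocone : Cocone (submoduleFunctor M) where
  pt := ModuleCat.of _ ↥(⨆ k, M k)
  ι := { app k := ModuleCat.ofHom (Submodule.inclusion (le_iSup M k)) }

lemma nonempty_isColimit_extend_iSupCocone [IsDirectedOrder K] [Nonempty K] :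
    Nonempty (IsColimit ((extend hW).mapCocone (iSupCocone M))) := by
  have hinj (k : K) : Function.Injective ((iSupCocone M).ι.app k) :=
    Submodule.inclusion_injective (le_iSup M k)
  obtain ⟨hc⟩ := nonempty_isColimit_of_injective_of_exists_rep _ hinj fun x => by
    obtain ⟨k, hk⟩ := (Submodule.mem_iSup_of_directed _ M.monotone.directed_le).1 x.2
    exact ⟨k, ⟨x.1, hk⟩, rfl⟩
  exact nonempty_isColimit_extend hW hc fun k => (ModuleCat.mono_iff_injective _).2 (hinj k)

end Union

variable [CompactSpace X] (A : TensorLocalizing X) {W : X.Opens} (hW : IsAffineOpen W)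

/-- The modules over the ring of functions of an affine open subset `W` that `A` cuts out. -/
def torsionClass : ObjectProperty (ModuleCat.{u} Γ(X, W)) := A.carrier.inverseImage (extend hW)

lemma torsionClass_sections {F : Qcoh X} (hF : A.carrier F) :
    torsionClass A hW ((sections W).obj F) :=
  IsTensorIdeal.prop_extend_sections A.isTensor hF hW

lemma torsionClass_iff (M : ModuleCat.{u} Γ(X, W)) :
    torsionClass A hW M ↔ A.carrier.map (sections W) M := by
  refine ⟨fun h => ⟨_, h, ⟨asIso ((sectionsAdjunction hW).counit.app M)⟩⟩, ?_⟩
  rintro ⟨F, hF, ⟨e⟩⟩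
  exact A.carrier.prop_of_iso ((extend hW).mapIso e) (torsionClass_sections A hW hF)

instance : (torsionClass A hW).IsSerreClass where
  exists_zero := ⟨_, isZero_zero _, A.carrier.prop_of_isZero
    ((extend hW).map_isZero (isZero_zero _))⟩
  prop_of_mono f _ h := by
    have := (sectionsAdjunction hW).rightAdjoint_preservesLimits.{0, 0}
    exact A.carrier.prop_of_mono ((extend hW).map f) h
  prop_of_epi f _ h := by
    have := preservesFiniteColimits_sections hW
    rw [torsionClass_iff] at h ⊢
    exact prop_map_of_epi A.carrier (sectionsAdjunction hW) h f
  prop_X₂_of_shortExact {S} hS h₁ h₃ := by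
    have := hS.mono_f
    exact A.carrier.prop_X₂_of_exact (exact_extend hW hS.exact) h₁ h₃

instance : IsTorsionClass (torsionClass A hW) where
  of_fg M _ _ h := by
    let J := {N : Submodule Γ(X, W) M // N.FG}
    have : IsDirectedOrder J := ⟨fun a b => ⟨⟨a.1 ⊔ b.1, Submodule.FG.sup a.2 b.2⟩,
      le_sup_left (a := a.1), le_sup_right (a := a.1)⟩⟩
    have : Nonempty J := ⟨⟨⊥, Submodule.fg_bot⟩⟩
    let F : J ⥤ ModuleCat.{u} Γ(X, W) :=
      { obj := fun N => ModuleCat.of _ N.1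
        map := fun f => ModuleCat.ofHom (Submodule.inclusion f.le) }
    let c : Cocone F :=
      { pt := ModuleCat.of _ M
        ι := { app := fun N => ModuleCat.ofHom N.1.subtype } }
    have hi (N : J) : Function.Injective (c.ι.app N) := Subtype.val_injective
    obtain ⟨hc⟩ := nonempty_isColimit_of_injective_of_exists_rep c hi fun x =>
      ⟨⟨Submodule.span _ {x}, Submodule.fg_span_singleton x⟩,
        ⟨x, Submodule.mem_span_singleton_self x⟩, rfl⟩
    obtain ⟨hc'⟩ := nonempty_isColimit_extend hW hc fun N =>
      (ModuleCat.mono_iff_injective _).2 (hi N)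
    have := IsLocalizingSubcategory.closedUnderFilteredColimits (S := A.carrier) J
    exact A.carrier.prop_of_isColimit hc' fun N => h N.1 N.2

variable {A hW} {P : Type u} [AddCommGroup P] [Module Γ(X, W) P]

lemma IsTorsionFree.hom_extend_eq_zero (hP : IsTorsionFree (torsionClass A hW) P) (F : Qcoh X)
    (hF : A.carrier F) (g : F ⟶ (extend hW).obj (ModuleCat.of _ P)) : g = 0 := by
  refine ((sectionsAdjunction hW).homEquiv _ _).symm.injective ?_
  exact (hP.eq_zero (torsionClass_sections A hW hF) _).trans
    (hP.eq_zero (torsionClass_sections A hW hF) _).symm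

lemma closedObjects_extend [Injective (ModuleCat.of Γ(X, W) P)]
    (hP : IsTorsionFree (torsionClass A hW) P) {N : Submodule Γ(X, W) P}
    (hN : IsTorsionFree (torsionClass A hW) (P ⧸ N)) :
    closedObjects A.carrier ((extend hW).obj (ModuleCat.of _ N)) := by
  have : Mono (ModuleCat.ofHom N.subtype) :=
    (ModuleCat.mono_iff_injective _).2 Subtype.val_injective
  have := (sectionsAdjunction hW).rightAdjoint_preservesLimits.{0, 0}
  have := Injective.injective_of_adjoint (sectionsAdjunction hW) (ModuleCat.of Γ(X, W) P)
  have hex := exact_extend hW (exact_ofHom_of_exact (LinearMap.exact_subtype_mkQ N))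
  have : Mono ((extend hW).map (ModuleCat.ofHom N.subtype)) := inferInstance
  exact closedObjects_of_injective A.carrier _ _ _ hex.fIsKernel hP.hom_extend_eq_zero
    hN.hom_extend_eq_zero

lemma isoModSerre_extend_inclusion {M N : Submodule Γ(X, W) P} (h : M ≤ N)
    (hN : N ≤ (torsionSubmodule (torsionClass A hW) (P ⧸ M)).comap M.mkQ) :
    A.carrier.isoModSerre ((extend hW).map (ModuleCat.ofHom (Submodule.inclusion h))) := by
  let p : N →ₗ[Γ(X, W)] torsionSubmodule (torsionClass A hW) (P ⧸ M) :=
    (M.mkQ.comp N.subtype).codRestrict _ fun x => hN x.2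
  have hex : Function.Exact (Submodule.inclusion h) p := fun x => by
    refine ⟨fun hx => ⟨⟨x.1, ?_⟩, rfl⟩, ?_⟩
    · exact (Submodule.Quotient.mk_eq_zero M).1 (congrArg Subtype.val hx)
    · rintro ⟨y, rfl⟩
      exact Subtype.ext ((Submodule.Quotient.mk_eq_zero M).2 y.2)
  have : Mono (ModuleCat.ofHom (Submodule.inclusion h)) :=
    (ModuleCat.mono_iff_injective _).2 (Submodule.inclusion_injective h)
  have := (sectionsAdjunction hW).rightAdjoint_preservesLimits.{0, 0}
  have hexE := exact_extend hW (exact_ofHom_of_exact hex)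
  have : Mono ((extend hW).map (ModuleCat.ofHom (Submodule.inclusion h))) := inferInstance
  refine ⟨A.carrier.prop_of_isZero (isZero_kernel_of_mono _), ?_⟩
  have := hexE.mono_cokernelDesc
  exact A.carrier.prop_of_mono (cokernel.desc _ ((extend hW).map (ModuleCat.ofHom p)) _)
    (prop_torsionSubmodule (T := torsionClass A hW))

/- The sheaf of the saturation `N` of `⨆ k, M k` is closed, so by finite type it is the union of
the closed sheaves of the `M k`, whence `N = ⨆ k, M k`. -/
lemma isTorsionFree_quotient_iSup {K : Type u} [PartialOrder K] [IsDirectedOrder K] [Nonempty K]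
    (M : K →o Submodule Γ(X, W) P) [Injective (ModuleCat.of Γ(X, W) P)]
    (hP : IsTorsionFree (torsionClass A hW) P)
    (hM : ∀ k, IsTorsionFree (torsionClass A hW) (P ⧸ M k)) :
    IsTorsionFree (torsionClass A hW) (P ⧸ ⨆ k, M k) := by
  let N := (torsionSubmodule (torsionClass A hW) (P ⧸ ⨆ k, M k)).comap (⨆ k, M k).mkQ
  have hle : ⨆ k, M k ≤ N := fun x hx => by
    refine Submodule.mem_comap.2 ?_
    rw [Submodule.mkQ_apply, (Submodule.Quotient.mk_eq_zero _).2 hx]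
    exact zero_mem _
  let F : K ⥤ (closedObjects A.carrier).FullSubcategory :=
    (closedObjects A.carrier).lift (submoduleFunctor M ⋙ extend hW) fun k =>
      closedObjects_extend hP (hM k)
  have hF {i j : K} (f : i ⟶ j) : Mono (F.map f) := by
    have : Mono ((submoduleFunctor M).map f) :=
      (ModuleCat.mono_iff_injective _).2 (Submodule.inclusion_injective (M.monotone f.le))
    have := (sectionsAdjunction hW).rightAdjoint_preservesLimits.{0, 0}
    exact (closedObjects A.carrier).ι.mono_of_mono_map
      (inferInstanceAs (Mono ((extend hW).map ((submoduleFunctor M).map f))))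
  obtain ⟨hc⟩ := nonempty_isColimit_extend_iSupCocone hW M
  have : IsIso ((extend hW).map (ModuleCat.ofHom (Submodule.inclusion hle))) :=
    A.isOfFiniteType.isIso_of_isoModSerre hF (c := (extend hW).mapCocone (iSupCocone M))
    hc (closedObjects_extend hP (isTorsionFree_quotient_comap _))
    (isoModSerre_extend_inclusion hle le_rfl)
  have := isIso_of_reflects_iso (ModuleCat.ofHom (Submodule.inclusion hle)) (extend hW)
  intro x hx
  obtain ⟨x, rfl⟩ := Submodule.mkQ_surjective _ x
  obtain ⟨y, hy⟩ := (ConcreteCategory.bijective_of_isIso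
    (ModuleCat.ofHom (Submodule.inclusion hle))).2 ⟨x, hx⟩
  have hxy : (y : P) = x := congrArg Subtype.val hy
  exact (Submodule.Quotient.mk_eq_zero _).2 (hxy ▸ y.2)

variable (A hW) in
lemma exists_fg_torsionClass {I : Ideal Γ(X, W)} (hI : torsionClass A hW (ModuleCat.of _ (_ ⧸ I))) :
    ∃ l ≤ I, l.FG ∧ torsionClass A hW (ModuleCat.of _ (_ ⧸ l)) := by
  by_contra! h
  obtain ⟨K, _, _, _, P, _, _, M, hi, hP, hM, hM'⟩ := exists_not_isTorsionFree_quotient_iSup hI h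
  have := Module.injective_object_of_injective_module Γ(X, W) P
  exact hM' (isTorsionFree_quotient_iSup M hP hM)

end Torsion

/-! ### Supports -/

section Points

variable {X : Scheme.{u}}

lemma exists_affine_mem (P : X) : ∃ W : X.Opens, IsAffineOpen W ∧ P ∈ W := by
  obtain ⟨W, hW, hP, -⟩ := Opens.isBasis_iff_nbhd.1 X.isBasis_affineOpens (Opens.mem_top P)
  exact ⟨W, hW, hP⟩

variable {W : X.Opens} (hW : IsAffineOpen W)

lemma fromSpec_mem_basicOpen_iff (p : PrimeSpectrum Γ(X, W)) (f : Γ(X, W)) :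
    hW.fromSpec p ∈ X.basicOpen f ↔ f ∉ p.asIdeal := by
  change p ∈ hW.fromSpec ⁻¹ᵁ X.basicOpen f ↔ p ∈ PrimeSpectrum.basicOpen f
  rw [hW.fromSpec_preimage_basicOpen]
  rfl

lemma fromSpec_mem (p : PrimeSpectrum Γ(X, W)) : hW.fromSpec p ∈ W :=
  hW.range_fromSpec.le ⟨p, rfl⟩

lemma exists_fromSpec_eq {P : X} (hP : P ∈ W) : ∃ p : PrimeSpectrum Γ(X, W), hW.fromSpec p = P :=
  hW.range_fromSpec.ge hP

lemma not_vanishingAt_fromSpec_iff (p : PrimeSpectrum Γ(X, W)) (F : Qcoh X) :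
    ¬ vanishingAt (hW.fromSpec p) F ↔
      ∃ x : Γ(F.obj, W), Ideal.torsionOf Γ(X, W) Γ(F.obj, W) x ≤ p.asIdeal := by
  rw [vanishingAt_iff hW (fromSpec_mem hW p), ← not_iff_not, not_not, not_exists]
  refine forall_congr' fun x => ?_
  rw [SetLike.not_le_iff_exists]
  refine exists_congr fun f => ?_
  rw [fromSpec_mem_basicOpen_iff, and_comm]
  rfl

lemma vanishingAt_of_specializes {P Q : X} (h : P ⤳ Q) {F : Qcoh X} (hF : vanishingAt Q F) :
    vanishingAt P F := by
  obtain ⟨W, hW, hQ⟩ := exists_affine_mem Q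
  rw [vanishingAt_iff hW hQ] at hF
  rw [vanishingAt_iff hW (h.mem_open W.isOpen hQ)]
  intro x
  obtain ⟨f, hf, hx⟩ := hF x
  exact ⟨f, h.mem_open (X.basicOpen f).isOpen hf, hx⟩

/-- The quasi-coherent sheaves whose stalks vanish outside of `V`. -/
def supportedOn (V : Set X) : ObjectProperty (Qcoh X) := fun F => ∀ P, P ∉ V → vanishingAt P F

end Points

section Support

variable {X : Scheme.{u}} [QuasiSeparatedSpace X] [CompactSpace X] (A : TensorLocalizing X)

/-- The union of the supports of the sheaves in `A`. -/
def supportOf : Set X := {P | ∃ F, A.carrier F ∧ ¬ vanishingAt P F}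

lemma exists_prime_of_not_torsionClass {W : X.Opens} (hW : IsAffineOpen W) {I : Ideal Γ(X, W)}
    (hI : ¬ torsionClass A hW (ModuleCat.of _ (_ ⧸ I))) :
    ∃ p : PrimeSpectrum Γ(X, W), I ≤ p.asIdeal ∧
      ¬ torsionClass A hW (ModuleCat.of _ (_ ⧸ p.asIdeal)) := by
  obtain ⟨p, hIp, hp⟩ := zorn_le_nonempty₀
    {J : Ideal Γ(X, W) | ¬ torsionClass A hW (ModuleCat.of _ (_ ⧸ J))}
    (fun c hc hc' y hy => ⟨sSup c, fun hT => by
      obtain ⟨l, hl, hfg, hTl⟩ := exists_fg_torsionClass A hW hT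
      obtain ⟨J, hJ, hlJ⟩ := (CompleteLattice.isCompactElement_iff_le_of_directed_sSup_le _ _).1
        ((Submodule.fg_iff_compact l).1 hfg) c ⟨y, hy⟩ hc'.directedOn hl
      exact hc hJ (prop_quotient_of_le hlJ hTl), fun z hz => le_sSup hz⟩) I hI
  exact ⟨⟨p, isOka_prop_quotient.isPrime_of_maximal_not hp⟩, hIp, hp.prop⟩

lemma fromSpec_mem_supportOf_iff {W : X.Opens} (hW : IsAffineOpen W) (p : PrimeSpectrum Γ(X, W)) :
    hW.fromSpec p ∈ supportOf A ↔ torsionClass A hW (ModuleCat.of _ (_ ⧸ p.asIdeal)) := by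
  refine ⟨fun ⟨F, hF, hFp⟩ => ?_, fun hp => ⟨_, hp, ?_⟩⟩
  · obtain ⟨y, hy⟩ := (not_vanishingAt_fromSpec_iff hW p F).1 hFp
    exact prop_quotient_of_le hy
      (isTorsionElt_of_prop (M := Γ(F.obj, W)) (torsionClass_sections A hW hF) y)
  · let Q := ModuleCat.of Γ(X, W) (Γ(X, W) ⧸ p.asIdeal)
    let ε := (sectionsAdjunction hW).counit.app Q
    obtain ⟨x, hx⟩ := (ModuleCat.epi_iff_surjective ε).1 inferInstance (Submodule.Quotient.mk 1)
    refine (not_vanishingAt_fromSpec_iff hW p _).2 ⟨x, fun r hr => ?_⟩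
    have h : r • (Submodule.Quotient.mk 1 : Γ(X, W) ⧸ p.asIdeal) = 0 :=
      hx ▸ (map_smul ε.hom r x).symm.trans ((congrArg ε hr).trans (map_zero ε.hom))
    rwa [← Submodule.Quotient.mk_smul, Submodule.Quotient.mk_eq_zero, smul_eq_mul, mul_one] at h

theorem carrier_eq_supportedOn : A.carrier = supportedOn (supportOf A) := by
  refine le_antisymm (fun F hF P hP => by_contra fun h => hP ⟨F, hF, h⟩) fun G hG => ?_
  obtain ⟨ι, _, V, hV, hc⟩ := exists_finite_affine_cover (X := X) (U := ⊤) isCompact_univ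
  refine prop_of_sections V hV hc.symm fun i => (torsionClass_iff A (hV i) _).1 ?_
  refine prop_of_isTorsionElt (T := torsionClass A (hV i)) (M := Γ(G.obj, V i))
    fun x => by_contra fun hx => ?_
  obtain ⟨p, hxp, hp⟩ := exists_prime_of_not_torsionClass A (hV i) hx
  exact (not_vanishingAt_fromSpec_iff (hV i) p G).2 ⟨x, hxp⟩
    (hG _ fun h => hp ((fromSpec_mem_supportOf_iff A (hV i) p).1 h))

/- Near the point of a prime `p`, the support contains the closed subset cut out by a finitely
generated ideal `l ≤ p` with torsion quotient. -/
lemma isThomason_supportOf : IsThomason (supportOf A) := by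
  refine isThomason_of_isOpen_constructible ?_ fun P Q h ⟨F, hF, hP⟩ =>
    ⟨F, hF, fun hQ => hP (vanishingAt_of_specializes h hQ)⟩
  refine (@isOpen_iff_forall_mem_open X (constructibleTopology X) _).2 fun P hP => ?_
  obtain ⟨W, hW, hPW⟩ := exists_affine_mem P
  obtain ⟨p, rfl⟩ := exists_fromSpec_eq hW hPW
  obtain ⟨l, hl, ⟨s, rfl⟩, hT⟩ :=
    exists_fg_torsionClass A hW ((fromSpec_mem_supportOf_iff A hW p).1 hP)
  let U : Set X := ⋃ f ∈ s, (X.basicOpen f : Set X)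
  have hU : IsOpen U := isOpen_biUnion fun f _ => (X.basicOpen f).isOpen
  have hUc : IsCompact U := s.isCompact_biUnion fun f _ => (hW.basicOpen f).isCompact
  have hmem (q : PrimeSpectrum Γ(X, W)) : hW.fromSpec q ∉ U ↔ Ideal.span s ≤ q.asIdeal := by
    simp only [U, Set.mem_iUnion, SetLike.mem_coe, fromSpec_mem_basicOpen_iff, exists_prop,
      not_exists, not_and, not_not]
    exact Ideal.span_le.symm
  refine ⟨(W : Set X) ∩ Uᶜ, ?_, @IsOpen.inter X (constructibleTopology X) _ _
    (IsCompact.isOpen_constructibleTopology_of_isOpen hW.isCompact W.isOpen)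
    (IsCompact.isOpen_constructibleTopology_of_isClosed (by rwa [compl_compl]) hU.isClosed_compl),
    ⟨hPW, (hmem p).2 hl⟩⟩
  rintro Q ⟨hQ, hQU⟩
  obtain ⟨q, rfl⟩ := exists_fromSpec_eq hW hQ
  exact (fromSpec_mem_supportOf_iff A hW q).2 (prop_quotient_of_le ((hmem q).1 hQU) hT)

end Support

section Vanishing

variable {X : Scheme.{u}}

lemma vanishingAt_of_sections {P : X} {W : X.Opens} (hW : IsAffineOpen W) (hP : P ∈ W) {F : Qcoh X}
    (h : ∀ x : Γ(F.obj, W), x = 0) : vanishingAt P F :=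
  (vanishingAt_iff hW hP F).2 fun x => ⟨1, by rwa [X.basicOpen_one], by rw [h x, smul_zero]⟩

open scoped TensorProduct in
lemma vanishingAt_tensor {P : X} {F : Qcoh X} (hF : vanishingAt P F) (G : Qcoh X) :
    vanishingAt P ⟨tensor F.obj G.obj, isQcoh_tensor F.property G.property⟩ := by
  obtain ⟨W, hW, hP⟩ := exists_affine_mem P
  rw [vanishingAt_iff hW hP] at hF ⊢
  intro x
  obtain ⟨t, rfl⟩ := (bijective_toTensor F.property G.property hW).2 x
  suffices h : ∃ f : Γ(X, W), P ∈ X.basicOpen f ∧ f • t = 0 by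
    obtain ⟨f, hf, ht⟩ := h
    exact ⟨f, hf, by rw [← map_smul, ht, map_zero]⟩
  induction t with
  | zero => exact ⟨1, by rwa [X.basicOpen_one], smul_zero _⟩
  | add x y hx hy =>
    obtain ⟨f, hf, hfx⟩ := hx
    obtain ⟨g, hg, hgy⟩ := hy
    refine ⟨f * g, X.basicOpen_mul f g ▸ ⟨hf, hg⟩, ?_⟩
    rw [smul_add, mul_smul, smul_comm, hfx, mul_smul, hgy, smul_zero, smul_zero, add_zero]
  | tmul x y =>
    obtain ⟨f, hf, hfx⟩ := hF x
    exact ⟨f, hf, by rw [TensorProduct.smul_tmul', hfx, TensorProduct.zero_tmul]⟩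

variable [QuasiSeparatedSpace X]

instance (P : X) : (vanishingAt P).IsSerreClass where
  exists_zero := by
    obtain ⟨W, hW, hP⟩ := exists_affine_mem P
    refine ⟨_, isZero_zero _, vanishingAt_of_sections hW hP fun x => ?_⟩
    have := ModuleCat.subsingleton_of_isZero ((sections W).map_isZero (isZero_zero (Qcoh X)))
    exact Subsingleton.elim (α := (sections W).obj _) _ _
  prop_of_mono {F G} f _ h := by
    obtain ⟨W, hW, hP⟩ := exists_affine_mem P
    rw [vanishingAt_iff hW hP] at h ⊢
    intro x
    obtain ⟨r, hr, hx⟩ := h (f.hom.app W x)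
    refine ⟨r, hr, injective_of_mono f W ?_⟩
    rw [Scheme.Modules.Hom.app_smul, hx, map_zero]
  prop_of_epi {F G} f _ h := by
    obtain ⟨W, hW, hP⟩ := exists_affine_mem P
    rw [vanishingAt_iff hW hP] at h ⊢
    intro x
    obtain ⟨x, rfl⟩ := surjective_of_epi f hW x
    obtain ⟨r, hr, hx⟩ := h x
    exact ⟨r, hr, by rw [← Scheme.Modules.Hom.app_smul, hx, map_zero]⟩
  prop_X₂_of_shortExact {S} hS h₁ h₃ := by
    obtain ⟨W, hW, hP⟩ := exists_affine_mem P
    have := preservesFiniteColimits_sections hW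
    have hex := (ShortComplex.moduleCat_exact_iff _).1 (hS.exact.map (sections W))
    rw [vanishingAt_iff hW hP] at h₁ h₃ ⊢
    intro x
    obtain ⟨r, hr, hx⟩ := h₃ (S.g.hom.app W x)
    obtain ⟨(y : Γ(S.X₁.obj, W)), hy⟩ := hex (r • x) ((Scheme.Modules.Hom.app_smul _ _ _).trans hx)
    have hyx : S.f.hom.app W y = r • x := hy
    obtain ⟨s, hs, hsy⟩ := h₁ y
    refine ⟨s * r, X.basicOpen_mul s r ▸ ⟨hs, hr⟩, ?_⟩
    rw [mul_smul, ← hyx, ← Scheme.Modules.Hom.app_smul, hsy, map_zero]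

instance (P : X) : IsLocalizingSubcategory (vanishingAt P) where
  closedUnderFilteredColimits J _ _ :=
    { colimitsOfShape_le := by
        rintro F ⟨p⟩
        obtain ⟨W, hW, hP⟩ := exists_affine_mem P
        rw [vanishingAt_iff hW hP]
        intro x
        obtain ⟨j, y, rfl⟩ := exists_rep_of_isColimit p.isColimit hW x
        obtain ⟨r, hr, hy⟩ := (vanishingAt_iff hW hP _).1 (p.prop_diag_obj j) y
        exact ⟨r, hr, by rw [← Scheme.Modules.Hom.app_smul, hy, map_zero]⟩ }

instance (V : Set X) : (supportedOn V).IsSerreClass where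
  exists_zero := ⟨_, isZero_zero _, fun P _ => (vanishingAt P).prop_of_isZero (isZero_zero _)⟩
  prop_of_mono f _ h P hP := (vanishingAt P).prop_of_mono f (h P hP)
  prop_of_epi f _ h P hP := (vanishingAt P).prop_of_epi f (h P hP)
  prop_X₂_of_shortExact hS h₁ h₃ P hP :=
    (vanishingAt P).prop_X₂_of_shortExact hS (h₁ P hP) (h₃ P hP)

instance (V : Set X) : IsLocalizingSubcategory (supportedOn V) where
  closedUnderFilteredColimits J _ _ :=
    { colimitsOfShape_le := by
        rintro F ⟨p⟩ P hP
        have := IsLocalizingSubcategory.closedUnderFilteredColimits (S := vanishingAt P) J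
        exact (vanishingAt P).prop_of_isColimit p.isColimit fun j => p.prop_diag_obj j P hP }

end Vanishing

/-! ### Sheaves supported on a Thomason subset -/

section RestrictPushforward

variable {X : Scheme.{u}}

lemma ι_image_preimage_eq (U W : X.Opens) : U.ι ''ᵁ U.ι ⁻¹ᵁ W = W ⊓ U := by
  rw [U.ι.image_preimage_eq_opensRange_inf, Scheme.Opens.opensRange_ι, inf_comm]

variable [QuasiSeparatedSpace X] (U : X.Opens) [CompactSpace U]

/-- The direct image of the restriction to a quasi-compact open subset. -/
def restrictPushforward : Qcoh X ⥤ Qcoh X := restrict U.ι ⋙ pushforward U.ι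

/-- The map from a sheaf to the direct image of its restriction. -/
def toRestrictPushforward (F : Qcoh X) : F ⟶ (restrictPushforward U).obj F :=
  (restrictAdjunction U.ι).unit.app F

variable {U}

lemma toRestrictPushforward_eq_zero_iff (F : Qcoh X) (W : X.Opens) (x : Γ(F.obj, W)) :
    (toRestrictPushforward U F).hom.app W x = 0 ↔
      res F.obj (inf_le_left : W ⊓ U ≤ W) x = 0 := by
  have h₁ : W ⊓ U ≤ U.ι ''ᵁ U.ι ⁻¹ᵁ W := (ι_image_preimage_eq U W).ge
  have h₂ : U.ι ''ᵁ U.ι ⁻¹ᵁ W ≤ W ⊓ U := (ι_image_preimage_eq U W).le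
  refine (map_eq_zero_iff (res F.obj h₁) (res_injective_of_le h₁ h₂)).symm.trans
    (iff_of_eq (congrArg (· = 0) ?_))
  exact res_res (U.ι.image_preimage_le W) h₁ x

lemma bijective_toRestrictPushforward_iff (F : Qcoh X) (W : X.Opens) :
    Function.Bijective ((toRestrictPushforward U F).hom.app W) ↔
      Function.Bijective (res F.obj (inf_le_left : W ⊓ U ≤ W)) := by
  have h₁ : W ⊓ U ≤ U.ι ''ᵁ U.ι ⁻¹ᵁ W := (ι_image_preimage_eq U W).ge
  have h₂ : U.ι ''ᵁ U.ι ⁻¹ᵁ W ≤ W ⊓ U := (ι_image_preimage_eq U W).le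
  have hb : Function.Bijective (res F.obj h₁) :=
    ⟨res_injective_of_le h₁ h₂, fun x => ⟨res F.obj h₂ x, by rw [res_res, res_self]⟩⟩
  refine (hb.of_comp_iff' fun x : Γ(F.obj, W) => res F.obj (U.ι.image_preimage_le W) x).symm.trans
    (iff_of_eq (congrArg _ (funext fun x => ?_)))
  exact res_res (U.ι.image_preimage_le W) h₁ x

lemma bijective_toRestrictPushforward (F : Qcoh X) {W : X.Opens} (h : W ≤ U) :
    Function.Bijective ((toRestrictPushforward U F).hom.app W) := by
  rw [bijective_toRestrictPushforward_iff]
  have h' : W ≤ W ⊓ U := le_inf le_rfl h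
  exact ⟨res_injective_of_le _ h', fun x => ⟨res F.obj h' x, by rw [res_res, res_self]⟩⟩

lemma isoModSerre_toRestrictPushforward {V : Set X} (hUV : (U : Set X)ᶜ ⊆ V) (F : Qcoh X) :
    (supportedOn V).isoModSerre (toRestrictPushforward U F) := by
  have exists_bijective (P : X) (hP : P ∉ V) : ∃ W : X.Opens, IsAffineOpen W ∧ P ∈ W ∧
      Function.Bijective ((toRestrictPushforward U F).hom.app W) := by
    obtain ⟨W, hW, hPW, hWU⟩ := Opens.isBasis_iff_nbhd.1 X.isBasis_affineOpens
      (show P ∈ U from by_contra fun h => hP (hUV h))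
    exact ⟨W, hW, hPW, bijective_toRestrictPushforward F hWU⟩
  refine ⟨fun P hP => ?_, fun P hP => ?_⟩ <;> obtain ⟨W, hW, hPW, hb⟩ := exists_bijective P hP
  · refine vanishingAt_of_sections hW hPW fun x =>
      injective_of_mono (kernel.ι _) W ((hb.1 ?_).trans (map_zero _).symm)
    rw [map_zero]
    exact congr(($(kernel.condition (toRestrictPushforward U F))).hom.app W x)
  · refine vanishingAt_of_sections hW hPW fun x => ?_
    obtain ⟨x, rfl⟩ := surjective_of_epi (cokernel.π (toRestrictPushforward U F)) hW x
    obtain ⟨x, rfl⟩ := hb.2 x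
    exact congr(($(cokernel.condition (toRestrictPushforward U F))).hom.app W x)

lemma isIso_toRestrictPushforward {V : Set X} (hUV : (U : Set X)ᶜ ⊆ V) {Z : Qcoh X}
    (hZ : closedObjects (supportedOn V) Z) : IsIso (toRestrictPushforward U Z) := by
  let : Reflective (pushforward U.ι) := { L := restrict U.ι, adj := restrictAdjunction U.ι }
  obtain ⟨r, hr⟩ : ∃ r, toRestrictPushforward U Z ≫ r = 𝟙 Z :=
    (hZ _ (isoModSerre_toRestrictPushforward hUV Z)).2 (𝟙 Z)
  have : IsSplitMono ((reflectorAdjunction (pushforward U.ι)).unit.app Z) := ⟨⟨r, hr⟩⟩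
  exact Functor.essImage.unit_isIso (i := pushforward U.ι) mem_essImage_of_unit_isSplitMono

end RestrictPushforward

section Abelian

variable {C : Type*} [Category* C] [Abelian C] (S : ObjectProperty C) [S.IsSerreClass]

lemma closedObjects_of_exists_retraction {Z : C} (h₀ : ∀ {K : C} (_ : S K) (g : K ⟶ Z), g = 0)
    (h : ∀ {E : C} (i : Z ⟶ E) [Mono i], S (cokernel i) → ∃ r : E ⟶ Z, i ≫ r = 𝟙 Z) :
    closedObjects S Z := by
  intro A B f hf
  refine ⟨fun a b hab => ?_, fun g => ?_⟩
  · have hd : f ≫ (a - b) = 0 := by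
      rw [Preadditive.comp_sub, sub_eq_zero]
      exact hab
    rw [← sub_eq_zero, ← cokernel.π_desc f (a - b) hd, h₀ hf.2 (cokernel.desc f _ hd), comp_zero]
  · have hi : S.isoModSerre (pushout.inr f g) := MorphismProperty.pushout_inr _ _ hf
    have : Mono (pushout.inr f g) := Preadditive.mono_of_kernel_zero (h₀ hi.1 _)
    obtain ⟨r, hr⟩ := h (pushout.inr f g) hi.2
    refine ⟨pushout.inl f g ≫ r, ?_⟩
    change f ≫ pushout.inl f g ≫ r = g
    rw [pushout.condition_assoc, hr, Category.comp_id]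

instance : (closedObjects S).ι.PreservesMonomorphisms where
  preserves f _ := by
    have : (closedObjects S).IsClosedUnderLimitsOfShape WalkingCospan :=
      inferInstanceAs (S.isoModSerre.isLocal.IsClosedUnderLimitsOfShape _)
    infer_instance

end Abelian

section Biproduct

variable {J C : Type*} [Category* J] [Category* C] [Preadditive C] [HasBinaryBiproducts C]

/-- The direct sum of a constant functor and a functor. -/
def constBiprod (Z : C) (T : J ⥤ C) : J ⥤ C where
  obj j := Z ⊞ T.obj j
  map f := biprod.map (𝟙 Z) (T.map f)

/-- The cocone on `constBiprod Z T` given by a cocone on `T` and a morphism from `Z`. -/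
def constBiprodCocone {Z : C} {T : J ⥤ C} (c : Cocone T) (i : Z ⟶ c.pt) :
    Cocone (constBiprod Z T) where
  pt := c.pt
  ι := { app j := biprod.desc i (c.ι.app j)
         naturality j k f := by
          change biprod.map (𝟙 Z) (T.map f) ≫ biprod.desc i (c.ι.app k) =
            biprod.desc i (c.ι.app j) ≫ 𝟙 c.pt
          apply biprod.hom_ext' <;> simp }

lemma exists_retraction_of_isColimit_constBiprodCocone [Nonempty J] {Z : C} {T : J ⥤ C}
    {c : Cocone T} {i : Z ⟶ c.pt} (hc : IsColimit (constBiprodCocone c i)) :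
    ∃ r, i ≫ r = 𝟙 Z := by
  let fstCocone : Cocone (constBiprod Z T) :=
    { pt := Z
      ι := { app j := biprod.fst
             naturality j k f := by
              change biprod.map (𝟙 Z) (T.map f) ≫ biprod.fst = biprod.fst ≫ 𝟙 Z
              simp } }
  let r : c.pt ⟶ Z := hc.desc fstCocone
  have h : biprod.desc i (c.ι.app (Classical.arbitrary J)) ≫ r = biprod.fst := hc.fac fstCocone _
  refine ⟨r, ?_⟩
  rw [← biprod.inl_desc_assoc i (c.ι.app (Classical.arbitrary J)), h, biprod.inl_fst]

end Biproduct

section Sections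

variable {X : Scheme.{u}}

lemma exists_app_eq_of_exact {S : ShortComplex (Qcoh X)} (hS : S.Exact) (hm : Mono S.f)
    (U : X.Opens) (x : Γ(S.X₂.obj, U)) (hx : S.g.hom.app U x = 0) :
    ∃ y, S.f.hom.app U y = x :=
  (ShortComplex.moduleCat_exact_iff _).1
    (hS.map_of_mono_of_preservesKernel (sections U) hm inferInstance) x hx

lemma exists_kernel_ι_app_eq {F G : Qcoh X} (g : F ⟶ G) (U : X.Opens) (x : Γ(F.obj, U))
    (hx : g.hom.app U x = 0) : ∃ y, (kernel.ι g).hom.app U y = x :=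
  exists_app_eq_of_exact (ShortComplex.exact_kernel g) (inferInstanceAs (Mono (kernel.ι g))) U x hx

lemma exists_app_eq_of_cokernel_π_app_eq_zero {F G : Qcoh X} (g : F ⟶ G) [hg : Mono g]
    (U : X.Opens) (x : Γ(G.obj, U)) (hx : (cokernel.π g).hom.app U x = 0) :
    ∃ y, g.hom.app U y = x :=
  exists_app_eq_of_exact (ShortComplex.exact_cokernel g) hg U x hx

lemma injective_biprod_desc {Z T E : Qcoh X} (i : Z ⟶ E) (k : T ⟶ E) (W : X.Opens)
    (h : ∀ z t, i.hom.app W z + k.hom.app W t = 0 → z = 0 ∧ t = 0) :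
    Function.Injective ((biprod.desc i k).hom.app W) := by
  refine (injective_iff_map_eq_zero _).2 fun w hw => ?_
  have hw' : (biprod.inl : _ ⟶ Z ⊞ T).hom.app W ((biprod.fst : Z ⊞ T ⟶ _).hom.app W w) +
      (biprod.inr : _ ⟶ Z ⊞ T).hom.app W ((biprod.snd : Z ⊞ T ⟶ _).hom.app W w) = w :=
    congr(($(biprod.total (X := Z) (Y := T))).hom.app W w)
  rw [biprod.desc_eq] at hw
  obtain ⟨h₁, h₂⟩ := h ((biprod.fst : Z ⊞ T ⟶ _).hom.app W w)
    ((biprod.snd : Z ⊞ T ⟶ _).hom.app W w) hw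
  rw [← hw', h₁, h₂, map_zero, map_zero, add_zero]

lemma exists_biprod_desc_app_eq {Z T E : Qcoh X} (i : Z ⟶ E) (k : T ⟶ E) (W : X.Opens)
    (z : Γ(Z.obj, W)) (t : Γ(T.obj, W)) :
    ∃ w, (biprod.desc i k).hom.app W w = i.hom.app W z + k.hom.app W t := by
  refine ⟨(biprod.inl : _ ⟶ Z ⊞ T).hom.app W z + (biprod.inr : _ ⟶ Z ⊞ T).hom.app W t, ?_⟩
  rw [map_add]
  exact congr($(congr(($(biprod.inl_desc i k)).hom.app W z)) +
    $(congr(($(biprod.inr_desc i k)).hom.app W t)))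

end Sections

section CompactNhds

variable {X : Scheme.{u}} (V : Set X)

/-- The quasi-compact open subsets that contain the complement of `V`, ordered by reverse
inclusion. -/
abbrev CompactNhds : Type u := {U : X.Opens // IsCompact (U : Set X) ∧ (U : Set X)ᶜ ⊆ V}ᵒᵈ

variable {V}

/-- The open subset underlying an element of `CompactNhds V`. -/
abbrev CompactNhds.opens (U : CompactNhds V) : X.Opens := (OrderDual.ofDual U).1

lemma CompactNhds.isCompact (U : CompactNhds V) : IsCompact (U.opens : Set X) :=
  (OrderDual.ofDual U).2.1

lemma CompactNhds.compl_subset (U : CompactNhds V) : (U.opens : Set X)ᶜ ⊆ V :=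
  (OrderDual.ofDual U).2.2

instance (U : CompactNhds V) : CompactSpace U.opens := isCompact_iff_compactSpace.1 U.isCompact

instance [CompactSpace X] : Nonempty (CompactNhds V) :=
  ⟨OrderDual.toDual ⟨⊤, isCompact_univ, Set.compl_univ.trans_subset V.empty_subset⟩⟩

variable [QuasiSeparatedSpace X]

instance : IsDirectedOrder (CompactNhds V) where
  directed U U' := by
    refine ⟨OrderDual.toDual ⟨U.opens ⊓ U'.opens, ?_, ?_⟩, ?_, ?_⟩
    · exact U.isCompact.inter_of_isOpen U'.isCompact U.opens.isOpen U'.opens.isOpen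
    · rw [Opens.coe_inf, Set.compl_inter]
      exact Set.union_subset U.compl_subset U'.compl_subset
    · exact (inf_le_left : U.opens ⊓ U'.opens ≤ U.opens)
    · exact (inf_le_right : U.opens ⊓ U'.opens ≤ U'.opens)

lemma res_kernel_ι_toRestrictPushforward (U : X.Opens) [CompactSpace U] (E : Qcoh X) (W : X.Opens)
    (t : Γ((kernel (toRestrictPushforward U E)).obj, W)) :
    res E.obj (inf_le_left : W ⊓ U ≤ W)
      ((kernel.ι (toRestrictPushforward U E)).hom.app W t) = 0 := by
  rw [← toRestrictPushforward_eq_zero_iff]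
  exact congr(($(kernel.condition (toRestrictPushforward U E))).hom.app W t)

variable (V)

/-- The subsheaves of the sections of `E` that vanish on some element of `CompactNhds V`. -/
def supportFunctor (E : Qcoh X) : CompactNhds V ⥤ Qcoh X where
  obj U := kernel (toRestrictPushforward U.opens E)
  map {U U'} h := kernel.lift _ (kernel.ι _) (hom_ext_of_affine fun W _ x => by
    have hU : U'.opens ≤ U.opens := h.le
    refine (toRestrictPushforward_eq_zero_iff (U := U'.opens) E W
      ((kernel.ι (toRestrictPushforward U.opens E)).hom.app W x)).2 ?_
    rw [← res_res (inf_le_left : W ⊓ U.opens ≤ W) (inf_le_inf_left W hU),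
      res_kernel_ι_toRestrictPushforward, map_zero])
  map_id U := by rw [← cancel_mono (kernel.ι _)]; simp
  map_comp f g := by rw [← cancel_mono (kernel.ι _)]; simp

/-- The inclusions of the values of `supportFunctor V E` into `E`. -/
def supportCocone (E : Qcoh X) : Cocone (supportFunctor V E) where
  pt := E
  ι := { app U := kernel.ι (toRestrictPushforward U.opens E)
         naturality _ _ _ := (kernel.lift_ι _ _ _).trans (Category.comp_id _).symm }

end CompactNhds

section ClosedOn

variable {X : Scheme.{u}}

/-- The sections of `Z` over affine open subsets do not change when they are restricted to a
quasi-compact open subset that contains the complement of `V`. For Thomason subsets `V` this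
characterizes the closed objects for the sheaves supported on `V`. -/
def IsClosedOn (V : Set X) (Z : Qcoh X) : Prop :=
  ∀ U : CompactNhds V, ∀ W, IsAffineOpen W →
    Function.Bijective (res Z.obj (inf_le_left : W ⊓ U.opens ≤ W))

variable [QuasiSeparatedSpace X] {V : Set X} {Z : Qcoh X}

lemma isClosedOn_of_closedObjects (hZ : closedObjects (supportedOn V) Z) : IsClosedOn V Z := by
  intro U W _
  have := isIso_toRestrictPushforward U.compl_subset hZ
  rw [← bijective_toRestrictPushforward_iff]
  exact ConcreteCategory.bijective_of_isIso ((sections W).map (toRestrictPushforward U.opens Z))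

lemma IsClosedOn.of_isColimit {J : Type u} [SmallCategory J] [IsFiltered J] {F : J ⥤ Qcoh X}
    {c : Cocone F} (hc : IsColimit c) (hF : ∀ {i j : J} (f : i ⟶ j), Mono (F.map f))
    (h : ∀ j, IsClosedOn V (F.obj j)) : IsClosedOn V c.pt := by
  have hm := mono_of_isColimit hc hF
  intro U W hW
  refine ⟨(injective_iff_map_eq_zero _).2 fun x hx => ?_, fun x => ?_⟩
  · obtain ⟨j, y, rfl⟩ := exists_rep_of_isColimit hc hW x
    rw [← app_res'] at hx
    have hy := injective_of_mono (c.ι.app j) _ (hx.trans (map_zero _).symm)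
    rw [(injective_iff_map_eq_zero _).1 (h j U W hW).1 y hy, map_zero]
  · obtain ⟨j, y, rfl⟩ := exists_rep_of_isCompact hc hm (U := W ⊓ U.opens)
      (hW.isCompact.inter_of_isOpen U.isCompact W.isOpen U.opens.isOpen) x
    obtain ⟨y, rfl⟩ := (h j U W hW).2 y
    exact ⟨(c.ι.app j).hom.app W y, (app_res' _ _ _).symm⟩

lemma IsClosedOn.injective_biprod_desc (hZ : IsClosedOn V Z) {E : Qcoh X} (i : Z ⟶ E) [Mono i]
    (U : CompactNhds V) {W : X.Opens} (hW : IsAffineOpen W) : Function.Injective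
      ((biprod.desc i (kernel.ι (toRestrictPushforward U.opens E))).hom.app W) := by
  let k := kernel.ι (toRestrictPushforward U.opens E)
  refine Reconstruction.injective_biprod_desc i k W fun z t hzt => ?_
  have hz : z = 0 := by
    refine (injective_iff_map_eq_zero _).1 (hZ U W hW).1 z (injective_of_mono i _ ?_)
    have := congrArg (res E.obj (inf_le_left : W ⊓ U.opens ≤ W)) hzt
    rw [map_add, res_kernel_ι_toRestrictPushforward, add_zero, map_zero] at this
    rw [app_res', this, map_zero]
  refine ⟨hz, injective_of_mono k W ?_⟩
  rwa [hz, map_zero, zero_add, ← map_zero (k.hom.app W).hom] at hzt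

variable [CompactSpace X]

lemma exists_res_eq_zero (hV : IsThomason V) {K : Qcoh X} (hK : supportedOn V K)
    {W : X.Opens} (hW : IsAffineOpen W) (x : Γ(K.obj, W)) :
    ∃ U : CompactNhds V, res K.obj (inf_le_left : W ⊓ U.opens ≤ W) x = 0 := by
  let ι := {f : Γ(X, W) // f • x = 0}
  let W₀ : X.Opens := ⨆ i : ι, X.basicOpen i.1
  have hC : IsClosed[constructibleTopology X] ((W : Set X) \ W₀) := by
    rw [← @isOpen_compl_iff _ _ (constructibleTopology X), Set.compl_sdiff]
    exact @IsOpen.union X _ _ (constructibleTopology X) (isOpen_constructible_of_isOpen W₀.isOpen)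
      (isThomason_compl W.isOpen hW.isCompact).isOpen_constructible
  obtain ⟨U, hU, hUc, hUC, hUV⟩ := hV.exists_disjoint_of_isClosed hC fun P hP => by
    by_contra hPV
    obtain ⟨f, hf, hx⟩ := (vanishingAt_iff hW hP.1 K).1 (hK P hPV) x
    exact hP.2 (Opens.mem_iSup.2 ⟨⟨f, hx⟩, hf⟩)
  let U' : CompactNhds V := OrderDual.toDual ⟨⟨U, hU⟩, hUc, hUV⟩
  refine ⟨U', sections_eq_zero (fun i : ι => X.basicOpen i.1 ⊓ U'.opens)
    (fun i => inf_le_inf_right _ (X.basicOpen_le i.1)) (fun P hP => ?_) fun i => ?_⟩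
  · have hP₀ : P ∈ W₀ := by_contra fun h => Set.disjoint_left.1 hUC hP.2 ⟨hP.1, h⟩
    obtain ⟨i, hi⟩ := Opens.mem_iSup.1 hP₀
    exact Opens.mem_iSup.2 ⟨i, hi, hP.2⟩
  · rw [res_res, ← res_res (X.basicOpen_le i.1) inf_le_left, res_basicOpen_eq_zero i.2, map_zero]

lemma IsClosedOn.eq_zero (hV : IsThomason V) (hZ : IsClosedOn V Z) {K : Qcoh X}
    (hK : supportedOn V K) (g : K ⟶ Z) : g = 0 := by
  refine hom_ext_of_affine fun W hW x => ?_
  obtain ⟨U, hx⟩ := exists_res_eq_zero hV hK hW x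
  refine (hZ U W hW).1 ?_
  rw [← app_res', hx, map_zero]
  exact (map_zero (res Z.obj (inf_le_left : W ⊓ U.opens ≤ W))).symm

lemma IsClosedOn.exists_biprod_desc_app_eq (hV : IsThomason V) (hZ : IsClosedOn V Z) {E : Qcoh X}
    (i : Z ⟶ E) [Mono i] (hC : supportedOn V (cokernel i)) {W : X.Opens} (hW : IsAffineOpen W)
    (x : Γ(E.obj, W)) : ∃ (U : CompactNhds V) (w : Γ((Z ⊞ (supportFunctor V E).obj U).obj, W)),
      (biprod.desc i ((supportCocone V E).ι.app U)).hom.app W w = x := by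
  obtain ⟨U, hx⟩ := exists_res_eq_zero hV hC hW ((cokernel.π i).hom.app W x)
  rw [← app_res'] at hx
  obtain ⟨z₀, hz₀⟩ := exists_app_eq_of_cokernel_π_app_eq_zero i _ _ hx
  obtain ⟨z, rfl⟩ := (hZ U W hW).2 z₀
  have hxz : (toRestrictPushforward U.opens E).hom.app W (x - i.hom.app W z) = 0 := by
    rw [toRestrictPushforward_eq_zero_iff, map_sub, sub_eq_zero, ← app_res']
    exact hz₀.symm
  obtain ⟨t, ht⟩ := exists_kernel_ι_app_eq _ W _ hxz
  obtain ⟨w, hw⟩ := Reconstruction.exists_biprod_desc_app_eq i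
    (kernel.ι (toRestrictPushforward U.opens E)) W z t
  refine ⟨U, w, hw.trans ?_⟩
  rw [ht, add_sub_cancel]

/- The extension `E` of a sheaf supported on `V` by `Z` is the directed union of the direct sums of
`Z` and the subsheaves of `E` that vanish on a quasi-compact neighbourhood of `Vᶜ`. -/
lemma IsClosedOn.exists_retraction (hV : IsThomason V) (hZ : IsClosedOn V Z) {E : Qcoh X}
    (i : Z ⟶ E) [Mono i] (hC : supportedOn V (cokernel i)) : ∃ r : E ⟶ Z, i ≫ r = 𝟙 Z := by
  suffices h : Nonempty (IsColimit (constBiprodCocone (supportCocone V E) i)) from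
    exists_retraction_of_isColimit_constBiprodCocone h.some
  exact nonempty_isColimit_of_mono_of_exists_rep _
    (fun U => mono_of_injective _ fun _ hW => hZ.injective_biprod_desc i U hW)
    fun _ hW x => hZ.exists_biprod_desc_app_eq hV i hC hW x

lemma closedObjects_supportedOn_iff (hV : IsThomason V) :
    closedObjects (supportedOn V) Z ↔ IsClosedOn V Z :=
  ⟨isClosedOn_of_closedObjects, fun hZ => closedObjects_of_exists_retraction _
    (fun hK g => hZ.eq_zero hV hK g) fun i _ hC => hZ.exists_retraction hV i hC⟩

lemma isOfFiniteType_supportedOn (hV : IsThomason V) : IsOfFiniteType (supportedOn V) := by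
  intro J _ _ _ F hF
  let c := colimit.cocone (F ⋙ (closedObjects (supportedOn V)).ι)
  let hc : IsColimit c := colimit.isColimit _
  have hpt : closedObjects (supportedOn V) c.pt :=
    (closedObjects_supportedOn_iff hV).2 <| IsClosedOn.of_isColimit hc
      (fun f => have := hF f
        inferInstanceAs (Mono ((closedObjects (supportedOn V)).ι.map (F.map f))))
      fun j => isClosedOn_of_closedObjects (F.obj j).property
  let c' : Cocone F :=
    { pt := ⟨c.pt, hpt⟩
      ι := { app j := ObjectProperty.homMk (c.ι.app j)
             naturality i j f := ObjectProperty.hom_ext _ (c.ι.naturality f) } }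
  have hc' : IsColimit ((closedObjects (supportedOn V)).ι.mapCocone c') := hc
  exact preservesColimit_of_preserves_colimit_cocone
    (isColimitOfReflects (closedObjects (supportedOn V)).ι hc') hc'

/-- The tensor localizing subcategory of finite type of the sheaves supported on a Thomason
subset. -/
def tensorLocalizingOf (V : Set X) (hV : IsThomason V) : TensorLocalizing X where
  carrier := supportedOn V
  isOfFiniteType := isOfFiniteType_supportedOn hV
  isTensor F G hF := ⟨isQcoh_tensor F.property G.property,
    fun P hP => vanishingAt_tensor (hF P hP) G⟩

end ClosedOn

/-! ### The points of the spectrum -/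

section Spectrum

variable {X : Scheme.{u}}

attribute [ext] TensorLocalizing LatticeSpec

/-- The direct image of the residue field of a point, as a quasi-coherent sheaf. -/
def residueFieldSheaf (Q : X) : Qcoh X :=
  (pushforward (X.fromSpecResidueField Q)).obj (structureModule _)

lemma not_vanishingAt_residueFieldSheaf (Q : X) : ¬ vanishingAt Q (residueFieldSheaf Q) := by
  intro h
  let g := X.fromSpecResidueField Q
  obtain ⟨W, hW, hQ⟩ := exists_affine_mem Q
  obtain ⟨f, hQf, hf⟩ := (vanishingAt_iff hW hQ _).1 h (1 : Γ(Spec (X.residueField Q), g ⁻¹ᵁ W))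
  have hgf : g.app W f = 0 := (mul_one _).symm.trans hf
  have hempty : g ⁻¹ᵁ X.basicOpen f = ⊥ := by
    rw [Scheme.preimage_basicOpen, hgf, Scheme.basicOpen_zero]
  have hmem : default ∈ g ⁻¹ᵁ X.basicOpen f := by
    change g default ∈ X.basicOpen f
    rwa [X.fromSpecResidueField_apply]
  rwa [hempty] at hmem

lemma vanishingAt_residueFieldSheaf_iff {P Q : X} :
    vanishingAt P (residueFieldSheaf Q) ↔ ¬ Q ⤳ P := by
  refine ⟨fun h hQP => not_vanishingAt_residueFieldSheaf Q (vanishingAt_of_specializes hQP h),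
    fun h => ?_⟩
  let g := X.fromSpecResidueField Q
  obtain ⟨s, hs, hP, hQ⟩ := not_specializes_iff_exists_open.1 h
  obtain ⟨W, hW, hPW, hWs⟩ := Opens.isBasis_iff_nbhd.1 X.isBasis_affineOpens
    (show P ∈ (⟨s, hs⟩ : X.Opens) from hP)
  have hempty : g ⁻¹ᵁ W = ⊥ := by
    refine eq_bot_iff.2 fun y (hy : g y ∈ W) => (hQ ?_).elim
    rw [X.fromSpecResidueField_apply] at hy
    exact hWs hy
  have : Subsingleton Γ(Spec (X.residueField Q), g ⁻¹ᵁ W) := by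
    rw [hempty]
    infer_instance
  exact vanishingAt_of_sections hW hPW
    fun (x : Γ(Spec (X.residueField Q), g ⁻¹ᵁ W)) => Subsingleton.elim x 0

lemma supportedOn_inf (V V' : Set X) : supportedOn V ⊓ supportedOn V' = supportedOn (V ∩ V') := by
  ext F
  refine ⟨fun h P hP => ?_, fun h => ⟨fun P hP => h P fun hP' => hP hP'.1,
    fun P hP => h P fun hP' => hP hP'.2⟩⟩
  by_cases hPV : P ∈ V
  · exact h.2 P fun hPV' => hP ⟨hPV, hPV'⟩
  · exact h.1 P hPV

lemma supportedOn_univ : supportedOn (Set.univ : Set X) = ⊤ :=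
  top_le_iff.1 fun _ _ P hP => (hP (Set.mem_univ P)).elim

lemma supportedOn_nonGeneralizations (P : X) :
    supportedOn (nonGeneralizations P) = vanishingAt P := by
  ext F
  exact ⟨fun h => h P fun h' => h' specializes_rfl,
    fun h Q hQ => vanishingAt_of_specializes (not_not.1 hQ) h⟩

lemma supportedOn_le_iff {V V' : Set X} (hV : IsThomason V) :
    supportedOn V ≤ supportedOn V' ↔ V ⊆ V' := by
  refine ⟨fun h Q hQ => by_contra fun hQ' => ?_, fun h F hF P hP => hF P fun hP' => hP (h hP')⟩
  refine not_vanishingAt_residueFieldSheaf Q (h _ (fun P hP => ?_) Q hQ')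
  exact vanishingAt_residueFieldSheaf_iff.2 fun hQP => hP (hV.mem_of_specializes hQP hQ)

variable [QuasiSeparatedSpace X] [CompactSpace X]

lemma carrier_le_iff {A B : TensorLocalizing X} :
    A.carrier ≤ B.carrier ↔ supportOf A ⊆ supportOf B := by
  rw [carrier_eq_supportedOn A, carrier_eq_supportedOn B,
    supportedOn_le_iff (isThomason_supportOf A)]

lemma carrier_inf_le_iff {A B C : TensorLocalizing X} :
    A.carrier ⊓ B.carrier ≤ C.carrier ↔ supportOf A ∩ supportOf B ⊆ supportOf C := by
  rw [carrier_eq_supportedOn A, carrier_eq_supportedOn B, carrier_eq_supportedOn C,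
    supportedOn_inf, supportedOn_le_iff ((isThomason_supportOf A).inter (isThomason_supportOf B))]

lemma supportOf_tensorLocalizingOf {V : Set X} (hV : IsThomason V) :
    supportOf (tensorLocalizingOf V hV) = V := by
  have h : supportedOn V = supportedOn (supportOf (tensorLocalizingOf V hV)) :=
    carrier_eq_supportedOn (tensorLocalizingOf V hV)
  exact Set.Subset.antisymm ((supportedOn_le_iff (isThomason_supportOf _)).1 h.ge)
    ((supportedOn_le_iff hV).1 h.le)

/-- The prime element of the sheaves whose stalk at `P` vanishes. -/
def pointPrime (P : X) : LatticeSpec X where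
  toTensorLocalizing := tensorLocalizingOf _ (isThomason_nonGeneralizations P)
  ne_top h := not_vanishingAt_residueFieldSheaf P <| by
    rw [← supportedOn_nonGeneralizations]
    exact h.ge _ trivial
  prime A B h := by
    rw [carrier_inf_le_iff, supportOf_tensorLocalizingOf, ((isThomason_supportOf A).inter
      (isThomason_supportOf B)).subset_nonGeneralizations_iff] at h
    rw [carrier_le_iff, carrier_le_iff, supportOf_tensorLocalizingOf,
      (isThomason_supportOf A).subset_nonGeneralizations_iff,
      (isThomason_supportOf B).subset_nonGeneralizations_iff]
    exact not_and_or.1 h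

lemma subcategory_pointPrime (P : X) : (pointPrime P).subcategory = vanishingAt P :=
  supportedOn_nonGeneralizations P

lemma supportOf_pointPrime (P : X) :
    supportOf (pointPrime P).toTensorLocalizing = nonGeneralizations P :=
  supportOf_tensorLocalizingOf (isThomason_nonGeneralizations P)

lemma pointPrime_injective : Function.Injective (pointPrime : X → LatticeSpec X) := fun P Q h =>
  nonGeneralizations_injective <| by rw [← supportOf_pointPrime, h, supportOf_pointPrime]

lemma pointPrime_surjective : Function.Surjective (pointPrime : X → LatticeSpec X) := by
  intro p
  obtain ⟨P, hP⟩ := (isThomason_supportOf p.toTensorLocalizing).exists_eq_nonGeneralizations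
    (fun h => p.ne_top (by rw [carrier_eq_supportedOn, h, supportedOn_univ]))
    fun A B hA hB h => by
      have hp := p.prime (tensorLocalizingOf A hA) (tensorLocalizingOf B hB)
      simp only [carrier_inf_le_iff, carrier_le_iff, supportOf_tensorLocalizingOf] at hp
      exact hp h
  refine ⟨P, LatticeSpec.ext (TensorLocalizing.ext ?_)⟩
  rw [carrier_eq_supportedOn, carrier_eq_supportedOn p.toTensorLocalizing, supportOf_pointPrime, hP]

/-- The bijection between the points of `X` and the prime elements of the lattice. -/
def pointEquiv (X : Scheme.{u}) [QuasiSeparatedSpace X] [CompactSpace X] : X ≃ LatticeSpec X :=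
  Equiv.ofBijective _ ⟨pointPrime_injective, pointPrime_surjective⟩

lemma preimage_basicOpen (A : TensorLocalizing X) :
    pointEquiv X ⁻¹' LatticeSpec.basicOpen A = supportOf A := by
  ext P
  change ¬ A.carrier ≤ (pointPrime P).toTensorLocalizing.carrier ↔ _
  rw [carrier_le_iff, supportOf_pointPrime, (isThomason_supportOf A).subset_nonGeneralizations_iff,
    not_not]

lemma basicOpen_tensorLocalizingOf {D : Set (LatticeSpec X)} (h : IsThomason (pointEquiv X ⁻¹' D)) :
    LatticeSpec.basicOpen (tensorLocalizingOf _ h) = D := by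
  refine (pointEquiv X).surjective.preimage_injective ?_
  rw [preimage_basicOpen, supportOf_tensorLocalizingOf]

lemma isOpen_iff_isThomason (D : Set (LatticeSpec X)) :
    IsOpen D ↔ IsThomason (pointEquiv X ⁻¹' D) := by
  refine ⟨fun h => ?_, fun h => basicOpen_tensorLocalizingOf h ▸ .basic _ ⟨_, rfl⟩⟩
  have hle : (hochsterDual X).coinduced (pointEquiv X) ≤ .generateFrom
      (Set.range LatticeSpec.basicOpen) := by
    refine le_generateFrom ?_
    rintro _ ⟨A, rfl⟩
    change IsThomason (pointEquiv X ⁻¹' _)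
    rw [preimage_basicOpen]
    exact isThomason_supportOf A
  exact hle D h

lemma isOpen_iff_eq_basicOpen (D : Set (LatticeSpec X)) :
    IsOpen D ↔ ∃ A : TensorLocalizing X, D = LatticeSpec.basicOpen A := by
  refine ⟨fun h => ⟨_, (basicOpen_tensorLocalizingOf ((isOpen_iff_isThomason D).1 h)).symm⟩, ?_⟩
  rintro ⟨A, rfl⟩
  exact .basic _ ⟨A, rfl⟩

lemma induced_pointEquiv :
    TopologicalSpace.induced (pointEquiv X) inferInstance = hochsterDual X :=
  TopologicalSpace.ext_iff.2 fun V => by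
    refine isOpen_induced_iff.trans ⟨?_, fun hV => ⟨pointEquiv X '' V, ?_⟩⟩
    · rintro ⟨D, hD, rfl⟩
      exact (isOpen_iff_isThomason D).1 hD
    · rw [isOpen_iff_isThomason, Equiv.preimage_image]
      exact ⟨hV, rfl⟩

/-- The homeomorphism between `X` and `Spec(Qcoh X)`. -/
def pointHomeomorph (X : Scheme.{u}) [QuasiSeparatedSpace X] [CompactSpace X] : X ≃ₜ SpecQcoh X :=
  Equiv.toHomeomorphOfIsInducing (Y := SpecQcoh X) (pointEquiv X) ⟨by
    refine Eq.trans ?_ (induced_hochsterDual (pointEquiv X)).symm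
    rw [induced_pointEquiv, hochsterDual_hochsterDual]⟩

end Spectrum

/-! ### Endomorphisms of the structure sheaf in the quotient categories -/

section OneSection

variable {X : Scheme.{u}} {F : Qcoh X} {O : X.Opens}

/-- The section `1` of the structure sheaf, as a section of a sheaf of modules. -/
def oneSection (O : X.Opens) : Γ((structureModule X).obj, O) := (1 : Γ(X, O))

lemma onSections_resO (a : structureModule X ⟶ F) {O' : X.Opens} (h : O' ≤ O)
    (r : Γ(X, O)) : onSections a O' (resO h r) = res F.obj h (onSections a O r) :=
  app_res' a.hom h r

lemma app_eq_zero_of_onSections_one {a : structureModule X ⟶ F}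
    (h : onSections a O 1 = 0) {W : X.Opens} (hW : W ≤ O)
    (x : Γ((structureModule X).obj, W)) : a.hom.app W x = 0 := by
  have hone : a.hom.app W (oneSection W) = 0 := by
    have h' := onSections_resO a hW 1
    rwa [map_one, h, map_zero] at h'
  let r : Γ(X, W) := x
  have hr : r • oneSection W = x := mul_one r
  rw [← hr, Scheme.Modules.Hom.app_smul, hone, smul_zero]

lemma exists_onSections_one_eq_res (y : Γ(F.obj, ⊤)) :
    ∃ a : structureModule X ⟶ F, ∀ O : X.Opens, onSections a O 1 = res F.obj le_top y := by
  let σ : SheafOfModules.sections (R := X.ringCatSheaf) F.obj :=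
    PresheafOfModules.sectionsMk (fun O => res F.obj (le_top : O.unop ≤ ⊤) y)
      fun O O' f => res_res (F := F.obj) le_top f.unop.le y
  refine ⟨ObjectProperty.homMk ((SheafOfModules.unitHomEquiv F.obj).symm σ), fun O => ?_⟩
  exact congrArg (fun t => t.val (op O)) ((SheafOfModules.unitHomEquiv F.obj).apply_symm_apply σ)

end OneSection

section LeftFraction

variable {X : Scheme.{u}} {S T : ObjectProperty (Qcoh X)} [S.IsSerreClass] [T.IsSerreClass]

lemma exists_leftFraction (φ : End ((toQuotient S).obj (structureModule X))) :
    ∃ (F : Qcoh X) (s a : structureModule X ⟶ F), S.isoModSerre s ∧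
      φ ≫ (toQuotient S).map s = (toQuotient S).map a := by
  obtain ⟨ψ, hψ⟩ := Localization.exists_leftFraction (toQuotient S) S.isoModSerre φ
  refine ⟨ψ.Y', ψ.s, ψ.f, ψ.hs, ?_⟩
  rw [hψ]
  exact ψ.map_comp_map_s _ _

lemma quotientFunctor_map_toQuotient_map (h : S ≤ T) {F G : Qcoh X} (s : F ⟶ G) :
    (quotientFunctor h).map ((toQuotient S).map s) = (toQuotient T).map s :=
  (Functor.congr_hom (toQuotient_comp h) s).trans ((Category.id_comp _).trans (Category.comp_id _))

lemma quotientEndMap_comp_toQuotient_map (h : S ≤ T)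
    {φ : End ((toQuotient S).obj (structureModule X))} {F : Qcoh X} {s a : structureModule X ⟶ F}
    (hφ : φ ≫ (toQuotient S).map s = (toQuotient S).map a) :
    (quotientEndMap (structureModule X) h φ : End ((toQuotient T).obj (structureModule X))) ≫
      (toQuotient T).map s = (toQuotient T).map a := by
  have hmap := congrArg (quotientFunctor h).map hφ
  rw [Functor.map_comp, quotientFunctor_map_toQuotient_map] at hmap
  exact (congrArg (_ ≫ ·) (quotientFunctor_map_toQuotient_map h s)).symm.trans hmap

end LeftFraction

section IsoModSupported

variable {X : Scheme.{u}} {O : X.Opens}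

lemma eq_zero_of_supportedOn_compl {F : Qcoh X} (hF : supportedOn (O : Set X)ᶜ F)
    (x : Γ(F.obj, O)) : x = 0 := by
  refine sections_eq_zero (fun W : {W : X.Opens // ∃ h : W ≤ O, res F.obj h x = 0} => W.1)
    (fun W => W.2.1) (fun P hP => ?_) fun W => W.2.2
  obtain ⟨W, hW, hPW, hWO⟩ := Opens.isBasis_iff_nbhd.1 X.isBasis_affineOpens hP
  obtain ⟨f, hPf, hf⟩ := (vanishingAt_iff hW hPW F).1 (hF P (not_not.2 hP)) (res F.obj hWO x)
  refine Opens.mem_iSup.2 ⟨⟨X.basicOpen f, (X.basicOpen_le f).trans hWO, ?_⟩, hPf⟩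
  rw [← res_res hWO (X.basicOpen_le f), res_basicOpen_eq_zero hf]

lemma supportedOn_compl_anti {O' : X.Opens} (h : O' ≤ O) :
    supportedOn (O : Set X)ᶜ ≤ supportedOn (O' : Set X)ᶜ :=
  fun _ hF P hP => hF P fun hPO => hP fun hPO' => hPO (h hPO')

variable [QuasiSeparatedSpace X] {F G : Qcoh X} {s : F ⟶ G}
  (hs : (supportedOn (O : Set X)ᶜ).isoModSerre s)
include hs

lemma injective_app_of_isoModSerre : Function.Injective (s.hom.app O) := by
  refine (injective_iff_map_eq_zero _).2 fun x hx => ?_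
  obtain ⟨y, rfl⟩ := exists_kernel_ι_app_eq s O x hx
  rw [eq_zero_of_supportedOn_compl hs.1 y, map_zero]

lemma surjective_app_of_isoModSerre_of_isAffineOpen (hO : IsAffineOpen O) :
    Function.Surjective (s.hom.app O) := fun x =>
  have := preservesFiniteColimits_sections hO
  (ShortComplex.moduleCat_exact_iff _).1 ((ShortComplex.exact_cokernel s).map (sections O)) x
    (eq_zero_of_supportedOn_compl hs.2 _)

lemma bijective_app_of_isoModSerre : Function.Bijective (s.hom.app O) := by
  refine ⟨injective_app_of_isoModSerre hs, fun x => ?_⟩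
  have hres {W : X.Opens} (h : W ≤ O) : (supportedOn (W : Set X)ᶜ).isoModSerre s :=
    ⟨supportedOn_compl_anti h _ hs.1, supportedOn_compl_anti h _ hs.2⟩
  let V (W : {W : X.affineOpens // W.1 ≤ O}) : X.Opens := W.1.1
  have hV (W) : V W ≤ O := W.2
  choose y hy using fun W =>
    surjective_app_of_isoModSerre_of_isAffineOpen (hres (hV W)) W.1.2 (res G.obj (hV W) x)
  obtain ⟨z, hz⟩ := exists_sections_glue V hV (le_iSup_affineOpens O) y fun W W' =>
    injective_app_of_isoModSerre (hres (inf_le_left.trans (hV W))) (by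
      rw [app_res', app_res', hy, hy, res_res, res_res])
  exact ⟨z, sections_ext V hV (le_iSup_affineOpens O) fun W => by rw [← app_res', hz, hy]⟩

end IsoModSupported

section QuotientSections

variable {X : Scheme.{u}} [QuasiSeparatedSpace X] {S T : ObjectProperty (Qcoh X)}
  [S.IsSerreClass] [T.IsSerreClass] {O : X.Opens}

lemma isInvertedBy_sections (hS : S ≤ supportedOn (O : Set X)ᶜ) :
    S.isoModSerre.IsInvertedBy (sections O) := fun F G s hs => by
  rw [ConcreteCategory.isIso_iff_bijective]
  exact bijective_app_of_isoModSerre (s := s) ⟨hS _ hs.1, hS _ hs.2⟩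

/-- The functor of sections over `O` on the quotient category by a Serre subcategory of sheaves that
vanish at the points of `O`. -/
def quotientSections (hS : S ≤ supportedOn (O : Set X)ᶜ) :
    QuotientCategory S ⥤ ModuleCat.{u} Γ(X, O) :=
  Localization.Construction.lift (sections O) (isInvertedBy_sections hS)

lemma toQuotient_comp_quotientSections (hS : S ≤ supportedOn (O : Set X)ᶜ) :
    toQuotient S ⋙ quotientSections hS = sections O :=
  Localization.Construction.fac _ _

instance (hS : S ≤ supportedOn (O : Set X)ᶜ) : (quotientSections hS).Additive := by
  rw [Localization.functor_additive_iff (toQuotient S) S.isoModSerre,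
    toQuotient_comp_quotientSections]
  infer_instance

/-- The action of a morphism of the quotient category on the sections over `O`. -/
def quotientApp (hS : S ≤ supportedOn (O : Set X)ᶜ) {F G : Qcoh X}
    (φ : (toQuotient S).obj F ⟶ (toQuotient S).obj G) : Γ(F.obj, O) →ₗ[Γ(X, O)] Γ(G.obj, O) :=
  ((quotientSections hS).map φ).hom

variable (hS : S ≤ supportedOn (O : Set X)ᶜ)

lemma quotientApp_toQuotient_map {F G : Qcoh X} (s : F ⟶ G) (x : Γ(F.obj, O)) :
    quotientApp hS ((toQuotient S).map s) x = s.hom.app O x := by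
  have h := Functor.congr_hom (toQuotient_comp_quotientSections hS) s
  exact congr(($(h.trans ((Category.id_comp _).trans (Category.comp_id _)))).hom x)

lemma quotientApp_id (F : Qcoh X) (x : Γ(F.obj, O)) :
    quotientApp hS (𝟙 ((toQuotient S).obj F)) x = x :=
  congr(($((quotientSections hS).map_id ((toQuotient S).obj F))).hom x)

lemma quotientApp_comp {F G H : Qcoh X} (φ : (toQuotient S).obj F ⟶ (toQuotient S).obj G)
    (ψ : (toQuotient S).obj G ⟶ (toQuotient S).obj H) (x : Γ(F.obj, O)) :
    quotientApp hS (φ ≫ ψ) x = quotientApp hS ψ (quotientApp hS φ x) :=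
  congr(($((quotientSections hS).map_comp φ ψ)).hom x)

lemma quotientApp_zero (F G : Qcoh X) :
    quotientApp hS (0 : (toQuotient S).obj F ⟶ (toQuotient S).obj G) = 0 :=
  congrArg ModuleCat.Hom.hom ((quotientSections hS).map_zero _ _)

lemma quotientApp_add {F G : Qcoh X} (φ ψ : (toQuotient S).obj F ⟶ (toQuotient S).obj G) :
    quotientApp hS (φ + ψ) = quotientApp hS φ + quotientApp hS ψ :=
  congrArg ModuleCat.Hom.hom (quotientSections hS).map_add

/-- The function `φ(1)` on `O` defined by an endomorphism `φ` of the structure sheaf in the quotient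
category. -/
def endToSections : End ((toQuotient S).obj (structureModule X)) →+* Γ(X, O) where
  toFun φ := quotientApp hS φ (oneSection O)
  map_one' := quotientApp_id hS _ _
  map_zero' := congr($(quotientApp_zero hS (structureModule X) (structureModule X)) (oneSection O))
  map_add' φ ψ := congr($(quotientApp_add hS φ ψ) (oneSection O))
  map_mul' φ ψ := by
    let a : Γ(X, O) := quotientApp hS φ (oneSection O)
    let b : Γ(X, O) := quotientApp hS ψ (oneSection O)
    have hb : b • oneSection O = b := mul_one b
    have hab : quotientApp hS φ (b • oneSection O) = b • a :=
      (quotientApp hS φ).map_smul b (oneSection O)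
    rw [hb] at hab
    exact (quotientApp_comp hS ψ φ _).trans (hab.trans (mul_comm b a))

variable {hS}

lemma onSections_endToSections {φ : End ((toQuotient S).obj (structureModule X))} {F : Qcoh X}
    {s a : structureModule X ⟶ F} (h : φ ≫ (toQuotient S).map s = (toQuotient S).map a) :
    onSections s O (endToSections hS φ) = onSections a O 1 :=
  calc onSections s O (endToSections hS φ)
    _ = quotientApp hS ((toQuotient S).map s) (quotientApp hS φ (oneSection O)) :=
      (quotientApp_toQuotient_map hS s _).symm
    _ = quotientApp hS ((toQuotient S).map a) (oneSection O) := by rw [← quotientApp_comp, h]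
    _ = onSections a O 1 := quotientApp_toQuotient_map hS a _

lemma endToSections_quotientEndMap (h : S ≤ T) {O' : X.Opens} (hO : O' ≤ O)
    (hT : T ≤ supportedOn (O' : Set X)ᶜ) (φ : End ((toQuotient S).obj (structureModule X))) :
    endToSections hT (quotientEndMap (structureModule X) h φ) = resO hO (endToSections hS φ) := by
  obtain ⟨F, s, a, hs, hφ⟩ := exists_leftFraction φ
  have hs' : (supportedOn (O' : Set X)ᶜ).isoModSerre s := ⟨hT _ (h _ hs.1), hT _ (h _ hs.2)⟩
  refine (bijective_app_of_isoModSerre hs').1 ?_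
  refine (onSections_endToSections (quotientEndMap_comp_toQuotient_map h hφ)).trans
    (Eq.trans ?_ (onSections_resO s hO _).symm)
  rw [onSections_endToSections hφ, ← onSections_resO, map_one]

end QuotientSections

section BijectiveEndToSections

variable {X : Scheme.{u}} [QuasiSeparatedSpace X] {O : X.Opens}

lemma supportedOn_compl_image {F : Qcoh X} {a : structureModule X ⟶ F}
    (h : onSections a O 1 = 0) : supportedOn (O : Set X)ᶜ (Abelian.image a) := by
  intro P hP
  obtain ⟨W, hW, hPW, hWO⟩ := Opens.isBasis_iff_nbhd.1 X.isBasis_affineOpens (not_not.1 hP)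
  refine vanishingAt_of_sections hW hPW fun x => ?_
  obtain ⟨x, rfl⟩ := surjective_of_epi (Abelian.factorThruImage a) hW x
  refine injective_of_mono (Abelian.image.ι a) W (Eq.trans ?_ (map_zero _).symm)
  exact congr(($(Abelian.image.fac a)).hom.app W x).trans (app_eq_zero_of_onSections_one h hWO x)

lemma surjective_res_restrictPushforward [CompactSpace O] (F : Qcoh X) :
    Function.Surjective (res ((restrictPushforward O).obj F).obj (le_top : O ≤ ⊤)) := fun x =>
  have h : O.ι ''ᵁ O.ι ⁻¹ᵁ O ≤ O.ι ''ᵁ O.ι ⁻¹ᵁ ⊤ := O.ι.image_mono (O.ι.preimage_mono le_top)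
  have h' : O.ι ''ᵁ O.ι ⁻¹ᵁ ⊤ ≤ O.ι ''ᵁ O.ι ⁻¹ᵁ O := by
    rw [ι_image_preimage_eq, ι_image_preimage_eq, top_inf_eq, inf_idem]
  ⟨res F.obj h' x, (res_res (F := F.obj) h' h x).trans (res_self _ _)⟩

variable {S : ObjectProperty (Qcoh X)} [S.IsSerreClass]
  (hS : S ≤ supportedOn (O : Set X)ᶜ) (hS' : supportedOn (O : Set X)ᶜ ≤ S)
include hS'

lemma injective_endToSections : Function.Injective (endToSections hS) := by
  refine (injective_iff_map_eq_zero _).2 fun φ hφ => ?_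
  obtain ⟨F, s, a, hs, h⟩ := exists_leftFraction φ
  have ha : onSections a O 1 = 0 := by
    rw [← onSections_endToSections (hS := hS) h, hφ]
    exact map_zero (s.hom.app O).hom
  have := Localization.inverts (toQuotient S) S.isoModSerre s hs
  rw [(ObjectProperty.SerreClassLocalization.map_eq_zero_iff (toQuotient S) S a).2
    (hS' _ (supportedOn_compl_image ha))] at h
  exact (cancel_mono ((toQuotient S).map s)).1 (h.trans zero_comp.symm)

lemma surjective_endToSections (hO : IsCompact (O : Set X)) :
    Function.Surjective (endToSections hS) := by
  intro r
  have : CompactSpace O := isCompact_iff_compactSpace.1 hO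
  let s := toRestrictPushforward O (structureModule X)
  have hs : (supportedOn (O : Set X)ᶜ).isoModSerre s :=
    isoModSerre_toRestrictPushforward subset_rfl _
  obtain ⟨y, hy⟩ := surjective_res_restrictPushforward (structureModule X) (onSections s O r)
  obtain ⟨a, ha⟩ := exists_onSections_one_eq_res y
  have := Localization.inverts (toQuotient S) S.isoModSerre s ⟨hS' _ hs.1, hS' _ hs.2⟩
  refine ⟨(toQuotient S).map a ≫ inv ((toQuotient S).map s),
    (bijective_app_of_isoModSerre hs).1 ?_⟩
  refine (onSections_endToSections (s := s) (a := a) ?_).trans ((ha O).trans hy)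
  rw [Category.assoc, IsIso.inv_hom_id, Category.comp_id]

end BijectiveEndToSections

/-! ### The structure sheaf of the spectrum -/

lemma isIso_sheafifyLift {C : Type*} [Category C] (J : GrothendieckTopology C)
    {A : Type*} [Category A] {FA : A → A → Type*} {CA : A → Type*}
    [∀ R R', FunLike (FA R R') (CA R) (CA R')] [ConcreteCategory A FA] [HasWeakSheafify J A]
    [J.WEqualsLocallyBijective A] {P Q : Cᵒᵖ ⥤ A} (f : P ⟶ Q) (hQ : Presheaf.IsSheaf J Q)
    [Presheaf.IsLocallyInjective J f] [Presheaf.IsLocallySurjective J f] :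
    IsIso (sheafifyLift J f hQ) := by
  have hf : J.W f := J.W_of_isLocallyBijective f
  rw [← toSheafify_sheafifyLift J f hQ, J.W.precomp_iff _ _ (J.W_toSheafify P)] at hf
  let g : (presheafToSheaf J A).obj P ⟶ ⟨Q, hQ⟩ := ⟨sheafifyLift J f hQ⟩
  have : IsIso g := (J.W_sheafToPresheaf_map_iff_isIso g).1 hf
  exact (sheafToPresheaf J A).map_isIso g

section StructureSheaf

variable {X : Scheme.{u}} [QuasiSeparatedSpace X] [CompactSpace X]

/-- The open subset of `X` that corresponds to an open subset of `Spec(Qcoh X)`. -/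
abbrev opensOf (U : Opens (SpecQcoh X)) : X.Opens := Opens.comap (pointHomeomorph X) U

lemma opensOf_le_opensOf_iff {U V : Opens (SpecQcoh X)} : opensOf V ≤ opensOf U ↔ V ≤ U :=
  (pointHomeomorph X).symm.opensCongr.le_iff_le

lemma opensOf_surjective : Function.Surjective (opensOf : Opens (SpecQcoh X) → X.Opens) :=
  (pointHomeomorph X).symm.opensCongr.surjective

lemma opensOf_iSup {ι : Type*} (U : ι → Opens (SpecQcoh X)) :
    opensOf (⨆ i, U i) = ⨆ i, opensOf (U i) :=
  (pointHomeomorph X).symm.opensCongr.map_iSup U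

lemma supportedAway_eq_supportedOn (U : Opens (SpecQcoh X)) :
    supportedAway U = supportedOn (opensOf U : Set X)ᶜ := by
  ext F
  rw [supportedAway_iff]
  refine ⟨fun h P hP => ?_, fun h p hp => ?_⟩
  · rw [← subcategory_pointPrime]
    exact h (pointPrime P) (not_not.1 hP)
  · obtain ⟨P, rfl⟩ := pointPrime_surjective p
    rw [subcategory_pointPrime]
    exact h P (not_not.2 hp)

variable (X)

/-- The structure sheaf of `X`, as a presheaf on `Spec(Qcoh X)`, in the universe of the values of
`endPresheaf X`. -/
def functionPresheaf : TopCat.Presheaf RingCat.{u + 1} (SpecQcoh X) where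
  obj U := RingCat.of (ULift.{u + 1} Γ(X, opensOf U.unop))
  map i := RingCat.ofHom ((ULift.ringEquiv.symm.toRingHom.comp
    (resO (opensOf_le_opensOf_iff.2 i.unop.le))).comp ULift.ringEquiv.toRingHom)
  map_id U := by
    ext x
    exact resO_self _ _
  map_comp i j := by
    ext x
    exact (resO_resO _ _ _).symm

lemma isSheaf_functionPresheaf : (functionPresheaf X).IsSheaf := by
  rw [TopCat.Presheaf.isSheaf_iff_isSheafUniqueGluing]
  intro ι U sf hsf
  obtain ⟨s, hs, hu⟩ := TopCat.Sheaf.existsUnique_gluing' X.sheaf (fun i => opensOf (U i))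
    (opensOf (iSup U)) (fun i => homOfLE (opensOf_le_opensOf_iff.2 (le_iSup U i)))
    (opensOf_iSup U).le (fun i => (sf i).down) fun i j => congrArg ULift.down (hsf i j)
  refine ⟨ULift.up s, fun i => congrArg ULift.up (hs i), fun t ht => ?_⟩
  exact congrArg ULift.up (hu t.down fun i => congrArg ULift.down (ht i))

/-- The comparison of the presheaf of endomorphisms with the presheaf of functions: it sends an
endomorphism `φ` to the function `φ(1)`. -/
def endToFunction : endPresheaf X ⟶ functionPresheaf X where
  app U := RingCat.ofHom (ULift.ringEquiv.symm.toRingHom.comp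
    (endToSections (supportedAway_eq_supportedOn U.unop).le))
  naturality U V i := by
    ext φ
    exact congrArg ULift.up (endToSections_quotientEndMap (supportedAway_anti i.unop.le)
      (opensOf_le_opensOf_iff.2 i.unop.le) (supportedAway_eq_supportedOn V.unop).le φ)

instance : Presheaf.IsLocallyInjective (Opens.grothendieckTopology (SpecQcoh X))
    (endToFunction X) :=
  Presheaf.isLocallyInjective_of_injective _ _ fun U _ _ h =>
    injective_endToSections _ (supportedAway_eq_supportedOn U.unop).ge (congrArg ULift.down h)

variable {X} in
lemma surjective_endToFunction_app {U : Opens (SpecQcoh X)}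
    (hU : IsCompact (opensOf U : Set X)) :
    Function.Surjective ((endToFunction X).app (op U)) := fun t =>
  have ⟨φ, hφ⟩ := surjective_endToSections (supportedAway_eq_supportedOn U).le
    (supportedAway_eq_supportedOn U).ge hU t.down
  ⟨φ, congrArg ULift.up hφ⟩

instance : Presheaf.IsLocallySurjective (Opens.grothendieckTopology (SpecQcoh X))
    (endToFunction X) where
  imageSieve_mem {U} t := by
    intro p hp
    obtain ⟨P, rfl⟩ := (pointHomeomorph X).surjective p
    obtain ⟨W, hW, hPW, hWU⟩ := Opens.isBasis_iff_nbhd.1 X.isBasis_affineOpens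
      (show P ∈ opensOf U from hp)
    obtain ⟨V, rfl⟩ := opensOf_surjective W
    exact ⟨V, homOfLE (opensOf_le_opensOf_iff.1 hWU),
      surjective_endToFunction_app hW.isCompact _, hPW⟩

/-- The ring isomorphism from the sections over `U` of the structure sheaf of `Spec(Qcoh X)` to the
functions on the corresponding open subset of `X`. -/
def sheafEquiv (U : Opens (SpecQcoh X)) :
    (specQcohSheaf X).obj.obj (op U) ≃+* Γ(X, opensOf U) :=
  have := isIso_sheafifyLift _ (endToFunction X) (isSheaf_functionPresheaf X)
  (asIso ((sheafifyLift (Opens.grothendieckTopology (SpecQcoh X)) (endToFunction X)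
    (isSheaf_functionPresheaf X)).app (op U))).ringCatIsoToRingEquiv.trans ULift.ringEquiv

lemma sheafEquiv_map {U V : Opens (SpecQcoh X)} (h : V ≤ U)
    (s : (specQcohSheaf X).obj.obj (op U)) :
    sheafEquiv X V ((specQcohSheaf X).obj.map (homOfLE h).op s) =
      resO (opensOf_le_opensOf_iff.2 h) (sheafEquiv X U s) :=
  congrArg ULift.down (congr($((sheafifyLift (Opens.grothendieckTopology (SpecQcoh X))
    (endToFunction X) (isSheaf_functionPresheaf X)).naturality (homOfLE h).op) s))

lemma sheafEquiv_toSpecQcohSheaf {U : Opens (SpecQcoh X)}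
    (φ : End ((toQuotient (supportedAway U)).obj (structureModule X))) :
    sheafEquiv X U (toSpecQcohSheaf X U φ) =
      endToSections (supportedAway_eq_supportedOn U).le φ :=
  congrArg ULift.down (congr(($(toSheafify_sheafifyLift
    (Opens.grothendieckTopology (SpecQcoh X)) (endToFunction X)
    (isSheaf_functionPresheaf X))).app (op U) φ))

end StructureSheaf

end
end Reconstruction

theorem mainTheorem2 (X : Scheme.{u}) [CompactSpace X] [QuasiSeparatedSpace X] :
    (∀ D : Set (LatticeSpec X), IsOpen D ↔ ∃ A : TensorLocalizing X, D = LatticeSpec.basicOpen A) ∧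
    ∃ f : X ≃ₜ SpecQcoh X, (∀ P : X, (f P).subcategory = vanishingAt P) ∧
      ∃ fSharp : ∀ U : Opens (SpecQcoh X),
          (specQcohSheaf X).obj.obj (op U) ≃+* Γ(X, Opens.comap f U),
        (∀ (U V : Opens (SpecQcoh X)) (h : V ≤ U) (s : (specQcohSheaf X).obj.obj (op U)),
          fSharp V ((specQcohSheaf X).obj.map (homOfLE h).op s) =
            X.presheaf.map (homOfLE (show Opens.comap f V ≤ Opens.comap f U from
              fun _ hx => h hx)).op (fSharp U s)) ∧
        (∀ (U : Opens (SpecQcoh X))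
          (φ : End ((toQuotient (supportedAway U)).obj (structureModule X)))
          (F : Qcoh X) (s a : structureModule X ⟶ F), (supportedAway U).isoModSerre s →
          φ ≫ (toQuotient (supportedAway U)).map s = (toQuotient (supportedAway U)).map a →
          onSections s _ (fSharp U (toSpecQcohSheaf X U φ)) = onSections a _ 1) := by
  refine ⟨isOpen_iff_eq_basicOpen, pointHomeomorph X, subcategory_pointPrime, sheafEquiv X,
    fun U V h s => sheafEquiv_map X h s, fun U φ F s a _ h => ?_⟩
  rw [sheafEquiv_toSpecQcohSheaf]
  exact onSections_endToSections h
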